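/- **Setting.** Let $d\in\{2,3,\dots\}\cup\{\infty\}$, let $A$ be an alphabet with $d$ symbols (any infinite alphabet, for instance $\mathbb Z$, if $d=\infty$), and let $\star\notin A$. Let $\sigma$ be the left shift on sequences over $A\cup\{\star\}$. A (non-trivial) *kneading sequence* $\nu$ is either a non-periodic infinite sequence over $A$, or a $\star$-periodic sequence $\overline{\nu_1\dots\nu_{p-1}\star}$ with $\nu_i\in A$ and $p\ge 2$. The *critical point* is $\star\nu$, and *precritical points* are the sequences $w\star\nu$, with $w$ a finite word over $A$ (depth $|w|+1$). The set $X_\nu$ consists of $\nu$, all $\sigma^k(\star\nu)$ with $k\ge1$, all precritical points, and all sequences over $A$ that are not of the form $w\nu$ with $w$ a non-empty word over $A$. Let $\operatorname{diff}(a,b)\in\{1,2,\dots\}\cup\{\infty\}$ be the first position at which $a$ and $b$ differ, where $\star$ is a wild card. For non-periodic $\nu$, the sets $U_k(a)$, $a\in X_\nu$, $k\ge1$, of all $b\in X_\nu$ with $\operatorname{diff}(a,b)\ge k$ that are not precritical points $\ne a$ of depth $\le k-1$, form a basis of the topology of $X_\nu$. **Critical path.** Start with the ordered set $P_1=\{\star\nu\prec\nu\}$.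 Construct $P_{n+1}$ from $P_n$ by inserting, between any two adjacent points $a\prec b$ with $k=\operatorname{diff}(a,b)<\infty$, the precritical point $w\star\nu$ of depth $k$ for which $w$ does not differ from the first $k-1$ entries of $a$ and of $b$. Let $P_\infty=\bigcup_n P_n$. Add to $P_\infty$ all *limit points*: sequences $x\in X_\nu$ over $A$ for which there are nested intervals $[a_n,b_n]$ between adjacent points of $P_n$ with $\operatorname{diff}(a_n,x)\to\infty$ and $\operatorname{diff}(b_n,x)\to\infty$ (if $[a_n,b_n]$ is eventually a constant interval $[a,b]$ with $\operatorname{diff}(a,b)=\infty$, then $x$ is called the central itinerary of this gap). The order $\prec$ extends to these points. If $\nu$ is $\star$-periodic and $x$ is a limit point whose intervals eventually have a constant boundary point $\rho\in P_\infty$, insert between $x$ and $\rho$ an abstract open interval, so that they become the boundary points of a *Fatou interval* $[x,\rho]\cong[0,1]$. The resulting ordered set is the *critical path* $C_\nu$. Extend $\sigma$ to Fatou intervals by letting it map $[x,\rho]$ to $[\sigma x,\sigma\rho]$ by an arbitrary homeomorphism that sends $x$ to $\sigma x$ and $\rho$ to $\sigma\rho$. **Hubbard tree.** $T=\mathcal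 H(\nu)=\bigcup_{n\ge0}\sigma^n(C_\nu)$. If $\nu$ is non-periodic, $T$ has the subspace topology of $X_\nu$. If $\nu$ is $\star$-periodic of period $p$, then $U\subset T$ is open if and only if for all $0\le k\le p-1$ the set $\{c\in C_\nu:\sigma^k(c)\in U\}$ is open in the order topology of $C_\nu$. A *path* between $x$ and $y$ is a subset of $T$ with a homeomorphism from $[0,1]$ onto it that sends $0$ to $x$ and $1$ to $y$. A point $x\in T$ is an *endpoint* if $T\setminus\{x\}$ is connected, and a *branch point* if $T\setminus\{x\}$ has at least three connected components. The *critical orbit* is $\{\sigma^k(\star\nu):k\ge0\}$. **Theorem.** For every kneading sequence $\nu$ as above, $T=\mathcal H(\nu)$ has the following properties. 1. $\sigma:T\to T$ is continuous and surjective. 2. Every point of $T$ has at most $d$ inverse images under $\sigma:T\to T$. 3. At every point other than the critical point, $\sigma$ is a local homeomorphism onto its image: every $x\in T\setminus\{\star\nu\}$ has an open neighbourhood $U$ in $T$ such that $\sigma|_U:U\to\sigma(U)$ is a homeomorphism, where $\sigma(U)$ has the subspace topology. 4. All endpoints of $T$ are on the critical orbit. 5. (Expansivity) If $x\neq y$ are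 branch points or points on the critical orbit, then there is a unique path $[x,y]$ in $T$ between $x$ and $y$, and there is an $n\ge0$ such that $\sigma^n([x,y])$ contains the critical point. -/

import Mathlib

open Set Filter Topology

noncomputable section

namespace Kneading

/-! ### Itineraries and kneading sequences -/

/-- Infinite sequences over the alphabet `A` extended by the symbol `⋆`; here `none` is `⋆`.
Positions are counted from `0`. -/
abbrev Itin (A : Type*) := ℕ → Option A

variable {A : Type*}

/-- The left shift `σ` on sequences. -/
def shift (x : Itin A) : Itin A := fun i => x (i + 1)

/-- Put one symbol in front of a sequence. -/
def cons (o : Option A) (x : Itin A) : Itin A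
  | 0 => o
  | i + 1 => x i

/-- The concatenation `w x` of a finite word `w` over `A` and a sequence `x`. -/
def wordCons (w : List A) (x : Itin A) : Itin A :=
  w.foldr (fun e y => cons (some e) y) x

/-- `x` is a sequence over `A`, that is, without `⋆`. -/
def StarFree (x : Itin A) : Prop := ∀ i, x i ≠ none

/-- A non-periodic sequence over `A` (it may be strictly preperiodic). -/
def IsNonPeriodic (ν : Itin A) : Prop :=
  StarFree ν ∧ ¬ ∃ p, 0 < p ∧ ∀ i, ν (i + p) = ν i

/-- A periodic sequence in which `⋆` occurs exactly once in the period, at its last position. -/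
def IsStarPeriodic (ν : Itin A) : Prop :=
  ∃ p, 0 < p ∧ ∀ i, ν (i + p) = ν i ∧ (ν i = none ↔ p ∣ i + 1)

/-- Abstract kneading sequences, other than the trivial one `⋆⋆⋆…`. -/
def IsKneading (ν : Itin A) : Prop :=
  (IsNonPeriodic ν ∨ IsStarPeriodic ν) ∧ ν ≠ fun _ => none

/-- The critical point `⋆ν`. -/
def critPt (ν : Itin A) : Itin A := cons none ν

/-- The precritical point `w⋆ν`; its depth is `|w| + 1`. -/
def precrit (ν : Itin A) (w : List A) : Itin A := wordCons w (critPt ν)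

/-- The collection `X_ν`: the critical value `ν`, the postcritical points, the precritical points,
and all sequences over `A` that are not of the form `wν` with a non-empty word `w` over `A`. -/
def itinSpace (ν : Itin A) : Set (Itin A) :=
  {x | x = ν ∨ (∃ k, 1 ≤ k ∧ x = shift^[k] (critPt ν)) ∨ (∃ w, x = precrit ν w) ∨
    (StarFree x ∧ ¬ ∃ w : List A, w ≠ [] ∧ x = wordCons w ν)}

/-- Two entries differ; `⋆` is a wild card. -/
def Differ (o o' : Option A) : Prop := ∃ e e', o = some e ∧ o' = some e' ∧ e ≠ e'

/-- The position (counted from `1`) of the first difference of two sequences, or `∞`. -/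
def diff (a b : Itin A) : ℕ∞ := sInf {n | ∃ i : ℕ, Differ (a i) (b i) ∧ n = (i : ℕ∞) + 1}

/-! ### The topology of `X_ν` for non-periodic `ν` -/

/-- The cylinder `N_k(a)`. -/
def cyl (ν : Itin A) (k : ℕ) (a : Itin A) : Set (Itin A) :=
  {b | b ∈ itinSpace ν ∧ (k : ℕ∞) ≤ diff a b}

/-- `∂_k(a)`: the precritical points in `N_k(a) \ {a}` of depth at most `k - 1`, except `ν`. -/
def cylBdry (ν : Itin A) (k : ℕ) (a : Itin A) : Set (Itin A) :=
  {b | b ∈ cyl ν k a \ {a} ∧ b ≠ ν ∧ ∃ w, b = precrit ν w ∧ (w.length + 1) + 1 ≤ k}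

/-- The basic neighbourhood `U_k(a) = N_k(a) \ ∂_k(a)`. -/
def basicNhd (ν : Itin A) (k : ℕ) (a : Itin A) : Set (Itin A) := cyl ν k a \ cylBdry ν k a

/-! ### Precritical points on the critical path -/

open Classical in
/-- The precritical point `w''⋆ν` of depth `k = diff a b`, where `w''` is the word of length
`k - 1` that does not differ from the first `k - 1` entries of `a` and `b`. -/
def midPt (ν a b : Itin A) : Itin A := fun i =>
  if i + 1 < (diff a b).toNat then (if a i = none then b i else a i)
  else if i + 1 = (diff a b).toNat then none
  else ν (i - (diff a b).toNat)

open Classical in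
/-- Insert a precritical point between any two adjacent elements `a`, `b` with `diff a b < ∞`. -/
def insertMids (ν : Itin A) : List (Itin A) → List (Itin A)
  | [] => []
  | [a] => [a]
  | a :: b :: l =>
    if diff a b = ⊤ then a :: insertMids ν (b :: l)
    else a :: midPt ν a b :: insertMids ν (b :: l)

/-- The finite ordered sets of precritical points on the critical path, listed in increasing
order, starting with `⋆ν ≺ ν` (the index `n` here is `n + 1` in the usual numbering `P_1, P_2, …`). -/
def precPts (ν : Itin A) : ℕ → List (Itin A)
  | 0 => [critPt ν, ν]
  | n + 1 => insertMids ν (precPts ν n)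

/-- The set `P_∞`. -/
def PInf (ν : Itin A) : Set (Itin A) := {ρ | ∃ n, ρ ∈ precPts ν n}

/-- The order `ρ ⪯ ρ'` on `P_∞`. -/
def PLe (ν ρ ρ' : Itin A) : Prop :=
  ρ ∈ PInf ν ∧ ρ' ∈ PInf ν ∧ (ρ = ρ' ∨ ∃ n, List.Sublist [ρ, ρ'] (precPts ν n))

/-! ### Limit points, central itineraries, Fatou intervals and the critical path -/

/-- `x ∈ X_ν` is a sequence over `A` that is the limit of the nested intervals `[a n, b n]` between
adjacent points of the `n`-th set of precritical points. If a gap is reached (so that the intervals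
are eventually a constant interval `[a, b]` with `diff a b = ∞`), then `x` is the central itinerary
of the gap. -/
def IsNestLimit (ν x : Itin A) (a b : ℕ → Itin A) : Prop :=
  x ∈ itinSpace ν ∧ StarFree x ∧
  (∀ n, List.IsInfix [a n, b n] (precPts ν n)) ∧
  (∀ n, a (n + 1) = a n ∨ b (n + 1) = b n) ∧
  Tendsto (fun n => diff (a n) x) atTop (𝓝 ⊤) ∧
  Tendsto (fun n => diff (b n) x) atTop (𝓝 ⊤)

/-- The itineraries on the critical path: the points of `P_∞`, their limit points, and the central
itineraries in the gaps. -/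
def pathItin (ν : Itin A) : Set (Itin A) :=
  PInf ν ∪ {x | ∃ a b, IsNestLimit ν x a b}

/-- The intervals `[a n, b n]` determine the position of `x` on the critical path. -/
def Brackets (ν x : Itin A) (a b : ℕ → Itin A) : Prop :=
  (x ∈ PInf ν ∧ (∀ n, a n = x) ∧ ∀ n, b n = x) ∨ IsNestLimit ν x a b

/-- The order `x ≺ y` on the itineraries of the critical path. -/
def itinLt (ν x y : Itin A) : Prop :=
  x ≠ y ∧ ∃ a b a' b', Brackets ν x a b ∧ Brackets ν y a' b' ∧ ∃ n, PLe ν (b n) (a' n)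

/-- The order `x ⪯ y` on the itineraries of the critical path. -/
def itinLe (ν x y : Itin A) : Prop := x = y ∨ itinLt ν x y

/-- For `⋆`-periodic `ν`, the pairs `x`, `ρ` that bound a Fatou interval `[x, ρ]` on the critical
path: `ρ` is in `P_∞`, and `x` is a central itinerary in a gap with boundary point `ρ`, or the limit
at `ρ` from one side of points of `P_∞` (so that `diff x ρ = ∞`). -/
def FatouPair (ν x ρ : Itin A) : Prop :=
  IsStarPeriodic ν ∧ ∃ a b, IsNestLimit ν x a b ∧
    ((∀ᶠ n in atTop, a n = ρ) ∨ ∀ᶠ n in atTop, b n = ρ)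

/-- Points: itineraries, and interior points of the Fatou intervals. The point `fatou x ρ t` is the
point at parameter `t` in the interval `[x, ρ]`, where `x` is at `t = 0` and `ρ` at `t = 1`. -/
inductive Pt (A : Type*)
  | itin (x : Itin A)
  | fatou (x ρ : Itin A) (t : Ioo (0 : ℝ) 1)

/-- The critical path `C_ν`. -/
def critPath (ν : Itin A) : Set (Pt A) :=
  {z | (∃ x ∈ pathItin ν, z = .itin x) ∨ ∃ x ρ t, FatouPair ν x ρ ∧ z = .fatou x ρ t}

/-- The order `≺` on the critical path. -/
def pathLt (ν : Itin A) : Pt A → Pt A → Prop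
  | .itin x, .itin y => itinLt ν x y
  | .itin x, .fatou y ρ _ => itinLe ν x y ∧ itinLe ν x ρ
  | .fatou x ρ _, .itin y => itinLe ν x y ∧ itinLe ν ρ y
  | .fatou x ρ t, .fatou x' ρ' t' =>
    (x = x' ∧ ρ = ρ' ∧ ((itinLt ν x ρ ∧ t < t') ∨ (itinLt ν ρ x ∧ t' < t))) ∨
    (itinLe ν x x' ∧ itinLe ν x ρ' ∧ itinLe ν ρ x' ∧ itinLe ν ρ ρ')

/-- The order topology on the critical path, generated by the open rays. -/
@[reducible] def pathTopology (ν : Itin A) : TopologicalSpace (critPath ν) :=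
  TopologicalSpace.generateFrom
    {V | ∃ u : critPath ν, V = {z | pathLt ν u.1 z.1} ∨ V = {z | pathLt ν z.1 u.1}}

/-! ### The Hubbard tree -/

/-- A choice, for every Fatou interval `[x, ρ]`, of the homeomorphism (in parameters) by which `σ`
maps it to `[σ x, σ ρ]`. -/
abbrev FatouMaps (A : Type*) := Itin A → Itin A → (Ioo (0 : ℝ) 1 ≃o Ioo (0 : ℝ) 1)

/-- The map `σ`, extended to the Fatou intervals. -/
def ptShift (h : FatouMaps A) : Pt A → Pt A
  | .itin x => .itin (shift x)
  | .fatou x ρ t => .fatou (shift x) (shift ρ) (h x ρ t)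

/-- The Hubbard tree as a set: the union of the `σ^n(C_ν)`. -/
def hubbardTree (h : FatouMaps A) (ν : Itin A) : Set (Pt A) :=
  ⋃ n : ℕ, (ptShift h)^[n] '' critPath ν

theorem ptShift_mem (h : FatouMaps A) (ν : Itin A) {z : Pt A} (hz : z ∈ hubbardTree h ν) :
    ptShift h z ∈ hubbardTree h ν := by
  obtain ⟨n, c, hc, rfl⟩ := mem_iUnion.1 hz
  exact mem_iUnion.2 ⟨n + 1, c, hc, Function.iterate_succ_apply' _ _ _⟩

theorem iterate_mem (h : FatouMaps A) (ν : Itin A) (n : ℕ) (c : critPath ν) :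
    (ptShift h)^[n] c.1 ∈ hubbardTree h ν :=
  mem_iUnion.2 ⟨n, c.1, c.2, rfl⟩

theorem critPt_mem (h : FatouMaps A) (ν : Itin A) : Pt.itin (critPt ν) ∈ hubbardTree h ν :=
  mem_iUnion.2 ⟨0, _, Or.inl ⟨critPt ν, Or.inl ⟨0, by simp [precPts]⟩, rfl⟩, rfl⟩

/-- The map `σ` on the Hubbard tree. -/
def treeMap (h : FatouMaps A) (ν : Itin A) (z : hubbardTree h ν) : hubbardTree h ν :=
  ⟨ptShift h z.1, ptShift_mem h ν z.2⟩

/-- The map `σ^n` from the critical path to the Hubbard tree. -/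
def pathToTree (h : FatouMaps A) (ν : Itin A) (n : ℕ) (c : critPath ν) : hubbardTree h ν :=
  ⟨(ptShift h)^[n] c.1, iterate_mem h ν n c⟩

/-- The critical point in the Hubbard tree. -/
def treeCrit (h : FatouMaps A) (ν : Itin A) : hubbardTree h ν :=
  ⟨.itin (critPt ν), critPt_mem h ν⟩

open Classical in
/-- The topology of the Hubbard tree. If `ν` is `⋆`-periodic with period `p`, it is the quotient
topology of the intervals that form the sets `σ^k(C_ν)`, `k ≤ p - 1`. If `ν` is non-periodic,
it is the subspace topology of `X_ν`, for which the sets `U_k(a)` with `k ≥ 1` form a basis. -/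
instance treeTopology (h : FatouMaps A) (ν : Itin A) : TopologicalSpace (hubbardTree h ν) :=
  if IsStarPeriodic ν then
    ⨆ k : Fin (Function.minimalPeriod shift ν),
      TopologicalSpace.coinduced (pathToTree h ν k) (pathTopology ν)
  else
    TopologicalSpace.generateFrom
      {V | ∃ a ∈ itinSpace ν, ∃ k : ℕ, 1 ≤ k ∧ V = {z | ∃ b ∈ basicNhd ν k a, z.1 = .itin b}}

/-! ### Trees -/

/-- `P` is a path from `x` to `y`: a subset homeomorphic to `[0,1]` with endpoints `x` and `y`. -/
def IsPathBetween {T : Type*} [TopologicalSpace T] (P : Set T) (x y : T) : Prop :=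
  ∃ γ : unitInterval → T, IsEmbedding γ ∧ γ 0 = x ∧ γ 1 = y ∧ range γ = P

/-- `x` is an endpoint of `T` if `T \ {x}` is connected. -/
def IsEndpoint {T : Type*} [TopologicalSpace T] (x : T) : Prop := IsConnected ({x}ᶜ : Set T)

/-- `x` is a branch point of `T` if `T \ {x}` has at least three components. -/
def IsBranchPoint {T : Type*} [TopologicalSpace T] (x : T) : Prop :=
  3 ≤ ENat.card (ConnectedComponents ({x}ᶜ : Set T))

/-- The critical orbit `σ^k(⋆ν)`, `k ≥ 0`, in the Hubbard tree. -/
def critOrbit (h : FatouMaps A) (ν : Itin A) : Set (hubbardTree h ν) :=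
  {z | ∃ k : ℕ, z = (treeMap h ν)^[k] (treeCrit h ν)}

end Kneading

end

noncomputable section

namespace Kneading

variable {A : Type*} {ν : Itin A}

/-! ### Admissible itineraries -/

/-! The whole tree is reconstructed from one combinatorial relation on admissible itineraries, those
in which `⋆` stands exactly where the tail `ν` follows (`Adm`). If a Hubbard tree existed, then
cutting it at `⋆ν` would give pieces labelled by symbols, each mapped injectively by the shift. To
decide whether `x` and `y` lie on the same side of `z`, retract both to the closed piece of `z`,
where everything outside the piece goes to `⋆ν`, and apply the shift; this is `pull`. The question
is repeated for the images until the two points coincide or `z` has become `⋆ν`, whose sides are the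
symbols. `Same` is the resulting relation, and `z` lies between `x` and `y` if this never ends with
the answer "same side". The axiom of tree-like betweenness is `same_or_same`; it makes the intervals
`[a, b]` linearly ordered.

The dynamical input is that the critical value is an endpoint: `ν` does not separate points of the
critical orbit (`IsKneading.same_orb`), because an extremal point of the orbit exists and a
separation at `ν` could be pushed forward to it. Hence the precritical point inserted between two
points of the tree is again admissible (`midPt_mem`), and intervals can be bisected repeatedly.
Bisection shows that the intervals are order complete (`Chain.exists_cut`), and that for
non-periodic `ν` they are dense orders, while for `⋆`-periodic `ν` the jumps (`IsEdge`) are dense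
and correspond to the Fatou intervals. The definitions of the critical path, its order and the tree
then become statements on betweenness (`mem_pathItin_iff`, `fatouPair_iff`, `itinLt_iff`,
`mem_hubbardTree_iff`), and surjectivity and the count of inverse images follow from lifting points
between `ν` and its orbit.

Since only countably many precritical points lie in the tree, each interval `[a, b]`, with its jumps
filled in, is parametrized by `[0, 1]` (`exists_isArc`). For the topology, in the non-periodic case
points close to `y` are not separated from `y` by a given `z ≠ y`. In the periodic case the
retractions to the edges generate a Hausdorff topology for which the shift is continuous; the given
topology is finer and compact, so both coincide (`compactSpace_and_eq`). In both cases the facts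
collected in `IsTreeLike` hold. Points between others then separate them topologically, which rules
out endpoints off the critical orbit and makes arcs unique; and every arc between two itineraries
contains a precritical point, which gives expansivity. -/

theorem shift_iterate_apply (n : ℕ) (x : Itin A) (i : ℕ) : shift^[n] x i = x (i + n) := by
  induction n generalizing i with
  | zero => rfl
  | succ n ih =>
    rw [Function.iterate_succ_apply', shift, ih]
    congr 1; omega

theorem critPt_zero (ν : Itin A) : critPt ν 0 = none := rfl

/-- The itineraries in which the entries preceding a tail `ν` are exactly the stars. -/
def Adm (ν z : Itin A) : Prop := ∀ n, z n = none ↔ shift^[n + 1] z = ν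

theorem Adm.shift {z : Itin A} (hz : Adm ν z) : Adm ν (shift z) := fun n => hz (n + 1)

theorem Adm.iterate {z : Itin A} (hz : Adm ν z) (n : ℕ) : Adm ν (Kneading.shift^[n] z) := by
  induction n with
  | zero => exact hz
  | succ n ih => rw [Function.iterate_succ_apply']; exact Adm.shift ih

theorem Adm.zero_eq_none {z : Itin A} (hz : Adm ν z) : z 0 = none ↔ Kneading.shift z = ν := hz 0

theorem cons_shift (x : Itin A) : cons (x 0) (shift x) = x := by
  funext i; cases i <;> rfl

theorem shift_cons (o : Option A) (x : Itin A) : shift (cons o x) = x := rfl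

theorem cons_zero (o : Option A) (x : Itin A) : cons o x 0 = o := rfl

theorem Adm.eq_critPt {z : Itin A} (hz : Adm ν z) (h : z 0 = none) : z = critPt ν := by
  rw [← cons_shift z, h, hz.zero_eq_none.1 h]; rfl

/-- The only obstruction to prepending a letter is that the tail may be `ν`, which must be preceded
by `⋆`. This is why the critical value has a single inverse image. -/
theorem Adm.cons {z : Itin A} (hz : Adm ν z) (hne : z ≠ ν) (e : A) :
    Adm ν (cons (some e) z) := by
  intro n
  cases n with
  | zero => exact ⟨fun h => by simp [Kneading.cons] at h, fun h => absurd h hne⟩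
  | succ n => exact hz n

theorem critPt_mem_adm (h : Adm ν ν) : Adm ν (critPt ν) := by
  intro n
  cases n with
  | zero => exact ⟨fun _ => rfl, fun _ => rfl⟩
  | succ n => exact h n

theorem ext_head {x y : Itin A} (h0 : x 0 = y 0) (h : shift x = shift y) : x = y := by
  rw [← cons_shift x, ← cons_shift y, h0, h]

/-- A letter and `⋆` cannot precede the same tail, so admissibility turns agreement up to wild cards
into equality. -/
theorem Adm.ext_shift {x y : Itin A} (hx : Adm ν x) (hy : Adm ν y)
    (h : Kneading.shift x = Kneading.shift y) (h0 : ¬ Differ (x 0) (y 0)) : x = y := by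
  refine ext_head ?_ h
  rcases hxo : x 0 with _ | e
  · exact (hy.zero_eq_none.2 (h ▸ hx.zero_eq_none.1 hxo)).symm
  · rcases hyo : y 0 with _ | e'
    · exact absurd (hx.zero_eq_none.2 (h ▸ hy.zero_eq_none.1 hyo)) (by simp [hxo])
    · by_contra hne
      exact h0 ⟨e, e', hxo, hyo, fun h => hne (by rw [h])⟩

/-! ### Directions -/

open Classical in
/-- The image of `x` under the shift after the retraction to the itineraries starting with `o`. -/
def pull (ν : Itin A) (o : Option A) (x : Itin A) : Itin A := if x 0 = o then shift x else ν

theorem pull_of_eq {o : Option A} {x : Itin A} (h : x 0 = o) : pull ν o x = shift x := if_pos h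

theorem pull_of_ne {o : Option A} {x : Itin A} (h : x 0 ≠ o) : pull ν o x = ν := if_neg h

theorem pull_of_none {o : Option A} {x : Itin A} (hx : Adm ν x) (h : x 0 = none) :
    pull ν o x = ν := by
  unfold pull; split_ifs
  · exact hx.zero_eq_none.1 h
  · rfl

theorem pull_eq_shift {o : Option A} {x : Itin A} (hx : Adm ν x) (h : x 0 = o ∨ x 0 = none) :
    pull ν o x = shift x := by
  rcases h with h | h
  · exact pull_of_eq h
  · rw [pull_of_none hx h, hx.zero_eq_none.1 h]

theorem pull_mem (hν : Adm ν ν) {o : Option A} {x : Itin A} (hx : Adm ν x) :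
    Adm ν (pull ν o x) := by
  unfold pull; split_ifs
  · exact hx.shift
  · exact hν

theorem eq_of_pull_eq_shift {z x : Itin A} (hz : Adm ν z) (h0 : z 0 ≠ none)
    (h : pull ν (z 0) x = shift z) : x = z := by
  by_cases hx : x 0 = z 0
  · exact ext_head hx (by rwa [pull_of_eq hx] at h)
  · rw [pull_of_ne hx] at h
    exact absurd (hz.zero_eq_none.2 h.symm) h0

/-- `x` and `y` lie in the same direction, seen from `z`. -/
inductive Same (ν : Itin A) : Itin A → Itin A → Itin A → Prop
  | eq (z x : Itin A) : Same ν z x x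
  | star {z x y : Itin A} : z 0 = none → x 0 = y 0 → Same ν z x y
  | step {z x y : Itin A} : z 0 ≠ none →
      Same ν (shift z) (pull ν (z 0) x) (pull ν (z 0) y) → Same ν z x y

theorem same_iff_of_none {z x y : Itin A} (h : z 0 = none) : Same ν z x y ↔ x 0 = y 0 := by
  constructor
  · intro hs
    cases hs with
    | eq => rfl
    | star _ h => exact h
    | step h' => exact absurd h h'
  · exact Same.star h

theorem same_iff {z x y : Itin A} (h : z 0 ≠ none) :
    Same ν z x y ↔ Same ν (shift z) (pull ν (z 0) x) (pull ν (z 0) y) := by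
  constructor
  · intro hs
    cases hs with
    | eq => exact Same.eq _ _
    | star h' => exact absurd h' h
    | step _ h' => exact h'
  · exact Same.step h

theorem Same.symm {z x y : Itin A} (h : Same ν z x y) : Same ν z y x := by
  induction h with
  | eq z x => exact Same.eq _ _
  | star h h' => exact Same.star h h'.symm
  | step h _ ih => exact Same.step h ih

theorem Same.trans {z x y w : Itin A} (h : Same ν z x y) (h' : Same ν z y w) : Same ν z x w := by
  induction h generalizing w with
  | eq z x => exact h'
  | star h h0 => exact Same.star h (h0.trans ((same_iff_of_none h).1 h'))
  | step h _ ih => exact Same.step h (ih ((same_iff h).1 h'))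

/-- No point lies in a direction seen from itself: the recursion ends with equal arguments or at
`⋆ν`, the only admissible itinerary beginning with `⋆`, and equality is carried back through the
steps by `eq_of_pull_eq_shift`. -/
theorem eq_of_same_self (hν : Adm ν ν) {z x : Itin A} (hz : Adm ν z) (hx : Adm ν x)
    (h : Same ν z z x) : x = z := by
  suffices H : ∀ z u x : Itin A, Same ν z u x → u = z → Adm ν z → Adm ν x → x = z from
    H z z x h rfl hz hx
  clear h hx hz x z
  intro z u x h
  induction h with
  | eq z x => exact fun h _ _ => h
  | star h h0 =>
    intro hu hz hx; subst hu
    rw [hz.eq_critPt h, hx.eq_critPt (h0.symm.trans h)]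
  | @step z u x h _ ih =>
    intro hu hz hx; subst hu
    exact eq_of_pull_eq_shift hz h (ih (pull_of_eq rfl) hz.shift (pull_mem hν hx))

theorem not_same_self (hν : Adm ν ν) {z x : Itin A} (hz : Adm ν z) (hx : Adm ν x)
    (h : x ≠ z) : ¬ Same ν z z x := fun h' => h (eq_of_same_self hν hz hx h')

theorem not_same_self' (hν : Adm ν ν) {z x : Itin A} (hz : Adm ν z) (hx : Adm ν x)
    (h : x ≠ z) : ¬ Same ν z x z := fun h' => h (eq_of_same_self hν hz hx h'.symm)

/-- The main property of directions: seen from one of two points, any third point lies in the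
direction of the other one. -/
theorem same_or_same {z w : Itin A} (hz : Adm ν z) (hw : Adm ν w) (hzw : z ≠ w) (u : Itin A) :
    Same ν z u w ∨ Same ν w u z := by
  have hex : ∃ n, z n ≠ w n := Function.ne_iff.1 hzw
  obtain ⟨n, hn⟩ := hex
  -- Induction on a position where `z` and `w` differ. If the first symbols differ, then `u` misses
  -- the piece of one of the two points, say of `z`, and seen from `z` both `u` and `w` are
  -- retracted to `⋆ν`; a point that begins with `⋆` compares symbols instead. If the first symbols
  -- coincide, all three points are pulled by the same map.
  induction n generalizing z w u with
  | zero =>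
    by_cases h1 : z 0 = none
    · by_cases h2 : u 0 = w 0
      · exact Or.inl (Same.star h1 h2)
      · refine Or.inr (Same.step (fun h => hn (h1.trans h.symm)) ?_)
        rw [pull_of_ne h2, pull_of_ne hn]; exact Same.eq _ _
    · by_cases h3 : w 0 = none
      · by_cases h2 : u 0 = z 0
        · exact Or.inr (Same.star h3 h2)
        · refine Or.inl (Same.step h1 ?_)
          rw [pull_of_ne h2, pull_of_ne (Ne.symm hn)]; exact Same.eq _ _
      · by_cases h2 : u 0 = z 0
        · refine Or.inr (Same.step h3 ?_)
          rw [pull_of_ne (h2 ▸ hn), pull_of_ne hn]; exact Same.eq _ _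
        · refine Or.inl (Same.step h1 ?_)
          rw [pull_of_ne h2, pull_of_ne (Ne.symm hn)]; exact Same.eq _ _
  | succ n ih =>
    by_cases h0 : z 0 = w 0
    · by_cases h1 : z 0 = none
      · exact absurd ((hz.eq_critPt h1).trans (hw.eq_critPt (h0 ▸ h1)).symm) hzw
      · have h2 : w 0 ≠ none := h0 ▸ h1
        rw [same_iff h1, same_iff h2, ← h0, pull_of_eq (x := z) rfl, pull_of_eq (x := w) h0.symm]
        exact ih hz.shift hw.shift (fun h => hzw (ext_head h0 h)) _ hn
    · by_cases h1 : z 0 = none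
      · by_cases h2 : u 0 = w 0
        · exact Or.inl (Same.star h1 h2)
        · refine Or.inr (Same.step (fun h => h0 (h1.trans h.symm)) ?_)
          rw [pull_of_ne h2, pull_of_ne h0]; exact Same.eq _ _
      · by_cases h3 : w 0 = none
        · by_cases h2 : u 0 = z 0
          · exact Or.inr (Same.star h3 h2)
          · refine Or.inl (Same.step h1 ?_)
            rw [pull_of_ne h2, pull_of_ne (Ne.symm h0)]; exact Same.eq _ _
        · by_cases h2 : u 0 = z 0
          · refine Or.inr (Same.step h3 ?_)
            rw [pull_of_ne (h2 ▸ h0), pull_of_ne h0]; exact Same.eq _ _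
          · refine Or.inl (Same.step h1 ?_)
            rw [pull_of_ne h2, pull_of_ne (Ne.symm h0)]; exact Same.eq _ _

/-! ### Betweenness: `z` lies on the path from `x` to `y` if and only if `¬ Same ν z x y` -/

/-- Transitivity of "closer to `c`". If `z` had `c` and `v` on one side, then applying
`same_or_same` to `c` and to `v` would put `c` and `v` on one side of `w`. -/
theorem not_same_trans {z w c v : Itin A} (hz : Adm ν z) (hw : Adm ν w)
    (h1 : ¬ Same ν z c w) (h2 : ¬ Same ν w c v) : ¬ Same ν z c v := by
  intro h
  by_cases hzw : z = w
  · subst hzw; exact h2 h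
  rcases same_or_same hz hw hzw c with h' | h'
  · exact h1 h'
  · rcases same_or_same hz hw hzw v with h3 | h3
    · exact h1 (h.trans h3)
    · exact h2 (h'.trans h3.symm)

theorem not_same_or {z a b : Itin A} (c : Itin A) (h : ¬ Same ν z a b) :
    ¬ Same ν z a c ∨ ¬ Same ν z c b := by
  by_contra! h'
  exact h (h'.1.trans h'.2)

/-- A point of `[a, b]` has the two ends in different directions, so `[a, z]` and `[z, b]`
lie on different sides. -/
theorem not_same_asymm {z w c : Itin A} (hz : Adm ν z) (hw : Adm ν w)
    (h1 : ¬ Same ν z c w) (h2 : ¬ Same ν w c z) : z = w := by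
  by_contra h
  rcases same_or_same hz hw h c with h' | h'
  · exact h1 h'
  · exact h2 h'

theorem not_same_total {u v a b : Itin A} (hu : Adm ν u) (hv : Adm ν v) (huv : u ≠ v)
    (h1 : ¬ Same ν u a b) (h2 : ¬ Same ν v a b) : ¬ Same ν u a v ∨ ¬ Same ν v a u := by
  by_contra! h
  rcases same_or_same hu hv huv b with h3 | h3
  · exact h1 (h.1.trans h3.symm)
  · exact h2 (h.2.trans h3.symm)

/-! ### Itineraries that agree on an initial segment -/

/-- The first `n` entries of `a` and `b` do not differ. -/
def Agree (n : ℕ) (a b : Itin A) : Prop := ∀ i < n, ¬ Differ (a i) (b i)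

/-- The first `n` entries of `a` are those of `x`, or `⋆`. -/
def Fits (n : ℕ) (a x : Itin A) : Prop := ∀ i < n, a i = x i ∨ a i = none

theorem differ_comm {o o' : Option A} : Differ o o' ↔ Differ o' o := by
  constructor <;> (rintro ⟨e, e', h, h', hne⟩; exact ⟨e', e, h', h, hne.symm⟩)

theorem not_differ_iff {o o' : Option A} : ¬ Differ o o' ↔ o = o' ∨ o = none ∨ o' = none := by
  cases o <;> cases o' <;> simp [Differ]

theorem Agree.symm {n : ℕ} {a b : Itin A} (h : Agree n a b) : Agree n b a :=
  fun i hi hd => h i hi (differ_comm.1 hd)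

theorem Agree.mono {n m : ℕ} {a b : Itin A} (h : Agree n a b) (hm : m ≤ n) : Agree m a b :=
  fun i hi => h i (hi.trans_le hm)

theorem Agree.shift {n : ℕ} {a b : Itin A} (h : Agree (n + 1) a b) :
    Agree n (Kneading.shift a) (Kneading.shift b) := fun i hi => h (i + 1) (by omega)

theorem Agree.refl (n : ℕ) (a : Itin A) : Agree n a a :=
  fun _ _ => not_differ_iff.2 (Or.inl rfl)

theorem Fits.shift {n : ℕ} {a x : Itin A} (h : Fits (n + 1) a x) :
    Fits n (Kneading.shift a) (Kneading.shift x) := fun i hi => h (i + 1) (by omega)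

theorem Agree.fits {n : ℕ} {a x : Itin A} (h : Agree n a x) (hx : ∀ i < n, x i ≠ none) :
    Fits n a x := fun i hi => by
  rcases not_differ_iff.1 (h i hi) with h' | h' | h'
  · exact Or.inl h'
  · exact Or.inr h'
  · exact absurd h' (hx i hi)

theorem Fits.agree {n : ℕ} {a x : Itin A} (h : Fits n a x) : Agree n a x := fun i hi =>
  not_differ_iff.2 ((h i hi).imp id Or.inl)

/-- As long as `a` and `b` do not differ, a point between them must follow both: if neither starts
in the piece of `z`, both are retracted to `⋆ν` and `z` does not separate them. If `z` begins with
`⋆`, it separates only different symbols, and then wild-card agreement forces `a` or `b` to be `⋆ν`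
as well. So precritical points of small depth occur only as ends. -/
theorem between_agree {n : ℕ} {a b z : Itin A} (ha : Adm ν a) (hb : Adm ν b) (hz : Adm ν z)
    (hab : Agree n a b) (h : ¬ Same ν z a b) :
    Agree n a z ∧ Agree n b z ∧ ((∃ i < n, z i = none) → z = a ∨ z = b) := by
  induction n generalizing a b z with
  | zero => exact ⟨fun i hi => absurd hi (by omega), fun i hi => absurd hi (by omega),
      fun ⟨i, hi, _⟩ => absurd hi (by omega)⟩
  | succ n ih =>
    have h0 := not_differ_iff.1 (hab 0 (by omega))
    by_cases hz0 : z 0 = none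
    · have hab0 : a 0 ≠ b 0 := fun h' => h (Same.star hz0 h')
      rcases h0 with h0 | h0 | h0
      · exact absurd h0 hab0
      · have : z = a := by rw [hz.eq_critPt hz0, ha.eq_critPt h0]
        subst this
        exact ⟨Agree.refl _ _, hab.symm, fun _ => Or.inl rfl⟩
      · have : z = b := by rw [hz.eq_critPt hz0, hb.eq_critPt h0]
        subst this
        exact ⟨hab, Agree.refl _ _, fun _ => Or.inr rfl⟩
    · rw [same_iff hz0] at h
      have hab' : (a 0 = z 0 ∨ a 0 = none) ∧ (b 0 = z 0 ∨ b 0 = none) := by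
        by_cases h1 : a 0 = z 0
        · refine ⟨Or.inl h1, ?_⟩
          rcases h0 with h0 | h0 | h0
          · exact Or.inl (h0 ▸ h1)
          · exact absurd (h1 ▸ h0) hz0
          · exact Or.inr h0
        · by_cases h2 : b 0 = z 0
          · refine ⟨?_, Or.inl h2⟩
            rcases h0 with h0 | h0 | h0
            · exact absurd (h0.trans h2) h1
            · exact Or.inr h0
            · exact absurd (h2 ▸ h0) hz0
          · rw [pull_of_ne h1, pull_of_ne h2] at h
            exact absurd (Same.eq _ _) h
      rw [pull_eq_shift ha hab'.1, pull_eq_shift hb hab'.2] at h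
      obtain ⟨h1, h2, h3⟩ := ih ha.shift hb.shift hz.shift hab.shift h
      have d1 : ¬ Differ (a 0) (z 0) := not_differ_iff.2 (hab'.1.imp id Or.inl)
      have d2 : ¬ Differ (b 0) (z 0) := not_differ_iff.2 (hab'.2.imp id Or.inl)
      refine ⟨fun i hi => ?_, fun i hi => ?_, ?_⟩
      · cases i with
        | zero => exact d1
        | succ i => exact h1 i (by omega)
      · cases i with
        | zero => exact d2
        | succ i => exact h2 i (by omega)
      · rintro ⟨i, hi, hi0⟩
        cases i with
        | zero => exact absurd hi0 hz0
        | succ i =>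
          rcases h3 ⟨i, by omega, hi0⟩ with h4 | h4
          · exact Or.inl (hz.ext_shift ha h4 (fun h => d1 (differ_comm.1 h)))
          · exact Or.inr (hz.ext_shift hb h4 (fun h => d2 (differ_comm.1 h)))

/-- Before position `k` both points stay in the closed piece of `m`, so pulling is shifting; at the
star of `m` the two symbols are different directions. -/
theorem not_same_of_fits {k : ℕ} {m a b : Itin A} (ha : Adm ν a) (hb : Adm ν b)
    (hm : ∀ i < k, m i ≠ none) (hk : m k = none) (ham : Fits k a m) (hbm : Fits k b m)
    (hd : Differ (a k) (b k)) : ¬ Same ν m a b := by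
  induction k generalizing m a b with
  | zero =>
    obtain ⟨e, e', h, h', hne⟩ := hd
    rw [same_iff_of_none hk, h, h']
    simpa using hne
  | succ k ih =>
    rw [same_iff (hm 0 (by omega)), pull_eq_shift ha (ham 0 (by omega)),
      pull_eq_shift hb (hbm 0 (by omega))]
    exact ih ha.shift hb.shift (fun i hi => hm (i + 1) (by omega)) hk ham.shift hbm.shift hd

/-- Retracting and shifting preserve betweenness up to collapse. If `w` is outside the piece, its
image is `ν`; then not both ends are in the piece, since `w` would see both in the direction of
`⋆ν`. So some end is also sent to `ν`, and `ν` is an end of the image interval. -/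
theorem pull_between (hν : Adm ν ν) {o : Option A} {x y w : Itin A} (hx : Adm ν x)
    (hy : Adm ν y) (hw : Adm ν w) (ho : o ≠ none)
    (h : ¬ Same ν w x y) : ¬ Same ν (pull ν o w) (pull ν o x) (pull ν o y) ∨
      (pull ν o w = pull ν o x ∧ pull ν o w = pull ν o y) := by
  by_cases hwo : w 0 = o
  · subst hwo
    rw [same_iff ho, ← pull_of_eq (ν := ν) (x := w) rfl] at h
    exact Or.inl h
  · rw [pull_of_ne hwo]
    by_cases hxo : x 0 = o
    · by_cases hyo : y 0 = o
      · exfalso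
        by_cases hwc : w = critPt ν
        · subst hwc
          exact h (Same.star rfl (hxo.trans hyo.symm))
        · have key : ∀ u : Itin A, u 0 = o → Same ν w u (critPt ν) := fun u hu => by
            rcases same_or_same hw (critPt_mem_adm hν) hwc u with h1 | h1
            · exact h1
            · exact absurd (((same_iff_of_none rfl).1 h1).symm.trans hu) hwo
          exact h ((key x hxo).trans (key y hyo).symm)
      · rw [pull_of_ne hyo]
        by_cases he : pull ν o x = ν
        · exact Or.inr ⟨he.symm, rfl⟩
        · exact Or.inl (not_same_self' hν hν (pull_mem hν hx) he)
    · rw [pull_of_ne hxo]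
      by_cases he : pull ν o y = ν
      · exact Or.inr ⟨rfl, he.symm⟩
      · exact Or.inl (not_same_self hν hν (pull_mem hν hy) he)

/-- If a sequence over `A` does not separate `a` from `b`, then its initial segments determine
at most one point between `a` and `b`. -/
theorem Same.exists_fits (hν : Adm ν ν) {x a b : Itin A} (h : Same ν x a b) (hx : StarFree x)
    (ha : Adm ν a) (hb : Adm ν b) : ∃ K, ∀ u v, Adm ν u → Adm ν v →
      (¬ Same ν u a b ∨ (u = a ∧ u = b)) → (¬ Same ν v a b ∨ (v = a ∧ v = b)) →
      Fits K u x → Fits K v x → u = v := by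
  induction h with
  | eq z c =>
    -- The interval has collapsed to `c`. The bound `K` counts the recursion steps leading here: a
    -- point that fits `x` for that long was only shifted, so it can be recovered from its image
    -- `c`.
    refine ⟨0, fun u v _ _ hu hv _ _ => ?_⟩
    rcases hu with hu | hu
    · exact absurd (Same.eq _ _) hu
    rcases hv with hv | hv
    · exact absurd (Same.eq _ _) hv
    rw [hu.1, hv.1]
  | star h _ => exact absurd h (hx 0)
  | @step x a b h0 _ ih =>
    obtain ⟨K, hK⟩ := ih (fun i => hx (i + 1)) (pull_mem hν ha) (pull_mem hν hb)
    refine ⟨K + 1, fun u v hu hv hu' hv' fu fv => ?_⟩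
    have key : ∀ u, Adm ν u → (¬ Same ν u a b ∨ (u = a ∧ u = b)) →
        (¬ Same ν (pull ν (x 0) u) (pull ν (x 0) a) (pull ν (x 0) b) ∨
          (pull ν (x 0) u = pull ν (x 0) a ∧ pull ν (x 0) u = pull ν (x 0) b)) := by
      rintro u hu (h | ⟨h, h'⟩)
      · exact pull_between hν ha hb hu h0 h
      · exact Or.inr ⟨by rw [h], by rw [h']⟩
    have ku := key u hu hu'
    have kv := key v hv hv'
    rw [pull_eq_shift hu (fu 0 (by omega))] at ku
    rw [pull_eq_shift hv (fv 0 (by omega))] at kv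
    refine hu.ext_shift hv (hK _ _ hu.shift hv.shift ku kv fu.shift fv.shift) ?_
    rw [not_differ_iff]
    rcases fu 0 (by omega) with h1 | h1
    · rcases fv 0 (by omega) with h2 | h2
      · exact Or.inl (h1.trans h2.symm)
      · exact Or.inr (Or.inr h2)
    · exact Or.inr (Or.inl h1)

/-! ### The critical orbit -/

/-- The critical orbit. -/
def orb (ν : Itin A) (i : ℕ) : Itin A := shift^[i] (critPt ν)

theorem orb_zero : orb ν 0 = critPt ν := rfl

theorem orb_one : orb ν 1 = ν := rfl

theorem orb_succ (i : ℕ) : orb ν (i + 1) = shift (orb ν i) := Function.iterate_succ_apply' _ _ _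

theorem orb_succ' (i : ℕ) : orb ν (i + 1) = shift^[i] ν := Function.iterate_succ_apply _ _ _

theorem orb_adm (hν : Adm ν ν) (i : ℕ) : Adm ν (orb ν i) := (critPt_mem_adm hν).iterate i

/-- The critical orbit is stable under `pull`. The bound on the index is used when it is compared
with the number of steps. -/
theorem pull_orb (o : Option A) (i : ℕ) : ∃ j, 1 ≤ j ∧ j ≤ i + 1 ∧ pull ν o (orb ν i) = orb ν j := by
  by_cases h : orb ν i 0 = o
  · exact ⟨i + 1, by omega, le_rfl, by rw [pull_of_eq h, orb_succ]⟩
  · exact ⟨1, le_rfl, by omega, by rw [pull_of_ne h, orb_one]⟩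

theorem IsNonPeriodic.shift_ne (h : IsNonPeriodic ν) {p : ℕ} (hp : 0 < p) : shift^[p] ν ≠ ν :=
  fun h' => h.2 ⟨p, hp, fun i => by rw [← shift_iterate_apply p ν i, h']⟩

theorem IsNonPeriodic.adm (h : IsNonPeriodic ν) : Adm ν ν := fun n =>
  ⟨fun h' => absurd h' (h.1 n), fun h' => absurd h' (h.shift_ne n.succ_pos)⟩

theorem IsStarPeriodic.adm (h : IsStarPeriodic ν) : Adm ν ν := by
  obtain ⟨p, hp, h⟩ := h
  have hper : ∀ k i, ν (i + p * k) = ν i := by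
    intro k
    induction k with
    | zero => intro i; rfl
    | succ k ih => intro i; rw [Nat.mul_succ, ← Nat.add_assoc, (h _).1, ih]
  intro n
  rw [(h n).2]
  constructor
  · rintro ⟨k, hk⟩
    funext i
    rw [shift_iterate_apply, hk, hper]
  · intro h'
    have h1 : ν (p - 1) = none := (h _).2.2 ⟨1, by omega⟩
    rw [← h', shift_iterate_apply, (h _).2] at h1
    have : p - 1 + (n + 1) + 1 = (n + 1) + p := by omega
    rw [this] at h1
    exact (Nat.dvd_add_left dvd_rfl).1 h1

theorem IsKneading.adm (h : IsKneading ν) : Adm ν ν := h.1.elim (·.adm) (·.adm)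

theorem IsKneading.zero_ne (h : IsKneading ν) : ν 0 ≠ none := by
  rcases h with ⟨h | ⟨p, hp, h⟩, hne⟩
  · exact h.1 0
  · intro h0
    have h1 : p = 1 := by simpa using (h 0).2.1 h0
    subst h1
    exact hne (funext fun i => (h i).2.2 (one_dvd _))

theorem IsKneading.critPt_ne (h : IsKneading ν) : critPt ν ≠ ν := fun h' =>
  h.zero_ne (by rw [← h', critPt_zero])

/-- The hypothesis says that after time `N` the orbit no longer leaves the hull of its previous
points. An endpoint of the orbit can then be found among finitely many points. -/
theorem exists_orb_end (hν : Adm ν ν) (hne : critPt ν ≠ ν) {N : ℕ} (hN : 1 ≤ N)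
    (H : ∀ n, N ≤ n → (∃ s ≤ n, orb ν (n + 1) = orb ν s) ∨
      ∃ s ≤ n, ∃ t ≤ n, ¬ Same ν (orb ν (n + 1)) (orb ν s) (orb ν t)) :
    ∃ m, 1 ≤ m ∧ m ≤ N ∧ ∀ i, orb ν i ≠ orb ν m → Same ν (orb ν m) (orb ν i) (critPt ν) := by
  classical
  -- `S m` collects the early orbit points in `[⋆ν, orb ν m]`. If a maximal `orb ν m` separated `⋆ν`
  -- from `orb ν i` with `i ≤ N`, then `S i` would be strictly larger, since it also contains `i`.
  let S : ℕ → Finset ℕ := fun m =>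
    (Finset.range (N + 1)).filter fun i => ¬ Same ν (orb ν i) (critPt ν) (orb ν m)
  obtain ⟨m, hm, hmax⟩ := Finset.exists_max_image (Finset.range (N + 1)) (fun m => (S m).card)
    ⟨0, by simp⟩
  have h1 : 1 ∈ S 1 := by
    simp only [S, Finset.mem_filter, Finset.mem_range]
    exact ⟨by omega, not_same_self' hν hν (critPt_mem_adm hν) hne⟩
  have hm0 : orb ν m ≠ critPt ν := by
    intro h
    have h2 : S m = ∅ := by
      refine Finset.filter_eq_empty_iff.2 fun i _ => ?_
      rw [h, not_not]; exact Same.eq _ _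
    have h3 := hmax 1 (Finset.mem_range.2 (by omega))
    rw [h2] at h3
    exact absurd (Finset.card_pos.2 ⟨1, h1⟩) (by simpa using h3)
  have hmN : m ≤ N := by simpa [Nat.lt_succ_iff] using hm
  refine ⟨m, Nat.one_le_iff_ne_zero.2 fun h => hm0 (by rw [h, orb_zero]), hmN, fun i => ?_⟩
  induction i using Nat.strong_induction_on with
  | _ i ih =>
  intro hi
  by_cases hiN : i ≤ N
  · by_contra hs
    have hs' : ¬ Same ν (orb ν m) (critPt ν) (orb ν i) := fun h => hs h.symm
    have hi0 : critPt ν ≠ orb ν i := fun h => hs (h ▸ Same.eq _ _)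
    have hlt : (S m).card < (S i).card := by
      refine Finset.card_lt_card (Finset.ssubset_iff_of_subset ?_ |>.2 ⟨i, ?_, ?_⟩)
      · intro j hj
        simp only [S, Finset.mem_filter] at hj ⊢
        exact ⟨hj.1, not_same_trans (orb_adm hν j) (orb_adm hν m) hj.2 hs'⟩
      · simp only [S, Finset.mem_filter, Finset.mem_range]
        exact ⟨by omega, not_same_self' hν (orb_adm hν i) (critPt_mem_adm hν) hi0⟩
      · simp only [S, Finset.mem_filter, not_and]
        intro _ h
        exact hi (not_same_asymm (orb_adm hν i) (orb_adm hν m) h hs')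
    exact absurd (hmax i (by simp; omega)) (not_le.2 hlt)
  · obtain ⟨n, rfl⟩ : ∃ n, i = n + 1 := ⟨i - 1, by omega⟩
    rcases H n (by omega) with ⟨s, hs, h⟩ | ⟨s, hs, t, ht, h⟩
    · rw [h] at hi ⊢
      exact ih s (by omega) hi
    · have key : ∀ s ≤ n, ¬ Same ν (orb ν (n + 1)) (orb ν s) (orb ν m) →
          Same ν (orb ν m) (orb ν (n + 1)) (critPt ν) := by
        intro s hs h
        have hsm : orb ν s ≠ orb ν m := fun h' => h (h' ▸ Same.eq _ _)
        rcases same_or_same (orb_adm hν m) (orb_adm hν (n + 1)) hi.symm (orb ν s) with h' | h'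
        · exact h'.symm.trans (ih s (by omega) hsm)
        · exact absurd h' h
      rcases not_same_or (orb ν m) h with h | h
      · exact key s hs h
      · exact key t ht fun h' => h h'.symm

/-- Separation at a point without initial `⋆` passes to its image, with the separated points
replaced by their pulls; these remain in the critical orbit, and by `eq_of_pull_eq_shift` they
remain different from the separating point. -/
theorem not_same_orb_transport (hν : Adm ν ν) {m : ℕ}
    (hm : ∀ j, 1 ≤ j → j < m → orb ν j 0 ≠ none) (hm1 : 1 ≤ m)
    (h : ∃ i j, ¬ Same ν ν (orb ν i) (orb ν j) ∧ orb ν i ≠ ν ∧ orb ν j ≠ ν) :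
    ∃ i j, ¬ Same ν (orb ν m) (orb ν i) (orb ν j) ∧ orb ν i ≠ orb ν m ∧ orb ν j ≠ orb ν m := by
  induction m, hm1 using Nat.le_induction with
  | base => exact h
  | succ m hm1 ih =>
    obtain ⟨i, j, h1, h2, h3⟩ := ih fun j hj hj' => hm j hj (by omega)
    have h0 := hm m hm1 (by omega)
    rw [same_iff h0] at h1
    obtain ⟨i', -, -, hi⟩ := pull_orb (ν := ν) (orb ν m 0) i
    obtain ⟨j', -, -, hj⟩ := pull_orb (ν := ν) (orb ν m 0) j
    refine ⟨i', j', ?_, ?_, ?_⟩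
    · rw [orb_succ, ← hi, ← hj]; exact h1
    · rw [orb_succ, ← hi]
      exact fun h => h2 (eq_of_pull_eq_shift (orb_adm hν m) h0 h)
    · rw [orb_succ, ← hj]
      exact fun h => h3 (eq_of_pull_eq_shift (orb_adm hν m) h0 h)

/-- The `n`-fold application of `pull` along the entries of `z`. -/
def pullAlong (ν z : Itin A) : ℕ → Itin A → Itin A
  | 0, x => x
  | n + 1, x => pull ν (z n) (pullAlong ν z n x)

theorem same_iff_pullAlong {z x y : Itin A} {n : ℕ} (h : ∀ i < n, z i ≠ none) :
    Same ν z x y ↔ Same ν (shift^[n] z) (pullAlong ν z n x) (pullAlong ν z n y) := by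
  induction n with
  | zero => rfl
  | succ n ih =>
    rw [ih fun i hi => h i (by omega), Function.iterate_succ_apply',
      same_iff (by rw [shift_iterate_apply, Nat.zero_add]; exact h n (by omega)),
      shift_iterate_apply, Nat.zero_add]
    rfl

/-- A point different from `ν` leaves the piece of `ν` at some time and is reset to `ν = orb ν 1`.
From then on its index after `n` steps is at most `n`, hence smaller than the index of `shift^[n] ν
= orb ν (n + 1)`. -/
theorem exists_pullAlong_orb {i : ℕ} (hi : orb ν i ≠ ν) :
    ∃ N, ∀ n, N ≤ n → ∃ s ≤ n, pullAlong ν ν n (orb ν i) = orb ν s := by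
  have hex : ∃ n, pullAlong ν ν n (orb ν i) 0 ≠ ν n := by
    by_contra! h
    have h1 : ∀ n, pullAlong ν ν n (orb ν i) = shift^[n] (orb ν i) := by
      intro n
      induction n with
      | zero => rfl
      | succ n ih => rw [pullAlong, pull_of_eq (h n), ih, Function.iterate_succ_apply']
    refine hi (funext fun n => ?_)
    rw [← h n, h1, shift_iterate_apply, Nat.zero_add]
  obtain ⟨n, hn⟩ := hex
  refine ⟨n + 1, fun k hk => ?_⟩
  induction k, hk using Nat.le_induction with
  | base => exact ⟨1, by omega, pull_of_ne hn⟩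
  | succ k _ ih =>
    obtain ⟨s, hs, h⟩ := ih
    obtain ⟨j, -, hj, h'⟩ := pull_orb (ν := ν) (ν k) s
    exact ⟨j, by omega, by rw [pullAlong, h, h']⟩

theorem IsStarPeriodic.orb_add {p : ℕ} (hp : 0 < p)
    (h : ∀ i, ν (i + p) = ν i ∧ (ν i = none ↔ p ∣ i + 1)) (i : ℕ) : orb ν (i + p) = orb ν i := by
  have h0 : orb ν p = orb ν 0 := by
    funext k
    rw [orb, shift_iterate_apply]
    cases k with
    | zero =>
      obtain ⟨q, rfl⟩ : ∃ q, p = q + 1 := ⟨p - 1, by omega⟩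
      rw [Nat.zero_add]
      exact (h q).2.2 dvd_rfl
    | succ k =>
      rw [Nat.add_right_comm]
      exact (h k).1
  rw [orb, Function.iterate_add_apply]
  exact congrArg _ h0

theorem IsStarPeriodic.orb_zero_eq_none {p : ℕ}
    (h : ∀ i, ν (i + p) = ν i ∧ (ν i = none ↔ p ∣ i + 1)) (j : ℕ) :
    orb ν j 0 = none ↔ p ∣ j := by
  cases j with
  | zero => simp [orb_zero, critPt_zero]
  | succ j => rw [orb_succ', shift_iterate_apply, Nat.zero_add, (h j).2]

/-- The critical value is an endpoint of the critical orbit. -/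
theorem IsKneading.same_orb (hK : IsKneading ν) {i j : ℕ} (hi : orb ν i ≠ ν) (hj : orb ν j ≠ ν) :
    Same ν ν (orb ν i) (orb ν j) := by
  by_contra hs
  have hν := hK.adm
  rcases hK.1 with h | ⟨p, hp, h⟩
  -- Pulling the assumed separation along `ν` shows that each late orbit point separates two earlier
  -- ones. So the orbit has an endpoint, but the separation at `ν` also transports to that endpoint.
  · obtain ⟨N₁, h1⟩ := exists_pullAlong_orb hi
    obtain ⟨N₂, h2⟩ := exists_pullAlong_orb hj
    obtain ⟨m, hm1, -, hm⟩ := exists_orb_end hν hK.critPt_ne (N := max 1 (max N₁ N₂)) (by simp)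
      fun n hn => by
        obtain ⟨s, hs1, hs2⟩ := h1 n (by omega)
        obtain ⟨t, ht1, ht2⟩ := h2 n (by omega)
        rw [same_iff_pullAlong (n := n) fun i _ => h.1 i, hs2, ht2] at hs
        exact Or.inr ⟨s, hs1, t, ht1, by rwa [orb_succ']⟩
    obtain ⟨i', j', h3, h4, h5⟩ := not_same_orb_transport hν (m := m)
      (fun j hj _ => by
        obtain ⟨k, rfl⟩ : ∃ k, j = k + 1 := ⟨j - 1, by omega⟩
        rw [orb_succ', shift_iterate_apply]; exact h.1 _) hm1 ⟨i, j, hs, hi, hj⟩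
    exact h3 ((hm i' h4).trans (hm j' h5).symm)
  · have hp2 : p ≠ 1 := fun hp1 => hK.zero_ne ((h 0).2.2 (by simp [hp1]))
    -- In the periodic case late orbit points repeat earlier ones. The endpoint has index less than
    -- the period, so no `⋆` blocks the transport.
    obtain ⟨m, hm1, hmp, hm⟩ := exists_orb_end hν hK.critPt_ne (N := p - 1) (by omega)
      fun n hn => Or.inl ⟨n + 1 - p, by omega, by
        rw [← IsStarPeriodic.orb_add hp h (n + 1 - p)]; congr 1; omega⟩
    obtain ⟨i', j', h3, h4, h5⟩ := not_same_orb_transport hν (m := m)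
      (fun j hj hjm h0 => by
        have := Nat.le_of_dvd (by omega) ((IsStarPeriodic.orb_zero_eq_none h j).1 h0)
        omega) hm1 ⟨i, j, hs, hi, hj⟩
    exact h3 ((hm i' h4).trans (hm j' h5).symm)

/-! ### The itineraries of the Hubbard tree -/

/-- The itineraries that lie between points of the critical orbit. -/
def treeItin (ν : Itin A) : Set (Itin A) :=
  {z | Adm ν z ∧ ∃ i, ¬ Same ν z (critPt ν) (orb ν i)}

theorem orb_mem (hK : IsKneading ν) (i : ℕ) : orb ν i ∈ treeItin ν := by
  have hν := hK.adm
  refine ⟨orb_adm hν i, ?_⟩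
  by_cases h : orb ν i = critPt ν
  · refine ⟨1, ?_⟩
    rw [h, orb_one]
    exact not_same_self hν (critPt_mem_adm hν) hν hK.critPt_ne.symm
  · exact ⟨i, not_same_self' hν (orb_adm hν i) (critPt_mem_adm hν) (Ne.symm h)⟩

theorem critPt_mem_treeItin (hK : IsKneading ν) : critPt ν ∈ treeItin ν := orb_mem hK 0

theorem critVal_mem (hK : IsKneading ν) : ν ∈ treeItin ν := orb_mem hK 1

/-- Convexity of the tree. If `z` did not separate `⋆ν` from any orbit point, all points of the tree
would lie in the direction of `⋆ν` seen from `z`. -/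
theorem between_mem {u v z : Itin A} (hu : u ∈ treeItin ν) (hv : v ∈ treeItin ν) (hz : Adm ν z)
    (h : ¬ Same ν z u v) : z ∈ treeItin ν := by
  refine ⟨hz, ?_⟩
  by_contra! hall
  have key : ∀ u ∈ treeItin ν, Same ν z u (critPt ν) := by
    rintro u ⟨hu, i, hi⟩
    have hzu : z ≠ u := fun e => hi (e ▸ hall i)
    rcases same_or_same hz hu hzu (critPt ν) with h1 | h1
    · exact h1.symm
    rcases same_or_same hz hu hzu (orb ν i) with h2 | h2
    · exact ((hall i).trans h2).symm
    · exact absurd (h1.trans h2.symm) hi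
  exact h ((key u hu).trans (key v hv).symm)

theorem shift_mem (hK : IsKneading ν) {z : Itin A} (hz : z ∈ treeItin ν) :
    shift z ∈ treeItin ν := by
  obtain ⟨hz, i, hi⟩ := hz
  by_cases h0 : z 0 = none
  · rw [hz.zero_eq_none.1 h0]; exact critVal_mem hK
  · rw [same_iff h0, ← orb_zero] at hi
    obtain ⟨s, -, -, h1⟩ := pull_orb (ν := ν) (z 0) 0
    obtain ⟨t, -, -, h2⟩ := pull_orb (ν := ν) (z 0) i
    rw [h1, h2] at hi
    exact between_mem (orb_mem hK s) (orb_mem hK t) hz.shift hi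

theorem shift_iterate_mem (hK : IsKneading ν) {z : Itin A} (hz : z ∈ treeItin ν) (n : ℕ) :
    shift^[n] z ∈ treeItin ν := by
  induction n with
  | zero => exact hz
  | succ n ih => rw [Function.iterate_succ_apply']; exact shift_mem hK ih

/-- The critical value is an endpoint of the tree. -/
theorem IsKneading.same_critVal (hK : IsKneading ν) {u v : Itin A} (hu : u ∈ treeItin ν)
    (hv : v ∈ treeItin ν) (hu' : u ≠ ν) (hv' : v ≠ ν) : Same ν ν u v := by
  have hν := hK.adm
  have key : ∀ u ∈ treeItin ν, u ≠ ν → Same ν ν u (critPt ν) := by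
    rintro u ⟨hu, i, hi⟩ hne
    have h3 : ∀ c, Same ν ν c u → c ≠ ν := by
      rintro _ hc rfl
      exact hne (eq_of_same_self hν hν hu hc)
    rcases same_or_same hν hu hne.symm (critPt ν) with h1 | h1
    · exact h1.symm
    rcases same_or_same hν hu hne.symm (orb ν i) with h2 | h2
    · exact h2.symm.trans (hK.same_orb (j := 0) (h3 _ h2) hK.critPt_ne)
    · exact absurd (h1.trans h2.symm) hi
  exact (key u hu hu').trans (key v hv hv').symm

/-! ### First differences and midpoints -/

theorem le_diff_iff {n : ℕ} {a b : Itin A} : ((n + 1 : ℕ) : ℕ∞) ≤ diff a b ↔ Agree n a b := by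
  rw [diff, le_sInf_iff]
  constructor
  · intro h i hi hd
    have := h _ ⟨i, hd, rfl⟩
    norm_cast at this
    omega
  · rintro h _ ⟨i, hd, rfl⟩
    norm_cast
    by_contra hlt
    exact h i (by omega) hd

theorem diff_eq_top_iff {a b : Itin A} : diff a b = ⊤ ↔ ∀ n, Agree n a b := by
  constructor
  · intro h n
    rw [← le_diff_iff, h]; exact le_top
  · intro h
    rw [diff, sInf_eq_top]
    rintro _ ⟨i, hd, rfl⟩
    exact absurd hd (h (i + 1) i (by omega))

theorem exists_first_diff {a b : Itin A} (h : diff a b ≠ ⊤) :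
    ∃ k, Agree k a b ∧ Differ (a k) (b k) := by
  classical
  have hex : ∃ k, Differ (a k) (b k) := by
    by_contra! h'
    exact h (diff_eq_top_iff.2 fun n i _ => h' i)
  exact ⟨Nat.find hex, fun i hi => Nat.find_min hex hi, Nat.find_spec hex⟩

theorem diff_eq {k : ℕ} {a b : Itin A} (h : Agree k a b) (hd : Differ (a k) (b k)) :
    diff a b = (k + 1 : ℕ) := by
  refine le_antisymm ?_ (le_diff_iff.2 h)
  exact sInf_le ⟨k, hd, by norm_cast⟩

theorem eq_of_shift_iterate_eq {n : ℕ} {x y : Itin A} (hx : Adm ν x) (hy : Adm ν y)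
    (h : Agree n x y) (hs : shift^[n] x = shift^[n] y) : x = y := by
  induction n generalizing x y with
  | zero => exact hs
  | succ n ih => exact hx.ext_shift hy (ih hx.shift hy.shift h.shift hs) (h 0 (by omega))

/-- From a common star on both itineraries are `⋆ν`; before it, admissibility recovers the entries.
-/
theorem eq_of_joint_star {n : ℕ} {x y : Itin A} (hx : Adm ν x) (hy : Adm ν y)
    (h : Agree n x y) (hxn : x n = none) (hyn : y n = none) : x = y := by
  refine eq_of_shift_iterate_eq hx hy h ?_
  rw [(hx.iterate n).eq_critPt (by rwa [shift_iterate_apply, Nat.zero_add]),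
    (hy.iterate n).eq_critPt (by rwa [shift_iterate_apply, Nat.zero_add])]

theorem midPt_spec {k : ℕ} {a b : Itin A} (ha : Adm ν a) (hb : Adm ν b) (h : Agree k a b)
    (hd : Differ (a k) (b k)) : (∀ i < k, midPt ν a b i ≠ none) ∧ midPt ν a b k = none ∧
      Fits k a (midPt ν a b) ∧ Fits k b (midPt ν a b) ∧ shift^[k] (midPt ν a b) = critPt ν := by
  have hdiff : (diff a b).toNat = k + 1 := by rw [diff_eq h hd]; rfl
  have hlt : ∀ i < k, midPt ν a b i = if a i = none then b i else a i := fun i hi => by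
    simp only [midPt, hdiff]; rw [if_pos (by omega)]
  have hk : midPt ν a b k = none := by
    simp [midPt, hdiff]
  have hj : ∀ i < k, ¬ (a i = none ∧ b i = none) := by
    rintro i hi ⟨h1, h2⟩
    have := eq_of_joint_star ha hb (h.mono hi.le) h1 h2
    subst this
    obtain ⟨e, e', h1, h2, h3⟩ := hd
    exact h3 (Option.some.inj (h1.symm.trans h2))
  refine ⟨fun i hi h' => ?_, hk, fun i hi => ?_, fun i hi => ?_, ?_⟩
  · rw [hlt i hi] at h'
    split_ifs at h' with h1
    · exact hj i hi ⟨h1, h'⟩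
    · exact h1 h'
  · rw [hlt i hi]
    split_ifs with h1
    · exact Or.inr h1
    · exact Or.inl rfl
  · rw [hlt i hi]
    split_ifs with h1
    · exact Or.inl rfl
    · rcases not_differ_iff.1 (h i hi) with h2 | h2 | h2
      · exact Or.inl h2.symm
      · exact absurd h2 h1
      · exact Or.inr h2
  · funext i
    rw [shift_iterate_apply]
    cases i with
    | zero => rw [Nat.zero_add, hk]; rfl
    | succ i =>
      simp only [midPt, hdiff]
      rw [if_neg (by omega), if_neg (by omega)]
      show _ = ν i
      congr 1; omega

theorem Fits.iterate {n k : ℕ} {a x : Itin A} (h : Fits (n + k) a x) :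
    Fits n (Kneading.shift^[k] a) (Kneading.shift^[k] x) := fun i hi => by
  rw [shift_iterate_apply, shift_iterate_apply]; exact h _ (by omega)

/-- Between two points of the tree with `diff a b < ∞`, the precritical point `midPt ν a b` lies
strictly between them on the tree. -/
theorem midPt_mem (hK : IsKneading ν) {k : ℕ} {a b : Itin A} (ha : a ∈ treeItin ν)
    (hb : b ∈ treeItin ν) (h : Agree k a b) (hd : Differ (a k) (b k)) :
    midPt ν a b ∈ treeItin ν ∧ ¬ Same ν (midPt ν a b) a b ∧ midPt ν a b ≠ a ∧ midPt ν a b ≠ b := by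
  obtain ⟨h1, h2, h3, h4, h5⟩ := midPt_spec ha.1 hb.1 h hd
  have hν := hK.adm
  set m := midPt ν a b with hm
  have hs : ¬ Same ν m a b := not_same_of_fits ha.1 hb.1 h1 h2 h3 h4 hd
  obtain ⟨e, e', hae, hbe, hne⟩ := hd
  have hma : m ≠ a := fun h' => by rw [h', hae] at h2; exact absurd h2 (by simp)
  have hmb : m ≠ b := fun h' => by rw [h', hbe] at h2; exact absurd h2 (by simp)
  -- What remains is admissibility of the midpoint. A tail `ν` preceded by a letter before position
  -- `k` would separate the corresponding tails of `a` and `b`, neither of which is `ν`; this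
  -- contradicts that `ν` is an endpoint of the tree.
  refine ⟨between_mem ha hb (fun n => ?_) hs, hs, hma, hmb⟩
  rcases lt_or_ge n k with hn | hn
  · refine ⟨fun h' => absurd h' (h1 n hn), fun h' => ?_⟩
    exfalso
    obtain ⟨l, rfl⟩ : ∃ l, k = l + (n + 1) := ⟨k - (n + 1), by omega⟩
    have hνl : ν l = none := by rw [← h', shift_iterate_apply]; exact h2
    have key : ∀ c ∈ treeItin ν, c (l + (n + 1)) ≠ none → shift^[n + 1] c ≠ ν := by
      intro c _ hc h'
      rw [← shift_iterate_apply (n + 1) c, h'] at hc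
      exact hc hνl
    have h6 := hK.same_critVal (shift_iterate_mem hK ha (n + 1)) (shift_iterate_mem hK hb (n + 1))
      (key a ha (by rw [hae]; simp)) (key b hb (by rw [hbe]; simp))
    refine not_same_of_fits (k := l) (ha.1.iterate (n + 1)) (hb.1.iterate (n + 1)) ?_ hνl ?_ ?_ ?_ h6
    · intro i hi
      rw [← h', shift_iterate_apply]; exact h1 _ (by omega)
    · rw [← h']; exact h3.iterate
    · rw [← h']; exact h4.iterate
    · rw [shift_iterate_apply, shift_iterate_apply]; exact ⟨e, e', hae, hbe, hne⟩
  · obtain ⟨l, rfl⟩ : ∃ l, n = l + k := ⟨n - k, by omega⟩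
    have := critPt_mem_adm hν l
    rw [← h5, shift_iterate_apply] at this
    rw [this, ← Function.iterate_add_apply]
    rw [Nat.add_right_comm]

/-- For non-periodic `ν` the wild cards lose no information. After a star of `x`, the tail of `y`
agrees with `ν`; another star in it would make `ν` equal to a proper shift of itself. So this tail
is `ν`, and `y` has a star at the same place. -/
theorem IsNonPeriodic.eq_of_agree (hN : IsNonPeriodic ν) {x y : Itin A} (hx : Adm ν x)
    (hy : Adm ν y) (h : ∀ n, Agree n x y) : x = y := by
  have key : ∀ x y : Itin A, Adm ν x → Adm ν y → (∀ n, Agree n x y) → ∀ n, x n = none →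
      y n = none := by
    intro x y hx hy h n hxn
    have h1 := (hx n).1 hxn
    refine (hy n).2 ?_
    have hag : ∀ i, ¬ Differ (ν i) (shift^[n + 1] y i) := fun i => by
      rw [← h1, shift_iterate_apply, shift_iterate_apply]; exact h _ _ (Nat.lt_succ_self _)
    by_cases hs : ∃ m, shift^[n + 1] y m = none
    · obtain ⟨m, hm⟩ := hs
      exfalso
      have h2 := ((hy.iterate (n + 1)) m).1 hm
      refine hN.shift_ne m.succ_pos (funext fun i => ?_)
      have h3 := hag (i + (m + 1))
      rw [← shift_iterate_apply (m + 1) ν, ← shift_iterate_apply (m + 1) (shift^[n + 1] y)] at h3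
      rw [h2, not_differ_iff] at h3
      rcases h3 with h3 | h3 | h3
      · exact h3
      · rw [shift_iterate_apply] at h3; exact absurd h3 (hN.1 _)
      · exact absurd h3 (hN.1 _)
    · push Not at hs
      funext i
      rcases not_differ_iff.1 (hag i) with h3 | h3 | h3
      · exact h3.symm
      · exact absurd h3 (hN.1 _)
      · exact absurd h3 (hs _)
  funext n
  rcases not_differ_iff.1 (h (n + 1) n (by omega)) with h1 | h1 | h1
  · exact h1
  · rw [h1, key x y hx hy h n h1]
  · rw [h1, key y x hy hx (fun n => (h n).symm) n h1]

theorem StarFree.eq_of_agree {x y : Itin A} (hx : StarFree x) (hy : StarFree y)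
    (h : ∀ n, Agree n x y) : x = y := by
  funext n
  rcases not_differ_iff.1 (h (n + 1) n (by omega)) with h1 | h1 | h1
  · exact h1
  · exact absurd h1 (hx n)
  · exact absurd h1 (hy n)

/-! ### The chains `[a, b]` -/

/-- The itineraries between `a` and `b`, ordered from `a` to `b`. -/
@[ext]
structure Chain (ν a b : Itin A) where
  /-- the itinerary -/
  val : Itin A
  property : Adm ν val ∧ ¬ Same ν val a b

open Classical in
instance (a b : Itin A) : LinearOrder (Chain ν a b) where
  le u v := u = v ∨ ¬ Same ν u.val a v.val
  le_refl u := Or.inl rfl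
  le_trans u v w := by
    rintro (rfl | h) (rfl | h')
    · exact Or.inl rfl
    · exact Or.inr h'
    · exact Or.inr h
    · exact Or.inr (not_same_trans u.property.1 v.property.1 h h')
  le_antisymm u v := by
    rintro (h | h) (h' | h')
    · exact h
    · exact h
    · exact h'.symm
    · exact Chain.ext (not_same_asymm u.property.1 v.property.1 h h')
  le_total u v := by
    by_cases h : u = v
    · exact Or.inl (Or.inl h)
    · exact (not_same_total u.property.1 v.property.1 (fun h' => h (Chain.ext h')) u.property.2 v.property.2).imp
        Or.inr Or.inr
  toDecidableLE := Classical.decRel _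

namespace Chain

variable {a b : Itin A}

theorem le_iff {u v : Chain ν a b} : u ≤ v ↔ u = v ∨ ¬ Same ν u.val a v.val := Iff.rfl

theorem lt_iff {u v : Chain ν a b} : u < v ↔ u ≠ v ∧ ¬ Same ν u.val a v.val := by
  rw [lt_iff_le_and_ne, le_iff]; tauto

/-- The order is defined from the end `a`. Seen from the end `b` it is the same, which makes it
available on subintervals. -/
theorem le_iff' {u v : Chain ν a b} : u ≤ v ↔ u = v ∨ ¬ Same ν v.val u.val b := by
  rw [le_iff]
  by_cases huv : u = v
  · simp [huv]
  have huv' : u.val ≠ v.val := fun h => huv (Chain.ext h)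
  simp only [huv, false_or]
  constructor
  · intro h h'
    exact huv' (not_same_asymm u.property.1 v.property.1 h fun h3 => v.property.2 (h3.trans h'))
  · intro h h'
    refine huv' (not_same_asymm u.property.1 v.property.1 (c := b) (fun h3 => u.property.2 (h'.trans h3.symm))
      fun h3 => h h3.symm)

theorem lt_iff' {u v : Chain ν a b} : u < v ↔ u ≠ v ∧ ¬ Same ν v.val u.val b := by
  rw [lt_iff_le_and_ne, le_iff']; tauto

theorem between_iff {u v : Chain ν a b} (huv : u < v) (hν : Adm ν ν) {z : Itin A} (hz : Adm ν z) :
    ¬ Same ν z u.val v.val ↔ ∃ h : Adm ν z ∧ ¬ Same ν z a b, 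
      u ≤ (⟨z, h⟩ : Chain ν a b) ∧ (⟨z, h⟩ : Chain ν a b) ≤ v := by
  constructor
  · intro h
    have h1 : ¬ Same ν z a v.val := fun h' => by
      refine not_same_trans hz u.property.1 (c := v.val) (v := a) (fun h3 => h h3.symm)
        (fun h3 => (lt_iff.1 huv).2 h3.symm) h'.symm
    have h2 : ¬ Same ν z u.val b := not_same_trans hz v.property.1 h (lt_iff'.1 huv).2
    have h3 : ¬ Same ν z a b := not_same_trans hz v.property.1 h1 v.property.2
    exact ⟨⟨hz, h3⟩, le_iff'.2 (Or.inr h2), le_iff.2 (Or.inr h1)⟩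
  · rintro ⟨h, h1, h2⟩ hs
    rcases le_iff.1 h1 with h3 | h3
    · subst h3
      exact huv.ne (Chain.ext (eq_of_same_self hν hz v.property.1 hs).symm)
    rcases le_iff.1 h2 with h4 | h4
    · subst h4
      exact huv.ne (Chain.ext (eq_of_same_self hν hz u.property.1 hs.symm))
    by_cases hne : u.val = z
    · subst hne
      exact huv.ne (Chain.ext (eq_of_same_self hν hz v.property.1 hs).symm)
    · refine hne (not_same_asymm u.property.1 hz h3 fun h5 => h4 (h5.trans hs))

end Chain

/-! ### Nested intervals -/

/-- Nested intervals in the tree, each obtained from the previous one by cutting at the midpoint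
as long as this is possible. -/
structure IsNest (ν : Itin A) (s : ℕ → Itin A × Itin A) : Prop where
  left_mem : ∀ n, (s n).1 ∈ treeItin ν
  right_mem : ∀ n, (s n).2 ∈ treeItin ν
  ne : ∀ n, (s n).1 ≠ (s n).2
  agree : ∀ n, Agree n (s n).1 (s n).2
  step : ∀ n, (diff (s n).1 (s n).2 = ⊤ ∧ s (n + 1) = s n) ∨ (diff (s n).1 (s n).2 ≠ ⊤ ∧
    (s (n + 1) = (midPt ν (s n).1 (s n).2, (s n).2) ∨
      s (n + 1) = ((s n).1, midPt ν (s n).1 (s n).2)))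

theorem IsNest.mid (hK : IsKneading ν) {s : ℕ → Itin A × Itin A} (hs : IsNest ν s) (n : ℕ)
    (h : diff (s n).1 (s n).2 ≠ ⊤) : ∃ k, n ≤ k ∧
      (∀ i < k, midPt ν (s n).1 (s n).2 i ≠ none) ∧
      Fits k (s n).1 (midPt ν (s n).1 (s n).2) ∧ Fits k (s n).2 (midPt ν (s n).1 (s n).2) ∧
      midPt ν (s n).1 (s n).2 ∈ treeItin ν ∧
      ¬ Same ν (midPt ν (s n).1 (s n).2) (s n).1 (s n).2 ∧
      midPt ν (s n).1 (s n).2 ≠ (s n).1 ∧ midPt ν (s n).1 (s n).2 ≠ (s n).2 := by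
  obtain ⟨k, hk, hd⟩ := exists_first_diff h
  obtain ⟨h1, h2, h3, h4, -⟩ := midPt_spec (hs.left_mem n).1 (hs.right_mem n).1 hk hd
  refine ⟨k, ?_, h1, h3, h4, midPt_mem hK (hs.left_mem n) (hs.right_mem n) hk hd⟩
  by_contra hlt
  exact hs.agree n k (by omega) hd

/-- Each step replaces one end by a point between the two ends, so the intervals are nested in the
sense of betweenness. -/
theorem IsNest.between_mono (hK : IsKneading ν) {s : ℕ → Itin A × Itin A} (hs : IsNest ν s)
    {m n : ℕ} (hmn : m ≤ n) {z : Itin A} (hz : Adm ν z) (h : ¬ Same ν z (s n).1 (s n).2) :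
    ¬ Same ν z (s m).1 (s m).2 := by
  induction n, hmn using Nat.le_induction with
  | base => exact h
  | succ n _ ih =>
    rcases hs.step n with ⟨-, h1⟩ | ⟨hd, h1⟩
    · rw [h1] at h; exact ih h
    · obtain ⟨k, -, -, -, -, h2, h3, -⟩ := hs.mid hK n hd
      refine ih ?_
      rcases h1 with h1 | h1
      · rw [h1] at h
        exact fun h4 => not_same_trans hz h2.1 (fun h5 => h h5.symm) (fun h5 => h3 h5.symm) h4.symm
      · rw [h1] at h
        exact not_same_trans hz h2.1 h h3

theorem IsNest.left_between (hK : IsKneading ν) {s : ℕ → Itin A × Itin A} (hs : IsNest ν s)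
    {m n : ℕ} (hmn : m ≤ n) : ¬ Same ν (s n).1 (s m).1 (s m).2 :=
  hs.between_mono hK hmn (hs.left_mem n).1
    (not_same_self hK.adm (hs.left_mem n).1 (hs.right_mem n).1 (hs.ne n).symm)

theorem IsNest.right_between (hK : IsKneading ν) {s : ℕ → Itin A × Itin A} (hs : IsNest ν s)
    {m n : ℕ} (hmn : m ≤ n) : ¬ Same ν (s n).2 (s m).1 (s m).2 :=
  hs.between_mono hK hmn (hs.right_mem n).1
    (not_same_self' hK.adm (hs.right_mem n).1 (hs.left_mem n).1 (hs.ne n))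

theorem exists_bound {P : ℕ → ℕ → Prop} (h : ∀ i, ∃ N, ∀ n, N ≤ n → P i n) (K : ℕ) :
    ∃ N, ∀ i < K, ∀ n, N ≤ n → P i n := by
  choose N hN using h
  refine ⟨(Finset.range K).sup N, fun i hi n hn => hN i n (le_trans ?_ hn)⟩
  exact Finset.le_sup (f := N) (Finset.mem_range.2 hi)

/-- If the right ends of nested intervals change infinitely often, then the intervals have a limit
itinerary. -/
theorem IsNest.exists_limit (hK : IsKneading ν) {s : ℕ → Itin A × Itin A} (hs : IsNest ν s)
    (h : ∀ N, ∃ n, N ≤ n ∧ (s (n + 1)).2 ≠ (s n).2) :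
    ∃ x, StarFree x ∧ (∀ K, ∃ N, ∀ n, N ≤ n → Fits K (s n).1 x ∧ Fits K (s n).2 x) ∧
      ∀ i, ∃ N, ∀ n, N ≤ n → (s n).2 i ≠ none := by
  have key : ∀ i, ∃ e : A, ∃ N, ∀ n, N ≤ n → (s n).2 i = some e := by
    intro i
    -- A right end that is new at stage `n ≥ i + 1` is a midpoint whose first star is at position at
    -- least `n > i`, so its entry at `i` is a letter. Later midpoints have letters at `i` too and
    -- fit the right end they replace, so this letter never changes.
    obtain ⟨n, hn, hne⟩ := h (i + 1)
    have hr : ∀ m, i + 1 ≤ m → diff (s m).1 (s m).2 ≠ ⊤ → midPt ν (s m).1 (s m).2 i ≠ none ∧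
        ((s m).2 i = midPt ν (s m).1 (s m).2 i ∨ (s m).2 i = none) := by
      intro m hm hd
      obtain ⟨k, hk, h1, -, h2, -⟩ := hs.mid hK m hd
      exact ⟨h1 i (by omega), h2 i (by omega)⟩
    rcases hs.step n with ⟨-, h1⟩ | ⟨hd, h1 | h1⟩
    · exact absurd (by rw [h1]) hne
    · exact absurd (by rw [h1]) hne
    obtain ⟨e, he⟩ := Option.ne_none_iff_exists'.1 (hr n hn hd).1
    refine ⟨e, n + 1, fun m hm => ?_⟩
    induction m, hm using Nat.le_induction with
    | base => rw [h1]; exact he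
    | succ m hm ih =>
      rcases hs.step m with ⟨-, h2⟩ | ⟨hd, h2 | h2⟩
      · rw [h2]; exact ih
      · rw [h2]; exact ih
      · rw [h2]
        rcases (hr m (by omega) hd).2 with h3 | h3
        · exact h3.symm.trans ih
        · exact absurd (h3.symm.trans ih) (by simp)
  choose e he using key
  refine ⟨fun i => some (e i), fun i => by simp, fun K => ?_, fun i => ?_⟩
  swap
  · obtain ⟨N, hN⟩ := he i
    exact ⟨N, fun n hn => by rw [hN n hn]; simp⟩
  obtain ⟨N, hN⟩ := exists_bound he K
  refine ⟨max N K, fun n hn => ?_⟩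
  have h2 : Fits K (s n).2 fun i => some (e i) := fun i hi => Or.inl (hN i hi n (by omega))
  refine ⟨fun i hi => ?_, h2⟩
  rcases not_differ_iff.1 (hs.agree n i (by omega)) with h3 | h3 | h3
  · exact Or.inl (h3.trans (hN i hi n (by omega)))
  · exact Or.inr h3
  · rw [hN i hi n (by omega)] at h3; exact absurd h3 (by simp)

/-- Otherwise `Same.exists_fits` would allow only one point of the interval to fit `x` for long, but
both ends of a late interval do and they are different. -/
theorem IsNest.not_same_limit (hK : IsKneading ν) {s : ℕ → Itin A × Itin A} (hs : IsNest ν s)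
    {x : Itin A} (hx : StarFree x)
    (h : ∀ K, ∃ N, ∀ n, N ≤ n → Fits K (s n).1 x ∧ Fits K (s n).2 x) (n : ℕ) :
    ¬ Same ν x (s n).1 (s n).2 := by
  intro hsame
  obtain ⟨K, hK'⟩ := hsame.exists_fits hK.adm hx (hs.left_mem n).1 (hs.right_mem n).1
  obtain ⟨N, hN⟩ := h K
  have hn := hN (max n N) (by omega)
  exact hs.ne (max n N) (hK' _ _ (hs.left_mem _).1 (hs.right_mem _).1
    (Or.inl (hs.left_between hK (by omega))) (Or.inl (hs.right_between hK (by omega))) hn.1 hn.2)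

/-- Points that fit `x` are pulled by the plain shift, so a verdict reached after `j` steps holds at
the start. -/
theorem Same.of_shift_iterate {j : ℕ} {x a b : Itin A} (ha : Adm ν a) (hb : Adm ν b)
    (hx : StarFree x) (fa : Fits j a x) (fb : Fits j b x)
    (h : Same ν (shift^[j] x) (shift^[j] a) (shift^[j] b)) : Same ν x a b := by
  induction j generalizing x a b with
  | zero => exact h
  | succ j ih =>
    refine Same.step (hx 0) ?_
    rw [pull_eq_shift ha (fa 0 (by omega)), pull_eq_shift hb (fb 0 (by omega))]
    exact ih ha.shift hb.shift (fun i => hx (i + 1)) fa.shift fb.shift h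

/-- A point strictly inside all intervals has no star, and each of its entries is read off from
whichever end has a letter there. The two ends never have a joint star before their first
difference, since they are distinct. -/
theorem IsNest.unique {s : ℕ → Itin A × Itin A} (hs : IsNest ν s) {u v : Itin A} (hu : Adm ν u)
    (hv : Adm ν v) (h1 : ∀ n, ¬ Same ν u (s n).1 (s n).2 ∧ u ≠ (s n).1 ∧ u ≠ (s n).2)
    (h2 : ∀ n, ¬ Same ν v (s n).1 (s n).2 ∧ v ≠ (s n).1 ∧ v ≠ (s n).2) : u = v := by
  have key : ∀ u : Itin A, Adm ν u →
      (∀ n, ¬ Same ν u (s n).1 (s n).2 ∧ u ≠ (s n).1 ∧ u ≠ (s n).2) → StarFree u ∧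
      ∀ n, Agree n (s n).1 u ∧ Agree n (s n).2 u := by
    intro u hu h
    have := fun n => between_agree (hs.left_mem n).1 (hs.right_mem n).1 hu (hs.agree n) (h n).1
    refine ⟨fun i hi => ?_, fun n => ⟨(this n).1, (this n).2.1⟩⟩
    rcases (this (i + 1)).2.2 ⟨i, by omega, hi⟩ with h' | h'
    · exact (h (i + 1)).2.1 h'
    · exact (h (i + 1)).2.2 h'
  obtain ⟨su, au⟩ := key u hu h1
  obtain ⟨sv, av⟩ := key v hv h2
  refine su.eq_of_agree sv fun n i _ => not_differ_iff.2 (Or.inl ?_)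
  have hi : i < i + 1 := by omega
  have fu := (au (i + 1)).1.fits (fun j _ => su j) i hi
  have fu' := (au (i + 1)).2.fits (fun j _ => su j) i hi
  have fv := (av (i + 1)).1.fits (fun j _ => sv j) i hi
  have fv' := (av (i + 1)).2.fits (fun j _ => sv j) i hi
  by_cases h3 : (s (i + 1)).1 i = none
  · by_cases h4 : (s (i + 1)).2 i = none
    · exact absurd (eq_of_joint_star (hs.left_mem _).1 (hs.right_mem _).1
        ((hs.agree (i + 1)).mono (by omega)) h3 h4) (hs.ne _)
    · exact (fu'.resolve_right h4).symm.trans (fv'.resolve_right h4)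
  · exact (fu.resolve_right h3).symm.trans (fv.resolve_right h3)

open Classical in
/-- One step of a nest: cut at the midpoint and keep the half determined by `Q`. -/
def nestStep (ν : Itin A) (Q : Itin A × Itin A → Prop) (s : Itin A × Itin A) : Itin A × Itin A :=
  if diff s.1 s.2 = ⊤ then s
  else if Q s then (midPt ν s.1 s.2, s.2) else (s.1, midPt ν s.1 s.2)

/-- The nest in `[a, b]` determined by `Q`. -/
def nest (ν : Itin A) (Q : Itin A × Itin A → Prop) (a b : Itin A) : ℕ → Itin A × Itin A
  | 0 => (a, b)
  | n + 1 => nestStep ν Q (nest ν Q a b n)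

theorem isNest_nest (hK : IsKneading ν) (Q : Itin A × Itin A → Prop) {a b : Itin A} (ha : a ∈ treeItin ν)
    (hb : b ∈ treeItin ν) (hab : a ≠ b) : IsNest ν (nest ν Q a b) := by
  have hstep : ∀ s : Itin A × Itin A, (diff s.1 s.2 = ⊤ ∧ nestStep ν Q s = s) ∨
      (diff s.1 s.2 ≠ ⊤ ∧ (nestStep ν Q s = (midPt ν s.1 s.2, s.2) ∨
        nestStep ν Q s = (s.1, midPt ν s.1 s.2))) := by
    intro s
    unfold nestStep
    split_ifs with h1 h2
    · exact Or.inl ⟨h1, rfl⟩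
    · exact Or.inr ⟨h1, Or.inl rfl⟩
    · exact Or.inr ⟨h1, Or.inr rfl⟩
  have key : ∀ n, (nest ν Q a b n).1 ∈ treeItin ν ∧ (nest ν Q a b n).2 ∈ treeItin ν ∧
      (nest ν Q a b n).1 ≠ (nest ν Q a b n).2 ∧
      Agree n (nest ν Q a b n).1 (nest ν Q a b n).2 := by
    intro n
    induction n with
    | zero => exact ⟨ha, hb, hab, fun i hi => absurd hi (by omega)⟩
    | succ n ih =>
      simp only [nest]
      obtain ⟨h1, h2, h3, h4⟩ := ih
      rcases hstep (nest ν Q a b n) with ⟨hd, h⟩ | ⟨hd, h⟩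
      · rw [h]; exact ⟨h1, h2, h3, diff_eq_top_iff.1 hd _⟩
      · obtain ⟨k, hk, hkd⟩ := exists_first_diff hd
        have hnk : n ≤ k := by
          by_contra hlt
          exact h4 k (by omega) hkd
        obtain ⟨m1, m2, m3, m4, -⟩ := midPt_spec h1.1 h2.1 hk hkd
        obtain ⟨m5, -, m6, m7⟩ := midPt_mem hK h1 h2 hk hkd
        have hag : ∀ c, Fits k c (midPt ν (nest ν Q a b n).1 (nest ν Q a b n).2) →
            Agree (n + 1) c (midPt ν (nest ν Q a b n).1 (nest ν Q a b n).2) := by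
          intro c hc i hi
          by_cases hik : i < k
          · exact hc.agree i hik
          · obtain rfl : i = k := by omega
            rw [m2]; exact not_differ_iff.2 (Or.inr (Or.inr rfl))
        rcases h with h | h
        · rw [h]; exact ⟨m5, h2, m7, (hag _ m4).symm⟩
        · rw [h]; exact ⟨h1, m5, m6.symm, hag _ m3⟩
  exact ⟨fun n => (key n).1, fun n => (key n).2.1, fun n => (key n).2.2.1,
    fun n => (key n).2.2.2, fun n => hstep _⟩

theorem Chain.mem (ha : a ∈ treeItin ν) (hb : b ∈ treeItin ν) (u : Chain ν a b) :
    u.val ∈ treeItin ν := between_mem ha hb u.property.1 u.property.2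

/-- Dedekind cuts of the chains of the tree are not gaps. -/
theorem Chain.exists_cut (hK : IsKneading ν) {a b : Itin A} (ha : a ∈ treeItin ν)
    (hb : b ∈ treeItin ν) (S : Set (Chain ν a b)) (hS : IsLowerSet S) {u v : Chain ν a b}
    (hu : u ∈ S) (hv : v ∉ S) : (∃ m, IsGreatest S m) ∨ ∃ m, IsLeast Sᶜ m := by
  have hlt : ∀ {u v : Chain ν a b}, u ∈ S → v ∉ S → u < v := fun hu hv =>
    lt_of_not_ge fun h => hv (hS h hu)
  -- Bisection steered by the cut: left ends remain in `S`, right ends remain outside.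
  set s := nest ν (fun s => ∃ h, (⟨midPt ν s.1 s.2, h⟩ : Chain ν a b) ∈ S) u.val v.val with hsdef
  have hs : IsNest ν s := isNest_nest hK _ (u.mem ha hb) (v.mem ha hb)
    fun h => (hlt hu hv).ne (Chain.ext h)
  have hch : ∀ n, (∃ u ∈ S, u.val = (s n).1) ∧ ∃ v ∉ S, v.val = (s n).2 := by
    intro n
    induction n with
    | zero => exact ⟨⟨u, hu, rfl⟩, ⟨v, hv, rfl⟩⟩
    | succ n ih =>
      obtain ⟨⟨u', hu', h1⟩, ⟨v', hv', h2⟩⟩ := ih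
      have hsn : s (n + 1) = nestStep ν _ (s n) := rfl
      rw [hsn, nestStep]
      split_ifs with h3 h4
      · exact ⟨⟨u', hu', h1⟩, ⟨v', hv', h2⟩⟩
      · obtain ⟨h, h4⟩ := h4
        exact ⟨⟨_, h4, rfl⟩, ⟨v', hv', h2⟩⟩
      · refine ⟨⟨u', hu', h1⟩, ?_⟩
        obtain ⟨k, -, -, -, -, h5, h6, -⟩ := hs.mid hK n h3
        rw [← h1, ← h2] at h6
        obtain ⟨h7, -⟩ := (between_iff (hlt hu' hv') hK.adm (by rw [h1, h2]; exact h5.1)).1 h6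
        rw [h1, h2] at h7
        exact ⟨⟨_, h7⟩, fun h8 => h4 ⟨h7, h8⟩, rfl⟩
  choose U hUS hU using fun n => (hch n).1
  choose V hVS hV using fun n => (hch n).2
  have hUV : ∀ n, U n < V n := fun n => hlt (hUS n) (hVS n)
  have hUm : ∀ m n, m ≤ n → U m ≤ U n ∧ V n ≤ V m := by
    intro m n hmn
    have h1 := hs.left_between hK hmn
    have h2 := hs.right_between hK hmn
    rw [← hU m, ← hV m, between_iff (hUV m) hK.adm (hs.left_mem n).1] at h1
    rw [← hU m, ← hV m, between_iff (hUV m) hK.adm (hs.right_mem n).1] at h2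
    obtain ⟨p, h1, -⟩ := h1
    obtain ⟨q, -, h2⟩ := h2
    have e1 : (⟨_, p⟩ : Chain ν a b) = U n := Chain.ext (hU n).symm
    have e2 : (⟨_, q⟩ : Chain ν a b) = V n := Chain.ext (hV n).symm
    rw [e1] at h1; rw [e2] at h2
    exact ⟨h1, h2⟩
  have hmem : ∃ z : Chain ν a b, ∀ n, U n ≤ z ∧ z ≤ V n := by
    -- If one side stabilises, the stable end lies in all intervals. Otherwise both sides change
    -- infinitely often and the limit itinerary will do.
    by_cases hA : ∃ N, ∀ n, N ≤ n → (s (n + 1)).1 = (s n).1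
    · obtain ⟨N, hN⟩ := hA
      have hconst : ∀ n, N ≤ n → U n = U N := by
        intro n hn
        induction n, hn using Nat.le_induction with
        | base => rfl
        | succ n hn ih => rw [← ih]; exact Chain.ext (by rw [hU, hU, hN n hn])
      refine ⟨U N, fun n => ⟨?_, ?_⟩⟩
      · rcases le_total n N with h | h
        · exact (hUm n N h).1
        · exact (hconst n h).le
      · exact ((hUm N _ (le_max_left N n)).1.trans (hUV _).le).trans (hUm n _ (le_max_right N n)).2
    by_cases hB : ∃ N, ∀ n, N ≤ n → (s (n + 1)).2 = (s n).2
    · obtain ⟨N, hN⟩ := hB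
      have hconst : ∀ n, N ≤ n → V n = V N := by
        intro n hn
        induction n, hn using Nat.le_induction with
        | base => rfl
        | succ n hn ih => rw [← ih]; exact Chain.ext (by rw [hV, hV, hN n hn])
      refine ⟨V N, fun n => ⟨?_, ?_⟩⟩
      · exact ((hUm n _ (le_max_right N n)).1.trans (hUV _).le).trans (hUm N _ (le_max_left N n)).2
      · rcases le_total n N with h | h
        · exact (hUm n N h).2
        · exact (hconst n h).ge
    push Not at hA hB
    obtain ⟨x, hx, hlim, hlet⟩ := hs.exists_limit hK hB
    have hxs := hs.not_same_limit hK hx hlim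
    -- If the tail of the limit after position `j` were `ν`, take late ends, both with a letter at
    -- `j`. Their tails differ from `ν` and lie on one side of it, so the limit would not separate
    -- these ends.
    have hxA : Adm ν x := by
      intro j
      refine ⟨fun h => absurd h (hx j), fun h => ?_⟩
      exfalso
      obtain ⟨N, hN⟩ := hlim (j + 1)
      obtain ⟨M, hM⟩ := hlet j
      obtain ⟨n, hn, hne⟩ := hA (max (max N M) (j + 1))
      have ha' : (s (n + 1)).1 j ≠ none := by
        rcases hs.step n with ⟨-, h1⟩ | ⟨hd, h1 | h1⟩
        · exact absurd (by rw [h1]) hne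
        · obtain ⟨k, hk, h2, -⟩ := hs.mid hK n hd
          rw [h1]; exact h2 j (by omega)
        · exact absurd (by rw [h1]) hne
      have hfit := hN (n + 1) (by omega)
      have hb' := hM (n + 1) (by omega)
      refine hxs (n + 1) (Same.of_shift_iterate (j := j + 1) (hs.left_mem _).1 (hs.right_mem _).1
        hx hfit.1 hfit.2 ?_)
      rw [h]
      exact hK.same_critVal (shift_iterate_mem hK (hs.left_mem _) _)
        (shift_iterate_mem hK (hs.right_mem _) _)
        (fun h' => ha' (((hs.left_mem _).1 j).2 h')) (fun h' => hb' (((hs.right_mem _).1 j).2 h'))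
    refine ⟨⟨x, hxA, ?_⟩, fun n => ?_⟩
    · have h1 := hxs 0
      rw [← hU 0, ← hV 0, between_iff (hUV 0) hK.adm hxA] at h1
      exact h1.1.2
    · have h1 := hxs n
      rw [← hU n, ← hV n, between_iff (hUV n) hK.adm hxA] at h1
      exact h1.2
  obtain ⟨z, hz⟩ := hmem
  -- If the cut had neither a greatest nor a least element, moving twice away from `z` on its side
  -- of the cut would give two distinct points strictly inside all intervals.
  by_contra! hcon
  have huniq : ∀ y y' : Chain ν a b, (∀ n, U n < y ∧ y < V n) → (∀ n, U n < y' ∧ y' < V n) →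
      y = y' := by
    intro y y' hy hy'
    have key : ∀ y : Chain ν a b, (∀ n, U n < y ∧ y < V n) → ∀ n,
        ¬ Same ν y.val (s n).1 (s n).2 ∧ y.val ≠ (s n).1 ∧ y.val ≠ (s n).2 := by
      intro y hy n
      refine ⟨?_, fun h => ?_, fun h => ?_⟩
      · rw [← hU n, ← hV n, between_iff (hUV n) hK.adm y.property.1]
        exact ⟨y.property, (hy n).1.le, (hy n).2.le⟩
      · exact (hy n).1.ne (Chain.ext ((hU n).trans h.symm))
      · exact (hy n).2.ne (Chain.ext (h.trans (hV n).symm))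
    exact Chain.ext (hs.unique y.property.1 y'.property.1 (key y hy) (key y' hy'))
  by_cases hzS : z ∈ S
  · have step : ∀ z ∈ S, ∃ y ∈ S, z < y := by
      intro z hz
      by_contra! h
      exact hcon.1 z ⟨hz, h⟩
    obtain ⟨y, hy, hzy⟩ := step z hzS
    obtain ⟨y', hy', hyy'⟩ := step y hy
    exact hyy'.ne (huniq y y' (fun n => ⟨(hz n).1.trans_lt hzy, hlt hy (hVS n)⟩)
      (fun n => ⟨((hz n).1.trans_lt hzy).trans hyy', hlt hy' (hVS n)⟩))
  · have step : ∀ z ∉ S, ∃ y ∉ S, y < z := by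
      intro z hz
      by_contra! h
      exact hcon.2 z ⟨hz, h⟩
    obtain ⟨y, hy, hzy⟩ := step z hzS
    obtain ⟨y', hy', hyy'⟩ := step y hy
    exact hyy'.ne (huniq y' y (fun n => ⟨hlt (hUS n) hy', hyy'.trans (hzy.trans_le (hz n).2)⟩)
      (fun n => ⟨hlt (hUS n) hy, hzy.trans_le (hz n).2⟩))

/-! ### Edges: the pairs of itineraries that bound Fatou intervals -/

theorem IsStarPeriodic.exists_none (hP : IsStarPeriodic ν) : ∃ j, ν j = none := by
  obtain ⟨p, hp, h⟩ := hP
  exact ⟨p - 1, (h _).2.2 ⟨1, by omega⟩⟩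

theorem IsStarPeriodic.not_nonPeriodic (hP : IsStarPeriodic ν) : ¬ IsNonPeriodic ν := fun h => by
  obtain ⟨j, hj⟩ := hP.exists_none
  exact h.1 j hj

theorem StarFree.adm (hP : IsStarPeriodic ν) {x : Itin A} (hx : StarFree x) : Adm ν x := by
  intro n
  refine ⟨fun h => absurd h (hx n), fun h => ?_⟩
  obtain ⟨j, hj⟩ := hP.exists_none
  rw [← h, shift_iterate_apply] at hj
  exact absurd hj (hx _)

theorem not_starFree_shift (hP : IsStarPeriodic ν) {ρ : Itin A} (hρ : Adm ν ρ)
    (h : ¬ StarFree ρ) : ¬ StarFree (shift ρ) := by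
  obtain ⟨j, hj⟩ := hP.exists_none
  simp only [StarFree, not_forall, not_not] at h
  obtain ⟨i, hi⟩ := h
  have h1 := (hρ i).1 hi
  intro h2
  refine h2 (j + i) ?_
  rw [← h1, shift_iterate_apply] at hj
  exact hj

/-- The central itinerary of a gap: each star of one end is filled with the entry of the other end,
which is a letter because there is no joint star. -/
theorem exists_fill {p q : Itin A} (hp : Adm ν p) (hq : Adm ν q) (hpq : p ≠ q)
    (h : ∀ n, Agree n p q) : ∃ x, StarFree x ∧ ∀ n, Fits n p x ∧ Fits n q x := by
  classical
  refine ⟨fun i => if p i = none then q i else p i, fun i => ?_, fun n => ⟨fun i _ => ?_,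
    fun i _ => ?_⟩⟩
  · dsimp only
    by_cases h1 : p i = none
    · rw [if_pos h1]
      exact fun h2 => hpq (eq_of_joint_star hp hq (h i) h1 h2)
    · rwa [if_neg h1]
  · dsimp only
    by_cases h1 : p i = none
    · exact Or.inr h1
    · rw [if_neg h1]; exact Or.inl rfl
  · dsimp only
    by_cases h1 : p i = none
    · rw [if_pos h1]; exact Or.inl rfl
    · rw [if_neg h1]
      rcases not_differ_iff.1 (h (i + 1) i (by omega)) with h2 | h2 | h2
      · exact Or.inl h2.symm
      · exact absurd h2 h1
      · exact Or.inr h2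

theorem not_same_of_fits_all (hν : Adm ν ν) {x p q : Itin A} (hx : StarFree x) (hp : Adm ν p)
    (hq : Adm ν q) (hpq : p ≠ q) (h : ∀ n, Fits n p x ∧ Fits n q x) : ¬ Same ν x p q := by
  intro hs
  obtain ⟨K, hK⟩ := hs.exists_fits hν hx hp hq
  exact hpq (hK p q hp hq (Or.inl (not_same_self hν hp hq hpq.symm))
    (Or.inl (not_same_self' hν hq hp hpq)) (h K).1 (h K).2)

/-- Two adjacent itineraries of the tree. -/
structure IsEdge (ν x ρ : Itin A) : Prop where
  left_mem : x ∈ treeItin ν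
  right_mem : ρ ∈ treeItin ν
  starFree : StarFree x
  not_starFree : ¬ StarFree ρ
  agree : ∀ n, Agree n x ρ

variable {x ρ : Itin A}

theorem IsEdge.ne (h : IsEdge ν x ρ) : x ≠ ρ := fun e => h.not_starFree (e ▸ h.starFree)

theorem IsEdge.isStarPeriodic (hK : IsKneading ν) (h : IsEdge ν x ρ) : IsStarPeriodic ν :=
  hK.1.resolve_left fun hN => h.ne (hN.eq_of_agree h.left_mem.1 h.right_mem.1 h.agree)

theorem IsEdge.fits (h : IsEdge ν x ρ) (n : ℕ) : Fits n ρ x :=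
  (h.agree n).symm.fits fun i _ => h.starFree i

/-- A point between the ends agrees with both to every length. Without stars it must be `x`; with a
star it must be an end by `between_agree`. -/
theorem IsEdge.eq_or_eq (h : IsEdge ν x ρ) {z : Itin A} (hz : Adm ν z) (hs : ¬ Same ν z x ρ) :
    z = x ∨ z = ρ := by
  have := fun n => between_agree h.left_mem.1 h.right_mem.1 hz (h.agree n) hs
  by_cases hz' : StarFree z
  · exact Or.inl (hz'.eq_of_agree h.starFree fun n => (this n).1.symm)
  · simp only [StarFree, not_forall, not_not] at hz'
    obtain ⟨i, hi⟩ := hz'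
    exact (this (i + 1)).2.2 ⟨i, by omega, hi⟩

/-- No point of the tree branches off from the interior of an edge. -/
theorem IsEdge.not_same_or (hK : IsKneading ν) (h : IsEdge ν x ρ) {u : Itin A}
    (hu : u ∈ treeItin ν) : ¬ Same ν x u ρ ∨ ¬ Same ν ρ u x := by
  by_contra! hcon
  obtain ⟨h1, h2⟩ := hcon
  have hν := hK.adm
  have hux : u ≠ x := by
    rintro rfl
    exact not_same_self hν hu.1 h.right_mem.1 h.ne.symm h1
  -- Bisecting `[u, x]` towards `x` yields a left end that agrees with `x` on `K` entries. Both it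
  -- and `ρ` lie in `[u, ρ]` and fit `x` that long, so they coincide; but `ρ` is not between `u` and
  -- `x`.
  obtain ⟨K, hK'⟩ := h1.exists_fits hν h.starFree hu.1 h.right_mem.1
  have hs := isNest_nest hK (fun _ => True) hu h.left_mem hux
  set s := nest ν (fun _ => True) u x with hsdef
  have hs2 : ∀ n, (s n).2 = x := by
    intro n
    induction n with
    | zero => rfl
    | succ n ih =>
      have : s (n + 1) = nestStep ν (fun _ => True) (s n) := rfl
      rw [this, nestStep]
      split_ifs with h1
      · exact ih
      · exact ih
  have hb := hs.left_between hK (Nat.zero_le K)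
  have hne := hs.ne K
  have hag := hs.agree K
  rw [hs2] at hne hag
  have hux' : ¬ Same ν (s K).1 u x := hb
  have haρ : (s K).1 ≠ ρ := fun e => hux' (e ▸ h2)
  refine haρ (hK' _ _ (hs.left_mem K).1 h.right_mem.1 (Or.inl fun h3 => ?_)
    (Or.inl (not_same_self' hν h.right_mem.1 hu.1 fun e => ?_))
    (hag.fits fun i _ => h.starFree i) (h.fits K))
  · have h4 : ¬ Same ν (s K).1 x ρ := fun h5 => hux' (h3.trans h5.symm)
    exact (h.eq_or_eq (hs.left_mem K).1 h4).elim hne haρ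
  · subst e
    exact not_same_self hν h.right_mem.1 h.left_mem.1 h.ne h2

theorem IsEdge.shift (hK : IsKneading ν) (h : IsEdge ν x ρ) :
    IsEdge ν (Kneading.shift x) (Kneading.shift ρ) :=
  ⟨shift_mem hK h.left_mem, shift_mem hK h.right_mem, fun i => h.starFree (i + 1),
    not_starFree_shift (h.isStarPeriodic hK) h.right_mem.1 h.not_starFree,
    fun n => (h.agree (n + 1)).shift⟩

/-- A precritical point of the tree bounds an edge in the direction of every other point. -/
theorem exists_edge_towards (hK : IsKneading ν) (hP : IsStarPeriodic ν) {ρ v : Itin A}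
    (hρ : ρ ∈ treeItin ν) (hρs : ¬ StarFree ρ) (hv : v ∈ treeItin ν) (hne : ρ ≠ v) :
    ∃ x, IsEdge ν x ρ ∧ ¬ Same ν x ρ v := by
  have hν := hK.adm
  -- The nest always keeps `ρ` as its left end. Either it stops at a gap, whose central itinerary is
  -- used, or its right ends change at every step and converge to an itinerary that agrees with `ρ`
  -- forever.
  have hs := isNest_nest hK (fun _ => False) hρ hv hne
  set s := nest ν (fun _ => False) ρ v with hsdef
  have hstep : ∀ n, s (n + 1) = nestStep ν (fun _ => False) (s n) := fun n => rfl
  have hs1 : ∀ n, (s n).1 = ρ := by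
    intro n
    induction n with
    | zero => rfl
    | succ n ih =>
      rw [hstep, nestStep]
      split_ifs with h1 h2
      · exact ih
      · exact h2.elim
      · exact ih
  have finish : ∀ x, StarFree x → (∀ n, Fits n ρ x) → ¬ Same ν x ρ v →
      ∃ x, IsEdge ν x ρ ∧ ¬ Same ν x ρ v := fun x hx hf hb =>
    ⟨x, ⟨between_mem hρ hv (hx.adm hP) hb, hρ, hx, hρs, fun n => (hf n).agree.symm⟩, hb⟩
  by_cases hgap : ∃ n, diff (s n).1 (s n).2 = ⊤
  · obtain ⟨n, hn⟩ := hgap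
    obtain ⟨x, hx, hf⟩ := exists_fill (hs.left_mem n).1 (hs.right_mem n).1 (hs.ne n)
      (diff_eq_top_iff.1 hn)
    refine finish x hx (fun m => hs1 n ▸ (hf m).1) ?_
    exact hs.between_mono hK (Nat.zero_le n) (hx.adm hP)
      (not_same_of_fits_all hν hx (hs.left_mem n).1 (hs.right_mem n).1 (hs.ne n) hf)
  · push Not at hgap
    obtain ⟨x, hx, hlim, -⟩ := hs.exists_limit hK fun N => ⟨N, le_rfl, by
      obtain ⟨k, -, -, -, -, -, -, -, h⟩ := hs.mid hK N (hgap N)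
      rw [hstep, nestStep, if_neg (hgap N), if_neg not_false]
      exact h⟩
    refine finish x hx (fun n => ?_) (hs.not_same_limit hK hx hlim 0)
    obtain ⟨N, hN⟩ := hlim n
    exact hs1 N ▸ (hN N le_rfl).1

/-- Jumps are dense: a precritical point, either an end or the midpoint, is available in `[u, v]`,
and it bounds an edge in the direction of an end different from it. -/
theorem exists_edge_between (hK : IsKneading ν) (hP : IsStarPeriodic ν) {u v : Itin A}
    (hu : u ∈ treeItin ν) (hv : v ∈ treeItin ν) (huv : u ≠ v) :
    ∃ x ρ, IsEdge ν x ρ ∧ ¬ Same ν x u v ∧ ¬ Same ν ρ u v := by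
  have hν := hK.adm
  have key : ∀ u v ρ : Itin A, u ∈ treeItin ν → v ∈ treeItin ν → ρ ∈ treeItin ν →
      ¬ StarFree ρ → ρ ≠ v → ¬ Same ν ρ u v →
      ∃ x ρ, IsEdge ν x ρ ∧ ¬ Same ν x u v ∧ ¬ Same ν ρ u v := by
    intro u v ρ hu hv hρ hρs hne hb
    obtain ⟨x, hx, hxb⟩ := exists_edge_towards hK hP hρ hρs hv hne
    refine ⟨x, ρ, hx, fun h => ?_, hb⟩
    exact not_same_trans hx.left_mem.1 hρ.1 (c := v) (fun h' => hxb h'.symm)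
      (fun h' => hb h'.symm) h.symm
  by_cases hus : StarFree u
  · by_cases hvs : StarFree v
    · have hd : diff u v ≠ ⊤ := fun h => huv (hus.eq_of_agree hvs (diff_eq_top_iff.1 h))
      obtain ⟨k, hk, hkd⟩ := exists_first_diff hd
      obtain ⟨h1, h2, h3, h4⟩ := midPt_mem hK hu hv hk hkd
      exact key u v _ hu hv h1 (fun h => h k (midPt_spec hu.1 hv.1 hk hkd).2.1) h4 h2
    · obtain ⟨x, ρ, h, h1, h2⟩ := key v u v hv hu hv hvs huv.symm
        (not_same_self hν hv.1 hu.1 huv)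
      exact ⟨x, ρ, h, fun h => h1 h.symm, fun h => h2 h.symm⟩
  · exact key u v u hu hv hu hus huv (not_same_self hν hu.1 hv.1 huv.symm)

theorem IsNonPeriodic.exists_between (hK : IsKneading ν) (hN : IsNonPeriodic ν) {u v : Itin A}
    (hu : u ∈ treeItin ν) (hv : v ∈ treeItin ν) (huv : u ≠ v) :
    ∃ m ∈ treeItin ν, ¬ StarFree m ∧ ¬ Same ν m u v ∧ m ≠ u ∧ m ≠ v := by
  have hd : diff u v ≠ ⊤ := fun h => huv (hN.eq_of_agree hu.1 hv.1 (diff_eq_top_iff.1 h))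
  obtain ⟨k, hk, hkd⟩ := exists_first_diff hd
  obtain ⟨h1, h2⟩ := midPt_mem hK hu hv hk hkd
  exact ⟨_, h1, fun h => h k (midPt_spec hu.1 hv.1 hk hkd).2.1, h2⟩

/-! ### Preimages -/

/-- The shift is injective on the closed piece of `orb ν i` and maps `[⋆ν, orb ν i]` over `[ν, orb ν
(i + 1)]`. The inverse branch prepends the first symbol of `orb ν i`, except that `ν` lifts to `⋆ν`.
-/
theorem exists_lift (hK : IsKneading ν) {i : ℕ} {y : Itin A} (hy : Adm ν y)
    (h : ¬ Same ν y ν (orb ν (i + 1))) : ∃ e : A, orb ν i 0 = some e ∧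
      ((y = ν ∧ ¬ Same ν (critPt ν) (critPt ν) (orb ν i)) ∨ (y ≠ ν ∧ Adm ν (cons (some e) y) ∧
        ¬ Same ν (cons (some e) y) (critPt ν) (orb ν i))) := by
  have hν := hK.adm
  have h0 : orb ν i 0 ≠ none := fun h0 => by
    rw [orb_succ, (orb_adm hν i).zero_eq_none.1 h0] at h
    exact h (Same.eq _ _)
  obtain ⟨e, he⟩ := Option.ne_none_iff_exists'.1 h0
  refine ⟨e, he, ?_⟩
  by_cases hyν : y = ν
  · refine Or.inl ⟨hyν, fun h' => ?_⟩
    rw [same_iff_of_none rfl, critPt_zero] at h'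
    exact h0 h'.symm
  · refine Or.inr ⟨hyν, hy.cons hyν e, fun h' => h ?_⟩
    rw [same_iff (by simp [cons_zero]), shift_cons, cons_zero,
      pull_of_none (critPt_mem_adm hν) rfl, pull_of_eq he, ← orb_succ] at h'
    exact h'

theorem exists_shift_eq_of_between (hK : IsKneading ν) {i : ℕ} {y : Itin A} (hy : Adm ν y)
    (h : ¬ Same ν y ν (orb ν (i + 1))) : ∃ z, Adm ν z ∧ shift z = y ∧
      ¬ Same ν z (critPt ν) (orb ν i) := by
  obtain ⟨e, -, ⟨h1, h2⟩ | ⟨-, h1, h2⟩⟩ := exists_lift hK hy h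
  · exact ⟨_, critPt_mem_adm hK.adm, h1.symm, h2⟩
  · exact ⟨_, h1, rfl, h2⟩

/-- Both ends are lifted by the same symbol. If `ρ = ν`, its lift is `⋆ν`, whose initial star is
compatible with that symbol. -/
theorem exists_edge_shift_eq (hK : IsKneading ν) {i : ℕ} (h : IsEdge ν x ρ)
    (h1 : ¬ Same ν x ν (orb ν (i + 1))) (h2 : ¬ Same ν ρ ν (orb ν (i + 1))) :
    ∃ x' ρ', IsEdge ν x' ρ' ∧ shift x' = x ∧ shift ρ' = ρ ∧ ¬ Same ν x' (critPt ν) (orb ν i) ∧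
      ¬ Same ν ρ' (critPt ν) (orb ν i) := by
  obtain ⟨j, hj⟩ := (h.isStarPeriodic hK).exists_none
  have hxν : x ≠ ν := fun e => h.starFree j (e ▸ hj)
  obtain ⟨e, he, ⟨h3, h4⟩ | ⟨-, h3, h4⟩⟩ := exists_lift hK h.left_mem.1 h1
  · exact absurd h3 hxν
  have hmem : ∀ z, Adm ν z → ¬ Same ν z (critPt ν) (orb ν i) → z ∈ treeItin ν := fun z hz hs =>
    ⟨hz, i, hs⟩
  have hsf : StarFree (cons (some e) x) := fun k => by
    cases k with
    | zero => simp [cons]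
    | succ k => exact h.starFree k
  obtain ⟨e', he', h5⟩ := exists_lift hK h.right_mem.1 h2
  obtain rfl : e = e' := Option.some.inj (he.symm.trans he')
  rcases h5 with ⟨h5, h6⟩ | ⟨-, h5, h6⟩
  · refine ⟨_, critPt ν, ⟨hmem _ h3 h4, hmem _ (critPt_mem_adm hK.adm) h6, hsf, fun h' => h' 0 rfl,
      fun n k hk => ?_⟩, rfl, h5.symm, h4, h6⟩
    cases k with
    | zero => exact not_differ_iff.2 (Or.inr (Or.inr rfl))
    | succ k =>
      have := h.agree n k (by omega)
      rw [h5] at this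
      exact this
  · refine ⟨_, _, ⟨hmem _ h3 h4, hmem _ h5 h6, hsf, fun h' => h.not_starFree fun k => h' (k + 1),
      fun n k hk => ?_⟩, rfl, rfl, h4, h6⟩
    cases k with
    | zero => exact not_differ_iff.2 (Or.inl rfl)
    | succ k => exact h.agree n k (by omega)

/-- Split `[⋆ν, orb ν (i + 1)]` at `ν`: a point is on the critical path, or it lifts to `[⋆ν, orb ν
i]`, where the index is smaller. -/
theorem exists_iterate_eq (hK : IsKneading ν) {i : ℕ} {y : Itin A} (hy : Adm ν y)
    (h : ¬ Same ν y (critPt ν) (orb ν i)) : ∃ n < i, ∃ z, Adm ν z ∧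
      ¬ Same ν z (critPt ν) ν ∧ shift^[n] z = y := by
  induction i generalizing y with
  | zero => exact absurd (Same.eq _ _) h
  | succ i ih =>
    rcases Kneading.not_same_or ν h with h | h
    · exact ⟨0, by omega, y, hy, h, rfl⟩
    · obtain ⟨z, hz, rfl, hzs⟩ := exists_shift_eq_of_between hK hy h
      obtain ⟨n, hn, w, hw, hws, rfl⟩ := ih hz hzs
      exact ⟨n + 1, by omega, w, hw, hws, Function.iterate_succ_apply' _ _ _⟩

theorem exists_edge_iterate_eq (hK : IsKneading ν) {i : ℕ} (h : IsEdge ν x ρ)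
    (hx : ¬ Same ν x (critPt ν) (orb ν i)) (hρ : ¬ Same ν ρ (critPt ν) (orb ν i)) :
    ∃ n < i, ∃ x' ρ', IsEdge ν x' ρ' ∧ ¬ Same ν x' (critPt ν) ν ∧ ¬ Same ν ρ' (critPt ν) ν ∧
      shift^[n] x' = x ∧ shift^[n] ρ' = ρ := by
  induction i generalizing x ρ with
  | zero => exact absurd (Same.eq _ _) hx
  | succ i ih =>
    by_cases hboth : ¬ Same ν x (critPt ν) ν ∧ ¬ Same ν ρ (critPt ν) ν
    · exact ⟨0, by omega, x, ρ, h, hboth.1, hboth.2, rfl, rfl⟩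
    -- Here `p` is the end nearer to `⋆ν`. If the edge is not on the critical path, its farther end
    -- `q` is beyond `ν`; since `ν` does not branch off inside the edge, `p` lies between `ν` and
    -- `q`. Thus both ends can be lifted by the same branch.
    have key : ∀ p q : Itin A, p ∈ treeItin ν → q ∈ treeItin ν → p ≠ q →
        ¬ Same ν p (critPt ν) (orb ν (i + 1)) → ¬ Same ν q (critPt ν) (orb ν (i + 1)) →
        (¬ Same ν p ν q ∨ ¬ Same ν q ν p) → ¬ Same ν p (critPt ν) q →
        ¬ (¬ Same ν p (critPt ν) ν ∧ ¬ Same ν q (critPt ν) ν) →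
        ¬ Same ν p ν (orb ν (i + 1)) ∧ ¬ Same ν q ν (orb ν (i + 1)) := by
      intro p q hp hq hpq hpi hqi hor hpc hnb
      have hq1 : Same ν q (critPt ν) ν := by
        by_contra h1
        exact hnb ⟨not_same_trans hp.1 hq.1 hpc h1, h1⟩
      have hq2 : ¬ Same ν q ν (orb ν (i + 1)) := fun h2 => hqi (hq1.trans h2)
      refine ⟨?_, hq2⟩
      rcases hor with h1 | h1
      · exact not_same_trans hp.1 hq.1 h1 hq2
      · exfalso
        have h3 : ¬ Same ν q (critPt ν) p := fun h4 => h1 (hq1.symm.trans h4)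
        exact hpq (not_same_asymm hp.1 hq.1 hpc h3)
    have hor : ∀ u ∈ treeItin ν, ¬ Same ν x u ρ ∨ ¬ Same ν ρ u x := fun u hu => h.not_same_or hK hu
    have hfin : ¬ Same ν x ν (orb ν (i + 1)) ∧ ¬ Same ν ρ ν (orb ν (i + 1)) := by
      rcases hor _ (critPt_mem_treeItin hK) with h1 | h1
      · exact key x ρ h.left_mem h.right_mem h.ne hx hρ (hor _ (critVal_mem hK)) h1 hboth
      · exact (key ρ x h.right_mem h.left_mem h.ne.symm hρ hx (hor _ (critVal_mem hK)).symm h1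
          fun h2 => hboth h2.symm).symm
    obtain ⟨x', ρ', h', rfl, rfl, h3, h4⟩ := exists_edge_shift_eq hK h hfin.1 hfin.2
    obtain ⟨n, hn, x'', ρ'', h'', h5, h6, rfl, rfl⟩ := ih h' h3 h4
    exact ⟨n + 1, by omega, x'', ρ'', h'', h5, h6, Function.iterate_succ_apply' _ _ _,
      Function.iterate_succ_apply' _ _ _⟩

theorem IsEdge.exists_orb (hK : IsKneading ν) (h : IsEdge ν x ρ) :
    ∃ i, ¬ Same ν x (critPt ν) (orb ν i) ∧ ¬ Same ν ρ (critPt ν) (orb ν i) := by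
  rcases h.not_same_or hK (critPt_mem_treeItin hK) with h1 | h1
  · obtain ⟨i, hi⟩ := h.right_mem.2
    exact ⟨i, not_same_trans h.left_mem.1 h.right_mem.1 h1 hi, hi⟩
  · obtain ⟨i, hi⟩ := h.left_mem.2
    exact ⟨i, hi, not_same_trans h.right_mem.1 h.left_mem.1 h1 hi⟩

theorem IsNonPeriodic.exists_ne_zero (hN : IsNonPeriodic ν) : ∃ j, 1 ≤ j ∧ orb ν j 0 ≠ ν 0 := by
  by_contra! h
  refine hN.2 ⟨1, one_pos, fun i => ?_⟩
  have key : ∀ i, ν i = ν 0 := fun i => by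
    have := h (i + 1) (by omega)
    rwa [orb_succ', shift_iterate_apply, Nat.zero_add] at this
  rw [key, key i]

/-- Every point of the tree other than the critical value separates the critical value from some
point of its orbit. -/
theorem exists_not_same_critVal (hK : IsKneading ν) {y : Itin A} (hy : y ∈ treeItin ν)
    (hne : y ≠ ν) : ∃ j, ¬ Same ν y ν (orb ν (j + 1)) := by
  have hν := hK.adm
  by_contra! hall
  obtain ⟨hyA, i, hi⟩ := hy
  -- In this case `y` lies between `⋆ν` and `ν`. For periodic `ν`, `⋆ν` is itself an image of `ν`,
  -- which `y` separates from `ν`. Otherwise some image of `ν` starts with another symbol than `ν`,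
  -- hence lies on another side of `⋆ν`, and `y` separates it from `ν`.
  have hi' : Same ν y ν (orb ν i) → False := fun h => by
    have hc : ¬ Same ν y (critPt ν) ν := fun h' => hi (h'.trans h)
    rcases hK.1 with hN | ⟨p, hp, hP⟩
    · obtain ⟨j, hj1, hj⟩ := hN.exists_ne_zero
      obtain ⟨k, rfl⟩ : ∃ k, j = k + 1 := ⟨j - 1, by omega⟩
      by_cases hyc : y = critPt ν
      · subst hyc
        exact hj ((same_iff_of_none rfl).1 (hall k)).symm
      · have h1 : Same ν (critPt ν) ν y := by
          rcases same_or_same hyA (critPt_mem_adm hν) hyc ν with h1 | h1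
          · exact absurd h1.symm hc
          · exact h1
        rcases same_or_same hyA (critPt_mem_adm hν) hyc (orb ν (k + 1)) with h2 | h2
        · exact hc ((hall k).trans h2).symm
        · exact hj ((same_iff_of_none rfl).1 (h1.trans h2.symm)).symm
    · have := hall (p - 1)
      rw [Nat.sub_add_cancel hp] at this
      have h2 := IsStarPeriodic.orb_add hp hP 0
      rw [Nat.zero_add, orb_zero] at h2
      rw [h2] at this
      exact hc this.symm
  cases i with
  | zero => exact hi (Same.eq _ _)
  | succ i => exact hi' (hall i)

theorem exists_mem_shift_eq (hK : IsKneading ν) {y : Itin A} (hy : y ∈ treeItin ν) :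
    ∃ z ∈ treeItin ν, shift z = y := by
  by_cases hne : y = ν
  · exact ⟨critPt ν, critPt_mem_treeItin hK, hne.symm⟩
  · obtain ⟨j, hj⟩ := exists_not_same_critVal hK hy hne
    obtain ⟨z, hz, h1, h2⟩ := exists_shift_eq_of_between hK hy.1 hj
    exact ⟨z, ⟨hz, j, h2⟩, h1⟩

theorem IsEdge.exists_shift_eq (hK : IsKneading ν) (h : IsEdge ν x ρ) :
    ∃ x' ρ', IsEdge ν x' ρ' ∧ Kneading.shift x' = x ∧ Kneading.shift ρ' = ρ := by
  have hν := hK.adm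
  have hP := h.isStarPeriodic hK
  obtain ⟨j, hj⟩ := hP.exists_none
  have hxν : x ≠ ν := fun e => h.starFree j (e ▸ hj)
  have fin : ∀ i, ¬ Same ν x ν (orb ν (i + 1)) → ¬ Same ν ρ ν (orb ν (i + 1)) →
      ∃ x' ρ', IsEdge ν x' ρ' ∧ Kneading.shift x' = x ∧ Kneading.shift ρ' = ρ := by
    intro i h1 h2
    obtain ⟨x', ρ', h', hx', hρ', -⟩ := exists_edge_shift_eq hK h h1 h2
    exact ⟨x', ρ', h', hx', hρ'⟩
  rcases h.not_same_or hK (critVal_mem hK) with h1 | h1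
  · by_cases hρν : ρ = ν
    · obtain ⟨i, hi⟩ := exists_not_same_critVal hK h.left_mem hxν
      refine fin i hi (not_same_trans h.right_mem.1 h.left_mem.1 ?_ hi)
      rw [hρν]
      exact not_same_self hν hν h.left_mem.1 hxν
    · obtain ⟨i, hi⟩ := exists_not_same_critVal hK h.right_mem hρν
      exact fin i (not_same_trans h.left_mem.1 h.right_mem.1 h1 hi) hi
  · obtain ⟨i, hi⟩ := exists_not_same_critVal hK h.left_mem hxν
    exact fin i hi (not_same_trans h.right_mem.1 h.left_mem.1 h1 hi)

/-! ### The finite sets of precritical points -/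

/-- The strict order of the chain `[a, b]`. -/
def CLt (ν a b u v : Itin A) : Prop :=
  ∃ hu hv, (⟨u, hu⟩ : Chain ν a b) < (⟨v, hv⟩ : Chain ν a b)

theorem CLt.trans {a b u v w : Itin A} (h : CLt ν a b u v) (h' : CLt ν a b v w) :
    CLt ν a b u w := by
  obtain ⟨hu, hv, h⟩ := h
  obtain ⟨_, hw, h'⟩ := h'
  exact ⟨hu, hw, h.trans h'⟩

theorem CLt.asymm {a b u v : Itin A} (h : CLt ν a b u v) (h' : CLt ν a b v u) : False := by
  obtain ⟨hu, hv, h⟩ := h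
  obtain ⟨_, _, h'⟩ := h'
  exact lt_asymm h h'

theorem cLt_iff {a b u v : Itin A} (hu : Adm ν u ∧ ¬ Same ν u a b) (hv : Adm ν v ∧ ¬ Same ν v a b) :
    CLt ν a b u v ↔ (⟨u, hu⟩ : Chain ν a b) < (⟨v, hv⟩ : Chain ν a b) :=
  ⟨fun ⟨_, _, h⟩ => h, fun h => ⟨hu, hv, h⟩⟩

theorem CLt.ne {a b u v : Itin A} (h : CLt ν a b u v) : u ≠ v := by
  rintro rfl; exact h.asymm h

theorem CLt.between {a b u v z : Itin A} (hν : Adm ν ν) (h : CLt ν a b u v) (hz : Adm ν z)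
    (hs : ¬ Same ν z u v) (h1 : z ≠ u) (h2 : z ≠ v) : CLt ν a b u z ∧ CLt ν a b z v := by
  obtain ⟨hu, hv, h⟩ := h
  obtain ⟨hz', h3, h4⟩ := (Chain.between_iff h hν hz).1 hs
  exact ⟨⟨hu, hz', lt_of_le_of_ne h3 fun e => h1 (congrArg Chain.val e).symm⟩,
    ⟨hz', hv, lt_of_le_of_ne h4 fun e => h2 (congrArg Chain.val e)⟩⟩

theorem exists_insertMids_cons (b : Itin A) (l : List (Itin A)) :
    ∃ t, insertMids ν (b :: l) = b :: t := by
  cases l with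
  | nil => exact ⟨[], rfl⟩
  | cons c l =>
    simp only [insertMids]
    split_ifs <;> exact ⟨_, rfl⟩

theorem subset_insertMids (l : List (Itin A)) : ∀ u ∈ l, u ∈ insertMids ν l := by
  induction l with
  | nil => exact fun u h => h
  | cons a l ih =>
    cases l with
    | nil => exact fun u h => h
    | cons b l =>
      intro u hu
      simp only [insertMids]
      rcases List.mem_cons.1 hu with rfl | hu
      · split_ifs <;> exact List.mem_cons_self
      · have := ih u hu
        split_ifs
        · exact List.mem_cons_of_mem _ this
        · exact List.mem_cons_of_mem _ (List.mem_cons_of_mem _ this)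

theorem infix_insertMids {a b : Itin A} {l : List (Itin A)} (h : [a, b] <:+: l) :
    (diff a b = ⊤ → [a, b] <:+: insertMids ν l) ∧
      (diff a b ≠ ⊤ → [a, midPt ν a b] <:+: insertMids ν l ∧
        [midPt ν a b, b] <:+: insertMids ν l) := by
  induction l with
  | nil => simp at h
  | cons x l ih =>
    cases l with
    | nil =>
      have := h.length_le
      simp at this
    | cons y l =>
      rcases List.infix_cons_iff.1 h with h | h
      · obtain ⟨t, ht⟩ := h
        simp only [List.cons_append, List.nil_append, List.cons.injEq] at ht
        obtain ⟨rfl, rfl, rfl⟩ := ht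
        obtain ⟨t', ht'⟩ := exists_insertMids_cons (ν := ν) b t
        simp only [insertMids]
        refine ⟨fun hd => ?_, fun hd => ?_⟩
        · rw [if_pos hd, ht']; exact ⟨[], t', by simp⟩
        · rw [if_neg hd, ht']
          exact ⟨⟨[], b :: t', by simp⟩, ⟨[a], t', by simp⟩⟩
      · have key : ∀ m : List (Itin A), m <:+: insertMids ν (y :: l) →
            m <:+: insertMids ν (x :: y :: l) := by
          intro m hm
          simp only [insertMids]
          split_ifs
          · exact List.infix_cons hm
          · exact List.infix_cons (List.infix_cons hm)
        exact ⟨fun hd => key _ ((ih h).1 hd), fun hd => ⟨key _ ((ih h).2 hd).1,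
          key _ ((ih h).2 hd).2⟩⟩

theorem mem_insertMids {l : List (Itin A)} {u : Itin A} (h : u ∈ insertMids ν l) :
    u ∈ l ∨ ∃ a b, [a, b] <:+: l ∧ diff a b ≠ ⊤ ∧ u = midPt ν a b := by
  induction l with
  | nil => exact Or.inl h
  | cons x l ih =>
    cases l with
    | nil => exact Or.inl h
    | cons y l =>
      have key : u ∈ insertMids ν (y :: l) → u ∈ x :: y :: l ∨
          ∃ a b, [a, b] <:+: x :: y :: l ∧ diff a b ≠ ⊤ ∧ u = midPt ν a b := fun h => by
        rcases ih h with h | ⟨a, b, h1, h2⟩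
        · exact Or.inl (List.mem_cons_of_mem _ h)
        · exact Or.inr ⟨a, b, List.infix_cons h1, h2⟩
      simp only [insertMids] at h
      split_ifs at h with hd
      · rcases List.mem_cons.1 h with rfl | h
        · exact Or.inl List.mem_cons_self
        · exact key h
      · rcases List.mem_cons.1 h with rfl | h
        · exact Or.inl List.mem_cons_self
        rcases List.mem_cons.1 h with rfl | h
        · exact Or.inr ⟨x, y, ⟨[], l, by simp⟩, hd, rfl⟩
        · exact key h

theorem isChain_insertMids {R : Itin A → Itin A → Prop} {l : List (Itin A)}
    (hR : ∀ a b, R a b → diff a b ≠ ⊤ → R a (midPt ν a b) ∧ R (midPt ν a b) b)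
    (h : l.IsChain R) : (insertMids ν l).IsChain R := by
  induction l with
  | nil => exact h
  | cons x l ih =>
    cases l with
    | nil => exact h
    | cons y l =>
      obtain ⟨h1, h2⟩ := List.isChain_cons_cons.1 h
      have h3 := ih h2
      obtain ⟨t, ht⟩ := exists_insertMids_cons (ν := ν) y l
      simp only [insertMids]
      rw [ht] at h3 ⊢
      split_ifs with hd
      · exact List.isChain_cons_cons.2 ⟨h1, h3⟩
      · obtain ⟨h4, h5⟩ := hR _ _ h1 hd
        exact List.isChain_cons_cons.2 ⟨h4, List.isChain_cons_cons.2 ⟨h5, h3⟩⟩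

theorem mem_of_infix {a b : Itin A} {l : List (Itin A)} (h : [a, b] <:+: l) : a ∈ l ∧ b ∈ l :=
  ⟨h.subset (by simp), h.subset (by simp)⟩

theorem midPt_cLt (hK : IsKneading ν) {a b u v : Itin A} (ha : a ∈ treeItin ν)
    (hb : b ∈ treeItin ν) (h : CLt ν a b u v) (hd : diff u v ≠ ⊤) :
    CLt ν a b u (midPt ν u v) ∧ CLt ν a b (midPt ν u v) v := by
  have h' := h
  obtain ⟨hu, hv, hlt⟩ := h'
  obtain ⟨k, hk, hkd⟩ := exists_first_diff hd
  obtain ⟨h1, h2, h3, h4⟩ := midPt_mem hK (between_mem ha hb hu.1 hu.2)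
    (between_mem ha hb hv.1 hv.2) hk hkd
  exact h.between hK.adm h1.1 h2 h3 h4

theorem critPt_prop (hK : IsKneading ν) :
    Adm ν (critPt ν) ∧ ¬ Same ν (critPt ν) (critPt ν) ν :=
  ⟨critPt_mem_adm hK.adm, not_same_self hK.adm (critPt_mem_adm hK.adm) hK.adm hK.critPt_ne.symm⟩

theorem critVal_prop (hK : IsKneading ν) : Adm ν ν ∧ ¬ Same ν ν (critPt ν) ν :=
  ⟨hK.adm, not_same_self' hK.adm hK.adm (critPt_mem_adm hK.adm) hK.critPt_ne⟩

theorem isChain_precPts (hK : IsKneading ν) (n : ℕ) :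
    (precPts ν n).IsChain (CLt ν (critPt ν) ν) := by
  induction n with
  | zero =>
    refine List.isChain_cons_cons.2 ⟨⟨critPt_prop hK, critVal_prop hK, ?_⟩,
      List.IsChain.singleton _⟩
    exact Chain.lt_iff.2 ⟨fun e => hK.critPt_ne (congrArg Chain.val e), (critPt_prop hK).2⟩
  | succ n ih =>
    exact isChain_insertMids (fun a b h hd =>
      midPt_cLt hK (critPt_mem_treeItin hK) (critVal_mem hK) h hd) ih

theorem pairwise_precPts (hK : IsKneading ν) (n : ℕ) :
    (precPts ν n).Pairwise (CLt ν (critPt ν) ν) := by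
  have : Trans (CLt ν (critPt ν) ν) (CLt ν (critPt ν) ν) (CLt ν (critPt ν) ν) := ⟨CLt.trans⟩
  exact List.isChain_iff_pairwise.1 (isChain_precPts hK n)

theorem cLt_of_infix (hK : IsKneading ν) {n : ℕ} {a b : Itin A} (h : [a, b] <:+: precPts ν n) :
    CLt ν (critPt ν) ν a b :=
  List.pairwise_iff_forall_sublist.1 (pairwise_precPts hK n) h.sublist

theorem precPts_prop (hK : IsKneading ν) {n : ℕ} {u : Itin A} (h : u ∈ precPts ν n) :
    (Adm ν u ∧ ¬ Same ν u (critPt ν) ν) ∧ (u = ν ∨ ¬ StarFree u) := by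
  induction n generalizing u with
  | zero =>
    simp only [precPts, List.mem_cons, List.not_mem_nil, or_false] at h
    rcases h with rfl | rfl
    · exact ⟨critPt_prop hK, Or.inr fun h => h 0 rfl⟩
    · exact ⟨critVal_prop hK, Or.inl rfl⟩
  | succ n ih =>
    rcases mem_insertMids h with h | ⟨a, b, hab, hd, rfl⟩
    · exact ih h
    · have h1 := cLt_of_infix hK hab
      obtain ⟨⟨ha, h2, -⟩, -⟩ := midPt_cLt hK (critPt_mem_treeItin hK) (critVal_mem hK) h1 hd
      obtain ⟨_, hb, _⟩ := h1
      obtain ⟨k, hk, hkd⟩ := exists_first_diff hd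
      exact ⟨h2, Or.inr fun h => h k (midPt_spec ha.1 hb.1 hk hkd).2.1⟩

theorem precPts_mono {n m : ℕ} (hnm : n ≤ m) {u : Itin A} (h : u ∈ precPts ν n) :
    u ∈ precPts ν m := by
  induction m, hnm using Nat.le_induction with
  | base => exact h
  | succ m _ ih => exact subset_insertMids _ _ ih

theorem le_or_ge_of_infix {R : Itin A → Itin A → Prop} {l : List (Itin A)} (hl : l.Pairwise R)
    {a b u : Itin A} (h : [a, b] <:+: l) (hu : u ∈ l) :
    (u = a ∨ R u a) ∨ (u = b ∨ R b u) := by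
  obtain ⟨s, t, rfl⟩ := h
  simp only [List.append_assoc, List.pairwise_append, List.mem_append, List.mem_cons,
    List.cons_append, List.nil_append, List.pairwise_cons] at hl hu
  rcases hu with hu | hu | hu | hu
  · exact Or.inl (Or.inr (hl.2.2 u hu a (Or.inl rfl)))
  · exact Or.inl (Or.inl hu)
  · exact Or.inr (Or.inl hu)
  · exact Or.inr (Or.inr (hl.2.1.2.1 u hu))

theorem sublist_of_pairwise {R : Itin A → Itin A → Prop} (hR : ∀ u v, R u v → ¬ R v u)
    {l : List (Itin A)} (hl : l.Pairwise R) {u v : Itin A} (hu : u ∈ l) (hv : v ∈ l)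
    (h : R u v) : List.Sublist [u, v] l := by
  induction l with
  | nil => simp at hu
  | cons x l ih =>
    rw [List.pairwise_cons] at hl
    rcases List.mem_cons.1 hv with hv' | hv'
    · rcases List.mem_cons.1 hu with hu' | hu'
      · rw [hu', hv'] at h; exact absurd h (hR _ _ h)
      · rw [hv'] at h; exact absurd h (hR _ _ (hl.1 u hu'))
    · rcases List.mem_cons.1 hu with rfl | hu'
      · exact List.Sublist.cons_cons _ (List.singleton_sublist.2 hv')
      · exact List.Sublist.cons _ (ih hl.2 hu' hv')

/-! ### Nests around a point -/

/-- The nest in `[⋆ν, ν]` that converges to `z`. -/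
def nestAt (ν z : Itin A) : ℕ → Itin A × Itin A :=
  nest ν (fun s => ¬ Same ν z (midPt ν s.1 s.2) s.2) (critPt ν) ν

theorem isNest_nestAt (hK : IsKneading ν) (z : Itin A) : IsNest ν (nestAt ν z) :=
  isNest_nest hK _ (critPt_mem_treeItin hK) (critVal_mem hK) hK.critPt_ne

theorem nestAt_between {z : Itin A} (hs : ¬ Same ν z (critPt ν) ν) (n : ℕ) :
    ¬ Same ν z (nestAt ν z n).1 (nestAt ν z n).2 := by
  induction n with
  | zero => exact hs
  | succ n ih =>
    have : nestAt ν z (n + 1) =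
        nestStep ν (fun s => ¬ Same ν z (midPt ν s.1 s.2) s.2) (nestAt ν z n) := rfl
    rw [this, nestStep]
    split_ifs with h1 h2
    · exact ih
    · exact (not_same_or _ ih).resolve_right (not_not.2 h2)
    · exact h2

theorem nestAt_infix (z : Itin A) (n : ℕ) :
    [(nestAt ν z n).1, (nestAt ν z n).2] <:+: precPts ν n := by
  induction n with
  | zero => exact List.infix_rfl
  | succ n ih =>
    have : nestAt ν z (n + 1) =
        nestStep ν (fun s => ¬ Same ν z (midPt ν s.1 s.2) s.2) (nestAt ν z n) := rfl
    rw [this, nestStep]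
    split_ifs with h1 h2
    · exact (infix_insertMids ih).1 h1
    · exact ((infix_insertMids ih).2 h1).1
    · exact ((infix_insertMids ih).2 h1).2

theorem nestAt_agree (hK : IsKneading ν) {z : Itin A} (hz : Adm ν z)
    (hs : ¬ Same ν z (critPt ν) ν) (n : ℕ) :
    Agree n (nestAt ν z n).1 z ∧ Agree n (nestAt ν z n).2 z ∧
      ((∃ i < n, z i = none) → z = (nestAt ν z n).1 ∨ z = (nestAt ν z n).2) := by
  have h := isNest_nestAt hK z
  exact between_agree (h.left_mem n).1 (h.right_mem n).1 hz (h.agree n) (nestAt_between hs n)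

/-- After `i + 1` bisections the ends agree with `z` beyond its star at position `i`, and then
`between_agree` leaves only the ends. -/
theorem mem_PInf (hK : IsKneading ν) {z : Itin A} (hz : Adm ν z)
    (hs : ¬ Same ν z (critPt ν) ν) (hzs : ¬ StarFree z) : z ∈ PInf ν := by
  simp only [StarFree, not_forall, not_not] at hzs
  obtain ⟨i, hi⟩ := hzs
  have h := mem_of_infix (nestAt_infix (ν := ν) z (i + 1))
  rcases (nestAt_agree hK hz hs (i + 1)).2.2 ⟨i, by omega, hi⟩ with h1 | h1
  · exact ⟨i + 1, h1 ▸ h.1⟩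
  · exact ⟨i + 1, h1 ▸ h.2⟩

theorem PInf_prop (hK : IsKneading ν) {u : Itin A} (h : u ∈ PInf ν) :
    (Adm ν u ∧ ¬ Same ν u (critPt ν) ν) ∧ (u = ν ∨ ¬ StarFree u) := by
  obtain ⟨n, h⟩ := h
  exact precPts_prop hK h

theorem exists_wordCons {n : ℕ} {x : Itin A} (h : ∀ i < n, x i ≠ none) :
    ∃ w : List A, w.length = n ∧ x = wordCons w (shift^[n] x) := by
  induction n generalizing x with
  | zero => exact ⟨[], rfl, rfl⟩
  | succ n ih =>
    obtain ⟨w, hw, h1⟩ := ih (x := shift x) fun i hi => h (i + 1) (by omega)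
    obtain ⟨e, he⟩ := Option.ne_none_iff_exists'.1 (h 0 (by omega))
    refine ⟨e :: w, by simp [hw], ?_⟩
    show x = cons (some e) (wordCons w (shift^[n] (shift x)))
    rw [← h1, ← he, cons_shift]

theorem wordCons_apply (w : List A) (y : Itin A) (i : ℕ) :
    (i < w.length → wordCons w y i ≠ none) ∧ wordCons w y (i + w.length) = y i := by
  induction w generalizing i with
  | nil => exact ⟨fun h => by simp at h, rfl⟩
  | cons e w ih =>
    refine ⟨fun h => ?_, (ih i).2⟩
    cases i with
    | zero => simp [wordCons, cons]
    | succ i => exact (ih i).1 (by simpa using h)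

theorem shift_wordCons (w : List A) (y : Itin A) : shift^[w.length] (wordCons w y) = y :=
  funext fun i => by rw [shift_iterate_apply]; exact (wordCons_apply w y i).2

theorem Adm.mem_itinSpace {z : Itin A} (hz : Adm ν z) : z ∈ itinSpace ν := by
  by_cases h : StarFree z
  · refine Or.inr (Or.inr (Or.inr ⟨h, ?_⟩))
    rintro ⟨w, hw, rfl⟩
    obtain ⟨n, hn⟩ : ∃ n, w.length = n + 1 :=
      ⟨w.length - 1, by have := List.length_pos_of_ne_nil hw; omega⟩
    have h1 := shift_wordCons w ν
    rw [hn] at h1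
    exact h n ((hz n).2 h1)
  · classical
    simp only [StarFree, not_forall, not_not] at h
    refine Or.inr (Or.inr (Or.inl ?_))
    obtain ⟨w, -, hw⟩ := exists_wordCons (n := Nat.find h) fun i hi => Nat.find_min h hi
    rw [(hz.iterate _).eq_critPt
      (by rw [shift_iterate_apply, Nat.zero_add]; exact Nat.find_spec h)] at hw
    exact ⟨w, hw⟩

/-- Restricted to sequences without `⋆`: for periodic `ν` the space also contains precritical points
in which a letter is followed by `ν`, and these are not admissible. -/
theorem adm_of_mem_itinSpace (hK : IsKneading ν) {z : Itin A} (hz : z ∈ itinSpace ν)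
    (hs : StarFree z) : Adm ν z := by
  rcases hz with rfl | ⟨k, -, rfl⟩ | ⟨w, rfl⟩ | ⟨-, h⟩
  · exact hK.adm
  · exact orb_adm hK.adm k
  · refine absurd ((wordCons_apply w (critPt ν) 0).2) ?_
    exact fun h => hs _ (h.trans rfl)
  · intro n
    refine ⟨fun h' => absurd h' (hs n), fun h' => ?_⟩
    exfalso
    obtain ⟨w, hw, h1⟩ := exists_wordCons (n := n + 1) (x := z) fun i _ => hs i
    rw [h'] at h1
    exact h ⟨w, fun e => by simp [e] at hw, h1⟩

/-! ### The itineraries of the critical path -/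

theorem tendsto_top_of_agree {f : ℕ → Itin A} {z : Itin A} (h : ∀ n, Agree n (f n) z) :
    Tendsto (fun n => diff (f n) z) atTop (𝓝 ⊤) := by
  rw [ENat.tendsto_nhds_top_iff_natCast_lt]
  intro n
  filter_upwards [eventually_ge_atTop n] with m hm
  exact (Nat.cast_lt.2 (Nat.lt_succ_of_le hm)).trans_le (le_diff_iff.2 (h m))

theorem agree_of_tendsto {f : ℕ → Itin A} {z : Itin A}
    (h : Tendsto (fun n => diff (f n) z) atTop (𝓝 ⊤)) (K : ℕ) :
    ∃ N, ∀ n, N ≤ n → Agree K (f n) z := by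
  rw [ENat.tendsto_nhds_top_iff_natCast_lt] at h
  obtain ⟨N, hN⟩ := eventually_atTop.1 (h (K + 1))
  exact ⟨N, fun n hn => le_diff_iff.1 (hN n hn).le⟩

theorem nestAt_isNestLimit (hK : IsKneading ν) {z : Itin A} (hz : Adm ν z)
    (hs : ¬ Same ν z (critPt ν) ν) (hzs : StarFree z) :
    IsNestLimit ν z (fun n => (nestAt ν z n).1) (fun n => (nestAt ν z n).2) := by
  refine ⟨hz.mem_itinSpace, hzs, nestAt_infix z, fun n => ?_,
    tendsto_top_of_agree fun n => (nestAt_agree hK hz hs n).1,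
    tendsto_top_of_agree fun n => (nestAt_agree hK hz hs n).2.1⟩
  rcases (isNest_nestAt hK z).step n with ⟨-, h⟩ | ⟨-, h | h⟩
  · exact Or.inl (by simp only [h])
  · exact Or.inr (by simp only [h])
  · exact Or.inl (by simp only [h])

/-- The finite sets are ordered as in the chain `[⋆ν, ν]`, so adjacent intervals sharing an end with
their predecessor are nested. If `x` did not separate the ends of some interval, only one point of
it could fit `x` for long, but both ends of every late interval do. -/
theorem IsNestLimit.between (hK : IsKneading ν) {x : Itin A} {a b : ℕ → Itin A}
    (h : IsNestLimit ν x a b) : Adm ν x ∧ (∀ n, ¬ Same ν x (a n) (b n)) ∧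
      ¬ Same ν x (critPt ν) ν := by
  have hν := hK.adm
  obtain ⟨h1, h2, h3, h4, h5, h6⟩ := h
  have hx := adm_of_mem_itinSpace hK h1 h2
  have hlt := fun n => cLt_of_infix hK (h3 n)
  have hmono : ∀ n m, n ≤ m → (a m = a n ∨ CLt ν (critPt ν) ν (a n) (a m)) ∧
      (b m = b n ∨ CLt ν (critPt ν) ν (b m) (b n)) := by
    intro n m hnm
    induction m, hnm using Nat.le_induction with
    | base => exact ⟨Or.inl rfl, Or.inl rfl⟩
    | succ m _ ih =>
      have hpw := pairwise_precPts hK (m + 1)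
      rcases h4 m with h7 | h7
      · refine ⟨by rw [h7]; exact ih.1, ?_⟩
        have hb : b m ∈ precPts ν (m + 1) :=
          precPts_mono (Nat.le_succ m) (mem_of_infix (h3 m)).2
        rcases le_or_ge_of_infix hpw (h3 (m + 1)) hb with (h8 | h8) | (h8 | h8)
        · exact absurd (h8.trans h7) (hlt m).ne.symm
        · rw [h7] at h8; exact (h8.asymm (hlt m)).elim
        · rw [← h8]; exact ih.2
        · rcases ih.2 with h9 | h9
          · rw [← h9]; exact Or.inr h8
          · exact Or.inr (h8.trans h9)
      · refine ⟨?_, by rw [h7]; exact ih.2⟩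
        have ha : a m ∈ precPts ν (m + 1) :=
          precPts_mono (Nat.le_succ m) (mem_of_infix (h3 m)).1
        rcases le_or_ge_of_infix hpw (h3 (m + 1)) ha with (h8 | h8) | (h8 | h8)
        · rw [← h8]; exact ih.1
        · rcases ih.1 with h9 | h9
          · rw [← h9]; exact Or.inr h8
          · exact Or.inr (h9.trans h8)
        · exact absurd (h8.trans h7) (hlt m).ne
        · rw [h7] at h8; exact (h8.asymm (hlt m)).elim
  have hbt : ∀ n, ¬ Same ν x (a n) (b n) := by
    intro n hs
    obtain ⟨han, hbn, hlt'⟩ := hlt n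
    obtain ⟨K, hK'⟩ := hs.exists_fits hν h2 han.1 hbn.1
    obtain ⟨N₁, hN₁⟩ := agree_of_tendsto h5 K
    obtain ⟨N₂, hN₂⟩ := agree_of_tendsto h6 K
    obtain ⟨m, hm⟩ : ∃ m, max n (max N₁ N₂) ≤ m := ⟨_, le_rfl⟩
    obtain ⟨ham, hbm, hltm⟩ := hlt m
    obtain ⟨m1, m2⟩ := hmono n m (by omega)
    have e1 : (⟨a n, han⟩ : Chain ν (critPt ν) ν) ≤ ⟨a m, ham⟩ :=
      m1.elim (fun e => (Chain.ext e.symm : (⟨a n, han⟩ : Chain ν _ _) = ⟨a m, ham⟩).le)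
        fun h => ((cLt_iff _ _).1 h).le
    have e2 : (⟨b m, hbm⟩ : Chain ν (critPt ν) ν) ≤ ⟨b n, hbn⟩ :=
      m2.elim (fun e => (Chain.ext e : (⟨b m, hbm⟩ : Chain ν _ _) = ⟨b n, hbn⟩).le)
        fun h => ((cLt_iff _ _).1 h).le
    refine (hlt m).ne (hK' _ _ ham.1 hbm.1
      (Or.inl ((Chain.between_iff hlt' hν ham.1).2 ⟨ham, e1, hltm.le.trans e2⟩))
      (Or.inl ((Chain.between_iff hlt' hν hbm.1).2 ⟨hbm, e1.trans hltm.le, e2⟩))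
      ((hN₁ m (by omega)).fits fun i _ => h2 i) ((hN₂ m (by omega)).fits fun i _ => h2 i))
  refine ⟨hx, hbt, ?_⟩
  obtain ⟨ha, hb, hlt'⟩ := hlt 0
  exact ((Chain.between_iff hlt' hν hx).1 (hbt 0)).1.2

/-- The itineraries of the critical path are the points between `⋆ν` and `ν`. -/
theorem mem_pathItin_iff (hK : IsKneading ν) {z : Itin A} :
    z ∈ pathItin ν ↔ Adm ν z ∧ ¬ Same ν z (critPt ν) ν := by
  constructor
  · rintro (h | ⟨a, b, h⟩)
    · exact (PInf_prop hK h).1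
    · exact ⟨(h.between hK).1, (h.between hK).2.2⟩
  · rintro ⟨hz, hs⟩
    by_cases h : StarFree z
    · exact Or.inr ⟨_, _, nestAt_isNestLimit hK hz hs h⟩
    · exact Or.inl (mem_PInf hK hz hs h)

theorem PInf_not_starFree (hK : IsKneading ν) (hP : IsStarPeriodic ν) {u : Itin A}
    (h : u ∈ PInf ν) : ¬ StarFree u := by
  rcases (PInf_prop hK h).2 with rfl | h
  · obtain ⟨j, hj⟩ := hP.exists_none
    exact fun h => h j hj
  · exact h

theorem PInf_mem_treeItin (hK : IsKneading ν) {u : Itin A} (h : u ∈ PInf ν) : u ∈ treeItin ν :=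
  between_mem (critPt_mem_treeItin hK) (critVal_mem hK) (PInf_prop hK h).1.1 (PInf_prop hK h).1.2

/-- The intervals between adjacent points of the `n`-th set eventually lie on one side of a given
point of `P_∞`. -/
theorem eventually_side (hK : IsKneading ν) {ρ : Itin A} (hρ : ρ ∈ PInf ν) :
    ∃ N, ∀ n, N ≤ n → ∀ a b, [a, b] <:+: precPts ν n →
      (ρ = a ∨ CLt ν (critPt ν) ν ρ a) ∨ (ρ = b ∨ CLt ν (critPt ν) ν b ρ) := by
  obtain ⟨N, hN⟩ := hρ
  exact ⟨N, fun n hn a b h => le_or_ge_of_infix (pairwise_precPts hK n) h (precPts_mono hn hN)⟩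

/-- A constant boundary point of intervals shrinking to `x` agrees with `x` forever, which gives an
edge. Conversely the bisection around the star-free end of an edge must eventually have the other
end as a constant boundary point. -/
theorem fatouPair_iff (hK : IsKneading ν) {x ρ : Itin A} :
    FatouPair ν x ρ ↔ IsEdge ν x ρ ∧ ¬ Same ν x (critPt ν) ν ∧ ¬ Same ν ρ (critPt ν) ν := by
  have hν := hK.adm
  constructor
  · rintro ⟨hP, a, b, h, h'⟩
    obtain ⟨hx, hbt, hs⟩ := h.between hK
    obtain ⟨-, h2, h3, -, h5, h6⟩ := h
    have key : ∀ f : ℕ → Itin A, (∀ n, f n ∈ precPts ν n) →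
        Tendsto (fun n => diff (f n) x) atTop (𝓝 ⊤) → (∀ᶠ n in atTop, f n = ρ) →
        ρ ∈ PInf ν ∧ ∀ n, Agree n x ρ := by
      intro f hf ht he
      obtain ⟨N, hN⟩ := eventually_atTop.1 he
      refine ⟨⟨N, hN N le_rfl ▸ hf N⟩, fun n => ?_⟩
      obtain ⟨M, hM⟩ := agree_of_tendsto ht n
      have := hM (max N M) (le_max_right _ _)
      rw [hN _ (le_max_left _ _)] at this
      exact this.symm
    have h7 : ρ ∈ PInf ν ∧ ∀ n, Agree n x ρ := by
      rcases h' with h' | h'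
      · exact key a (fun n => (mem_of_infix (h3 n)).1) h5 h'
      · exact key b (fun n => (mem_of_infix (h3 n)).2) h6 h'
    exact ⟨⟨between_mem (critPt_mem_treeItin hK) (critVal_mem hK) hx hs,
      PInf_mem_treeItin hK h7.1, h2, PInf_not_starFree hK hP h7.1, h7.2⟩, hs,
      (PInf_prop hK h7.1).1.2⟩
  · rintro ⟨h, hx, hρ⟩
    have hP := h.isStarPeriodic hK
    refine ⟨hP, _, _, nestAt_isNestLimit hK h.left_mem.1 hx h.starFree, ?_⟩
    set s := nestAt ν x with hs
    have hρP := mem_PInf hK h.right_mem.1 hρ h.not_starFree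
    obtain ⟨N, hN⟩ := eventually_side hK hρP
    have hbt := nestAt_between hx
    have hnest := isNest_nestAt hK x
    have hnsf : ∀ n, (s n).1 ≠ x ∧ (s n).2 ≠ x := fun n => by
      have h1 := mem_of_infix (nestAt_infix (ν := ν) x n)
      exact ⟨fun e => PInf_not_starFree hK hP ⟨n, h1.1⟩ (by rw [← hs, e]; exact h.starFree),
        fun e => PInf_not_starFree hK hP ⟨n, h1.2⟩ (by rw [← hs, e]; exact h.starFree)⟩
    -- Late intervals do not have `ρ` in their interior, but they have `x` there. The end on the
    -- side of `ρ` then lies between `x` and `ρ`, so it is `ρ`.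
    have hor : ∀ n, N ≤ n → (s n).1 = ρ ∨ (s n).2 = ρ := by
      intro n hn
      have h1 := cLt_of_infix hK (nestAt_infix (ν := ν) x n)
      obtain ⟨h2, h3⟩ := h1.between hν h.left_mem.1 (hbt n) (hnsf n).1.symm (hnsf n).2.symm
      rcases hN n hn _ _ (nestAt_infix x n) with (h4 | h4) | (h4 | h4)
      · exact Or.inl h4.symm
      · left
        obtain ⟨p1, p2, p3⟩ := h4.trans h2
        obtain ⟨q1, q2, q3⟩ := h4
        obtain ⟨r1, r2, r3⟩ := h2
        refine (h.eq_or_eq q2.1 fun h5 => ?_).resolve_left (hnsf n).1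
        exact (Chain.between_iff p3 hν q2.1).2 ⟨q2, q3.le, r3.le⟩ h5.symm
      · exact Or.inr h4.symm
      · right
        obtain ⟨p1, p2, p3⟩ := h3.trans h4
        obtain ⟨q1, q2, q3⟩ := h4
        obtain ⟨r1, r2, r3⟩ := h3
        refine (h.eq_or_eq q1.1 fun h5 => ?_).resolve_left (hnsf n).2
        exact (Chain.between_iff p3 hν q1.1).2 ⟨q1, r3.le, q3.le⟩ h5
    have hmono : ∀ n m, n ≤ m → ¬ Same ν (s m).1 (s n).1 (s n).2 ∧ ¬ Same ν (s m).2 (s n).1 (s n).2 :=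
      fun n m hnm => ⟨hnest.left_between hK hnm, hnest.right_between hK hnm⟩
    have hlt := fun n => cLt_of_infix hK (nestAt_infix (ν := ν) x n)
    -- Nestedness prevents `ρ` from switching between the left and the right end.
    rcases hor N le_rfl with h1 | h1
    · left
      filter_upwards [eventually_ge_atTop N] with n hn
      refine (hor n hn).resolve_right fun h2 => ?_
      obtain ⟨p1, p2, p3⟩ := hlt N
      obtain ⟨h3, h4, h5⟩ := (Chain.between_iff p3 hν (hnest.left_mem n).1).1 (hmono N n hn).1
      obtain ⟨q1, q2, q3⟩ := hlt n
      have : (⟨_, q2⟩ : Chain ν (critPt ν) ν) = ⟨_, p1⟩ := Chain.ext (h2.trans h1.symm)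
      rw [this] at q3
      exact absurd q3 (not_lt.2 h4)
    · right
      filter_upwards [eventually_ge_atTop N] with n hn
      refine (hor n hn).resolve_left fun h2 => ?_
      obtain ⟨p1, p2, p3⟩ := hlt N
      obtain ⟨h3, h4, h5⟩ := (Chain.between_iff p3 hν (hnest.right_mem n).1).1 (hmono N n hn).2
      obtain ⟨q1, q2, q3⟩ := hlt n
      have : (⟨_, q1⟩ : Chain ν (critPt ν) ν) = ⟨_, p2⟩ := Chain.ext (h2.trans h1.symm)
      rw [this] at q3
      exact absurd q3 (not_lt.2 h5)

theorem Brackets.le (hK : IsKneading ν) {x : Itin A} {a b : ℕ → Itin A} (h : Brackets ν x a b)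
    (n : ℕ) : (a n ∈ PInf ν ∧ (a n = x ∨ CLt ν (critPt ν) ν (a n) x)) ∧
      (b n ∈ PInf ν ∧ (x = b n ∨ CLt ν (critPt ν) ν x (b n))) := by
  rcases h with ⟨h1, h2, h3⟩ | h
  · exact ⟨⟨(h2 n).symm ▸ h1, Or.inl (h2 n)⟩, ⟨(h3 n).symm ▸ h1, Or.inl (h3 n).symm⟩⟩
  · obtain ⟨hx, hbt, hs⟩ := h.between hK
    have hi := h.2.2.1 n
    have hlt := cLt_of_infix hK hi
    have hm := mem_of_infix hi
    refine ⟨⟨⟨n, hm.1⟩, ?_⟩, ⟨⟨n, hm.2⟩, ?_⟩⟩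
    · by_cases h1 : a n = x
      · exact Or.inl h1
      by_cases h2 : x = b n
      · exact Or.inr (h2 ▸ hlt)
      exact Or.inr (hlt.between hK.adm hx (hbt n) (fun e => h1 e.symm) h2).1
    · by_cases h1 : x = b n
      · exact Or.inl h1
      by_cases h2 : a n = x
      · exact Or.inr (h2 ▸ hlt)
      exact Or.inr (hlt.between hK.adm hx (hbt n) (fun e => h2 e.symm) h1).2

theorem pLe_iff (hK : IsKneading ν) {ρ ρ' : Itin A} (hρ : ρ ∈ PInf ν) (hρ' : ρ' ∈ PInf ν) :
    PLe ν ρ ρ' ↔ ρ = ρ' ∨ CLt ν (critPt ν) ν ρ ρ' := by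
  constructor
  · rintro ⟨-, -, h | ⟨n, h⟩⟩
    · exact Or.inl h
    · exact Or.inr (List.pairwise_iff_forall_sublist.1 (pairwise_precPts hK n) h)
  · rintro (h | h)
    · exact ⟨hρ, hρ', Or.inl h⟩
    · have hρ₀ := hρ
      have hρ₀' := hρ'
      obtain ⟨n, hn⟩ := hρ
      obtain ⟨m, hm⟩ := hρ'
      exact ⟨hρ₀, hρ₀', Or.inr ⟨max n m, sublist_of_pairwise (fun u v h h' => h.asymm h')
        (pairwise_precPts hK _) (precPts_mono (le_max_left _ _) hn)
        (precPts_mono (le_max_right _ _) hm) h⟩⟩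

/-- Brackets of `x` that eventually do not cross `ρ`: constant ones if `x` is in `P_∞`, and
otherwise the bisection around `x`. -/
theorem exists_brackets (hK : IsKneading ν) {x ρ : Itin A}
    (hx : Adm ν x ∧ ¬ Same ν x (critPt ν) ν) (hρ : ρ ∈ PInf ν) :
    ∃ a b, Brackets ν x a b ∧ ∃ N, ∀ n, N ≤ n →
      ((x = ρ ∨ CLt ν (critPt ν) ν x ρ) → b n = ρ ∨ CLt ν (critPt ν) ν (b n) ρ) ∧
      ((ρ = x ∨ CLt ν (critPt ν) ν ρ x) → ρ = a n ∨ CLt ν (critPt ν) ν ρ (a n)) := by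
  by_cases hxP : x ∈ PInf ν
  · exact ⟨fun _ => x, fun _ => x, Or.inl ⟨hxP, fun _ => rfl, fun _ => rfl⟩, 0,
      fun n _ => ⟨id, id⟩⟩
  · have hxs : StarFree x := by
      by_contra h
      exact hxP (mem_PInf hK hx.1 hx.2 h)
    have hB : Brackets ν x _ _ := Or.inr (nestAt_isNestLimit hK hx.1 hx.2 hxs)
    obtain ⟨N, hN⟩ := eventually_side hK hρ
    refine ⟨_, _, hB, N, fun n hn => ?_⟩
    obtain ⟨⟨hP1, h1⟩, hP2, h2⟩ := hB.le hK n
    have h1 := h1.resolve_left fun e => hxP (e ▸ hP1)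
    have h2 := h2.resolve_left fun e => hxP (e ▸ hP2)
    have hne : x ≠ ρ := fun e => hxP (e ▸ hρ)
    constructor
    · intro h
      have h := h.resolve_left hne
      rcases hN n hn _ _ (nestAt_infix x n) with (h4 | h4) | (h4 | h4)
      · rw [h4] at h; exact (h.asymm h1).elim
      · exact (h.asymm (h4.trans h1)).elim
      · exact Or.inl h4.symm
      · exact Or.inr h4
    · intro h
      have h := h.resolve_left hne.symm
      rcases hN n hn _ _ (nestAt_infix x n) with (h4 | h4) | (h4 | h4)
      · exact Or.inl h4
      · exact Or.inr h4
      · rw [h4] at h; exact (h.asymm h2).elim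
      · exact (h.asymm (h2.trans h4)).elim

/-- An edge between `x` and `y` provides a point of `P_∞` that separates their brackets eventually.
-/
theorem itinLt_iff (hK : IsKneading ν) (hP : IsStarPeriodic ν) {x y : Itin A}
    (hx : Adm ν x ∧ ¬ Same ν x (critPt ν) ν) (hy : Adm ν y ∧ ¬ Same ν y (critPt ν) ν) :
    itinLt ν x y ↔ CLt ν (critPt ν) ν x y := by
  constructor
  · rintro ⟨hne, a, b, a', b', hB, hB', n, hn⟩
    obtain ⟨-, hb, h1⟩ := hB.le hK n
    obtain ⟨⟨ha, h2⟩, -⟩ := hB'.le hK n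
    rcases h1 with h1 | h1 <;> rcases (pLe_iff hK hb ha).1 hn with h3 | h3 <;>
      rcases h2 with h2 | h2
    · exact absurd (h1.trans (h3.trans h2)) hne
    · rwa [h1, h3]
    · rwa [h1, ← h2]
    · rw [h1]; exact h3.trans h2
    · rwa [← h2, ← h3]
    · rw [← h3] at h2; exact h1.trans h2
    · rw [← h2]; exact h1.trans h3
    · exact h1.trans (h3.trans h2)
  · intro h
    obtain ⟨ρ, hρ, h1, h2⟩ : ∃ ρ ∈ PInf ν, (x = ρ ∨ CLt ν (critPt ν) ν x ρ) ∧
        (ρ = y ∨ CLt ν (critPt ν) ν ρ y) := by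
      obtain ⟨_, _, hlt⟩ := id h
      obtain ⟨z, ρ, he, -, hs⟩ := exists_edge_between hK hP
        (between_mem (critPt_mem_treeItin hK) (critVal_mem hK) hx.1 hx.2)
        (between_mem (critPt_mem_treeItin hK) (critVal_mem hK) hy.1 hy.2) h.ne
      obtain ⟨hρ, h3, h4⟩ := (Chain.between_iff hlt hK.adm he.right_mem.1).1 hs
      refine ⟨ρ, mem_PInf hK hρ.1 hρ.2 he.not_starFree, ?_, ?_⟩
      · exact h3.eq_or_lt.imp (congrArg Chain.val) fun h => ⟨_, _, h⟩
      · exact h4.eq_or_lt.imp (congrArg Chain.val) fun h => ⟨_, _, h⟩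
    obtain ⟨a, b, hB, N, hN⟩ := exists_brackets hK hx hρ
    obtain ⟨a', b', hB', N', hN'⟩ := exists_brackets hK hy hρ
    refine ⟨h.ne, a, b, a', b', hB, hB', max N N', ?_⟩
    obtain ⟨-, hb, -⟩ := hB.le hK (max N N')
    obtain ⟨⟨ha, -⟩, -⟩ := hB'.le hK (max N N')
    refine (pLe_iff hK hb ha).2 ?_
    rcases (hN _ (le_max_left N N')).1 h1 with h3 | h3 <;>
      rcases (hN' _ (le_max_right N N')).2 h2 with h4 | h4
    · exact Or.inl (h3.trans h4)
    · rw [h3]; exact Or.inr h4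
    · rw [← h4]; exact Or.inr h3
    · exact Or.inr (h3.trans h4)

/-! ### The points of the Hubbard tree -/

/-- The points of the tree: its itineraries, and the interior points of its edges. -/
def IsTreePt (ν : Itin A) (w : Pt A) : Prop :=
  (∃ z ∈ treeItin ν, w = .itin z) ∨ ∃ x ρ t, IsEdge ν x ρ ∧ w = .fatou x ρ t

theorem ptShift_iterate_itin (h : FatouMaps A) (n : ℕ) (z : Itin A) :
    (ptShift h)^[n] (.itin z) = .itin (shift^[n] z) := by
  induction n generalizing z with
  | zero => rfl
  | succ n ih => exact ih (shift z)

theorem exists_ptShift_iterate_fatou (h : FatouMaps A) (n : ℕ) (x ρ : Itin A) (t : Ioo (0 : ℝ) 1) :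
    ∃ t', (ptShift h)^[n] (.fatou x ρ t') = .fatou (shift^[n] x) (shift^[n] ρ) t := by
  induction n generalizing x ρ with
  | zero => exact ⟨t, rfl⟩
  | succ n ih =>
    obtain ⟨t', ht'⟩ := ih (shift x) (shift ρ)
    refine ⟨(h x ρ).symm t', ?_⟩
    rw [Function.iterate_succ_apply, ptShift, OrderIso.apply_symm_apply, ht']
    rfl

theorem IsTreePt.ptShift (hK : IsKneading ν) (h : FatouMaps A) {w : Pt A} (hw : IsTreePt ν w) :
    IsTreePt ν (ptShift h w) := by
  rcases hw with ⟨z, hz, rfl⟩ | ⟨x, ρ, t, he, rfl⟩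
  · exact Or.inl ⟨_, shift_mem hK hz, rfl⟩
  · exact Or.inr ⟨_, _, _, he.shift hK, rfl⟩

theorem isTreePt_of_mem_critPath (hK : IsKneading ν) {w : Pt A} (hw : w ∈ critPath ν) :
    IsTreePt ν w := by
  rcases hw with ⟨x, hx, rfl⟩ | ⟨x, ρ, t, he, rfl⟩
  · have := (mem_pathItin_iff hK).1 hx
    exact Or.inl ⟨x, between_mem (critPt_mem_treeItin hK) (critVal_mem hK) this.1 this.2, rfl⟩
  · exact Or.inr ⟨x, ρ, t, ((fatouPair_iff hK).1 he).1, rfl⟩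

theorem exists_critPath_itin (hK : IsKneading ν) (h : FatouMaps A) {z : Itin A} {i : ℕ}
    (hz : Adm ν z) (hi : ¬ Same ν z (critPt ν) (orb ν i)) :
    ∃ n < i, ∃ c ∈ critPath ν, (ptShift h)^[n] c = .itin z := by
  obtain ⟨n, hn, z', hz', hs, rfl⟩ := exists_iterate_eq hK hz hi
  exact ⟨n, hn, .itin z', Or.inl ⟨z', (mem_pathItin_iff hK).2 ⟨hz', hs⟩, rfl⟩,
    ptShift_iterate_itin h n z'⟩

theorem exists_critPath_fatou (hK : IsKneading ν) (h : FatouMaps A) {x ρ : Itin A} {i : ℕ}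
    (he : IsEdge ν x ρ) (hx : ¬ Same ν x (critPt ν) (orb ν i))
    (hρ : ¬ Same ν ρ (critPt ν) (orb ν i)) (t : Ioo (0 : ℝ) 1) :
    ∃ n < i, ∃ c ∈ critPath ν, (ptShift h)^[n] c = .fatou x ρ t := by
  obtain ⟨n, hn, x', ρ', he', h1, h2, rfl, rfl⟩ := exists_edge_iterate_eq hK he hx hρ
  obtain ⟨t', ht'⟩ := exists_ptShift_iterate_fatou h n x' ρ' t
  exact ⟨n, hn, _, Or.inr ⟨x', ρ', t', (fatouPair_iff hK).2 ⟨he', h1, h2⟩, rfl⟩, ht'⟩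

theorem mem_hubbardTree_iff (hK : IsKneading ν) {h : FatouMaps A} {w : Pt A} :
    w ∈ hubbardTree h ν ↔ IsTreePt ν w := by
  constructor
  · intro hw
    obtain ⟨n, c, hc, rfl⟩ := mem_iUnion.1 hw
    clear hw
    induction n with
    | zero => exact isTreePt_of_mem_critPath hK hc
    | succ n ih => rw [Function.iterate_succ_apply']; exact ih.ptShift hK h
  · rintro (⟨z, ⟨hz, i, hi⟩, rfl⟩ | ⟨x, ρ, t, he, rfl⟩)
    · obtain ⟨n, -, c, hc, h1⟩ := exists_critPath_itin hK h hz hi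
      exact mem_iUnion.2 ⟨n, c, hc, h1⟩
    · obtain ⟨i, h1, h2⟩ := he.exists_orb hK
      obtain ⟨n, -, c, hc, h1⟩ := exists_critPath_fatou hK h he h1 h2 t
      exact mem_iUnion.2 ⟨n, c, hc, h1⟩

theorem IsStarPeriodic.orb_mod {p : ℕ} (hp : ∀ i, orb ν (i + p) = orb ν i) (i : ℕ) :
    orb ν (i % p) = orb ν i := by
  conv_rhs => rw [← Nat.mod_add_div i p]
  generalize i / p = k
  induction k with
  | zero => simp
  | succ k ih => rw [Nat.mul_succ, ← add_assoc, hp, ih]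

/-- The orbit index in the definition of `treeItin` can be reduced modulo `p`, and the number of
iterates needed is below that index. So the pieces used to define the topology cover the tree. -/
theorem exists_critPath_lt (hK : IsKneading ν) (h : FatouMaps A) {p : ℕ} (hp0 : 0 < p)
    (hp : ∀ i, orb ν (i + p) = orb ν i) {w : Pt A} (hw : IsTreePt ν w) :
    ∃ n < p, ∃ c ∈ critPath ν, (ptShift h)^[n] c = w := by
  rcases hw with ⟨z, ⟨hz, i, hi⟩, rfl⟩ | ⟨x, ρ, t, he, rfl⟩
  · rw [← IsStarPeriodic.orb_mod hp] at hi
    obtain ⟨n, hn, h1⟩ := exists_critPath_itin hK h hz hi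
    exact ⟨n, hn.trans (Nat.mod_lt _ hp0), h1⟩
  · obtain ⟨i, h1, h2⟩ := he.exists_orb hK
    rw [← IsStarPeriodic.orb_mod hp] at h1 h2
    obtain ⟨n, hn, h3⟩ := exists_critPath_fatou hK h he h1 h2 t
    exact ⟨n, hn.trans (Nat.mod_lt _ hp0), h3⟩

theorem IsStarPeriodic.exists_period (hP : IsStarPeriodic ν) :
    ∃ p, 0 < p ∧ Function.minimalPeriod shift ν = p ∧ ∀ i, orb ν (i + p) = orb ν i := by
  obtain ⟨p, hp, hi⟩ := hP
  refine ⟨p, hp, ?_, fun i => ?_⟩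
  · have h1 : Function.IsPeriodicPt shift p ν :=
      funext fun i => by rw [shift_iterate_apply, (hi i).1]
    refine Nat.dvd_antisymm h1.minimalPeriod_dvd ?_
    have h3 := congrFun (Function.isPeriodicPt_minimalPeriod shift ν) (p - 1)
    rw [shift_iterate_apply, (hi (p - 1)).2.2 (by rw [Nat.sub_add_cancel hp]), (hi _).2] at h3
    have h4 : p - 1 + Function.minimalPeriod shift ν + 1 = p + Function.minimalPeriod shift ν := by
      omega
    rw [h4] at h3
    exact (Nat.dvd_add_right (dvd_refl p)).1 h3
  · have hstar : IsStarPeriodic ν := ⟨p, hp, hi⟩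
    rcases Nat.eq_zero_or_pos i with rfl | h0
    · rw [Nat.zero_add, orb_zero]
      refine (orb_adm hstar.adm p).eq_critPt ?_
      obtain ⟨q, rfl⟩ : ∃ q, p = q + 1 := ⟨p - 1, by omega⟩
      rw [orb_succ', shift_iterate_apply, Nat.zero_add]
      exact (hi q).2.2 dvd_rfl
    · obtain ⟨j, rfl⟩ : ∃ j, i = j + 1 := ⟨i - 1, by omega⟩
      have : j + 1 + p = (j + p) + 1 := by omega
      rw [this, orb_succ', orb_succ']
      funext k
      rw [shift_iterate_apply, shift_iterate_apply, ← (hi (k + j)).1, add_assoc]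

/-! ### Symbols -/

/-- The symbol of a point of the tree. -/
def sym : Pt A → Option A
  | .itin x => x 0
  | .fatou x _ _ => x 0

theorem IsEdge.head {x ρ : Itin A} (h : IsEdge ν x ρ) : ρ 0 = x 0 ∨ ρ = critPt ν := by
  by_cases h0 : ρ 0 = none
  · exact Or.inr (h.right_mem.1.eq_critPt h0)
  · left
    by_contra hne
    obtain ⟨e, he⟩ := Option.ne_none_iff_exists'.1 h0
    obtain ⟨e', he'⟩ := Option.ne_none_iff_exists'.1 (h.starFree 0)
    exact h.agree 1 0 one_pos ⟨e', e, he', he, fun e => hne (by rw [he, he', e])⟩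

theorem IsTreePt.sym_eq_none {w : Pt A} (hw : IsTreePt ν w) (h : sym w = none) :
    w = .itin (critPt ν) := by
  rcases hw with ⟨z, hz, rfl⟩ | ⟨x, ρ, t, he, rfl⟩
  · rw [hz.1.eq_critPt h]
  · exact absurd h (he.starFree 0)

theorem eq_critPt_of_ptShift {h : FatouMaps A} {w : Pt A} (hw : IsTreePt ν w)
    (hs : ptShift h w = .itin ν) : w = .itin (critPt ν) := by
  rcases hw with ⟨z, hz, rfl⟩ | ⟨x, ρ, t, he, rfl⟩
  · rw [hz.1.eq_critPt (hz.1.zero_eq_none.2 (Pt.itin.inj hs))]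
  · cases hs

/-- The symbol of a Fatou point is that of its star-free end. The other end begins with the same
symbol unless it is `⋆ν`, and this exception is visible in its image `ν`. -/
theorem eq_of_ptShift_eq {h : FatouMaps A} {w w' : Pt A} (hw : IsTreePt ν w) (hw' : IsTreePt ν w')
    (hs : sym w = sym w') (he : ptShift h w = ptShift h w') : w = w' := by
  rcases hw with ⟨z, hz, rfl⟩ | ⟨x, ρ, t, hE, rfl⟩ <;>
    rcases hw' with ⟨z', hz', rfl⟩ | ⟨x', ρ', t', hE', rfl⟩
  · rw [ext_head hs (Pt.itin.inj he)]
  · cases he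
  · cases he
  · obtain ⟨h1, h2, h3⟩ := Pt.fatou.inj he
    have hx : x = x' := ext_head hs h1
    subst hx
    have hρ : ρ = ρ' := by
      have key : ∀ ρ ρ' : Itin A, IsEdge ν x ρ → IsEdge ν x ρ' → shift ρ = shift ρ' →
          ρ = critPt ν → ρ' = critPt ν := by
        rintro ρ ρ' - hE' h2 rfl
        exact hE'.right_mem.1.eq_critPt (hE'.right_mem.1.zero_eq_none.2 (h2.symm.trans rfl))
      rcases hE.head with h4 | h4
      · rcases hE'.head with h5 | h5
        · exact ext_head (h4.trans h5.symm) h2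
        · rw [key _ _ hE' hE h2.symm h5, h5]
      · rw [key _ _ hE hE' h2 h4, h4]
    subst hρ
    rw [(h x ρ).injective h3]

theorem exists_ptShift_eq (hK : IsKneading ν) (h : FatouMaps A) {w : Pt A} (hw : IsTreePt ν w) :
    ∃ w', IsTreePt ν w' ∧ ptShift h w' = w := by
  rcases hw with ⟨z, hz, rfl⟩ | ⟨x, ρ, t, hE, rfl⟩
  · obtain ⟨z', hz', rfl⟩ := exists_mem_shift_eq hK hz
    exact ⟨_, Or.inl ⟨z', hz', rfl⟩, rfl⟩
  · obtain ⟨x', ρ', hE', rfl, rfl⟩ := hE.exists_shift_eq hK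
    refine ⟨_, Or.inr ⟨x', ρ', (h x' ρ').symm t, hE', rfl⟩, ?_⟩
    rw [ptShift, OrderIso.apply_symm_apply]

theorem surjective_treeMap (hK : IsKneading ν) (h : FatouMaps A) :
    Function.Surjective (treeMap h ν) := by
  rintro ⟨w, hw⟩
  obtain ⟨w', hw', h1⟩ := exists_ptShift_eq hK h ((mem_hubbardTree_iff hK).1 hw)
  exact ⟨⟨w', (mem_hubbardTree_iff hK).2 hw'⟩, Subtype.ext h1⟩

theorem encard_preimage_le (hK : IsKneading ν) (h : FatouMaps A) (hA : 2 ≤ ENat.card A)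
    (y : hubbardTree h ν) : (treeMap h ν ⁻¹' {y}).encard ≤ ENat.card A := by
  have htp : ∀ w : hubbardTree h ν, IsTreePt ν w.1 := fun w => (mem_hubbardTree_iff hK).1 w.2
  -- Over the critical value there is only `⋆ν`. Over any other point no symbol is `⋆`, so inverse
  -- images inject into the alphabet.
  by_cases hy : y.1 = .itin ν
  · have h1 : (treeMap h ν ⁻¹' {y}).encard ≤ 1 := by
      rw [Set.encard_le_one_iff]
      intro a b ha hb
      have key : ∀ a : hubbardTree h ν, a ∈ treeMap h ν ⁻¹' {y} → a.1 = .itin (critPt ν) :=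
        fun a ha => eq_critPt_of_ptShift (h := h) (htp a) ((congrArg Subtype.val ha).trans hy)
      exact Subtype.ext ((key a ha).trans (key b hb).symm)
    exact h1.trans (le_trans (by norm_num) hA)
  · have h1 : (range (some : A → Option A)).encard = ENat.card A := by
      rw [← image_univ, (Option.some_injective A).encard_image, Set.encard_univ]
    rw [← h1]
    refine Set.encard_le_encard_of_injOn (f := fun w : hubbardTree h ν => sym w.1) ?_ ?_
    · intro w hw
      rw [Set.mem_range]
      by_contra hne
      have h2 : sym w.1 = none := by
        by_contra h3
        obtain ⟨e, he⟩ := Option.ne_none_iff_exists'.1 h3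
        exact hne ⟨e, he.symm⟩
      have h4 := (htp w).sym_eq_none h2
      refine hy ?_
      rw [← show treeMap h ν w = y from hw]
      show ptShift h w.1 = _
      rw [h4]; rfl
    · intro w hw w' hw' hs
      have : treeMap h ν w = treeMap h ν w' := Eq.trans hw (Eq.symm hw')
      exact Subtype.ext (eq_of_ptShift_eq (htp w) (htp w') hs (congrArg Subtype.val this))

/-- If no point of the critical orbit begins with the symbol of `z`, then seen from `z` the whole
orbit is retracted to `⋆ν`. -/
theorem head_mem_range {z : Itin A} (hz : z ∈ treeItin ν) : z 0 = none ∨ z 0 ∈ range ν := by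
  by_contra! hcon
  obtain ⟨h0, h1⟩ := hcon
  obtain ⟨hz, i, hi⟩ := hz
  rw [same_iff h0, pull_of_ne (x := critPt ν) fun h => h0 h.symm] at hi
  by_cases h2 : orb ν i 0 = z 0
  · cases i with
    | zero => exact h0 h2.symm
    | succ i =>
      rw [orb_succ', shift_iterate_apply] at h2
      exact h1 ⟨_, h2⟩
  · rw [pull_of_ne h2] at hi
    exact hi (Same.eq _ _)

theorem apply_mem_range (hK : IsKneading ν) {z : Itin A} (hz : z ∈ treeItin ν) (n : ℕ) :
    z n ∈ insert none (range ν) := by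
  have := head_mem_range (shift_iterate_mem hK hz n)
  rwa [shift_iterate_apply, Nat.zero_add] at this

/-- The alphabet may be uncountable, but only `⋆` and symbols of `ν` occur in the tree, and a
precritical point is determined by finitely many entries before a star. -/
theorem countable_precritical (hK : IsKneading ν) : {z | z ∈ treeItin ν ∧ ¬ StarFree z}.Countable := by
  have h1 : {z | z ∈ treeItin ν ∧ ¬ StarFree z} ⊆ ⋃ n, {z | z ∈ treeItin ν ∧ z n = none} := by
    rintro z ⟨hz, hs⟩
    simp only [StarFree, not_forall, not_not] at hs
    obtain ⟨n, hn⟩ := hs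
    exact mem_iUnion.2 ⟨n, hz, hn⟩
  refine (countable_iUnion fun n => ?_).mono h1
  have h2 : (Set.pi univ fun _ : Fin n => insert none (range ν)).Countable :=
    countable_univ_pi fun _ => (countable_range ν).insert _
  have h3 : MapsTo (fun (z : Itin A) (i : Fin n) => z i) {z | z ∈ treeItin ν ∧ z n = none}
      (Set.pi univ fun _ : Fin n => insert none (range ν)) :=
    fun z hz i _ => apply_mem_range hK hz.1 i
  refine h3.countable_of_injOn ?_ h2
  rintro z ⟨hz, hzn⟩ w ⟨hw, hwn⟩ he
  funext i
  rcases lt_trichotomy i n with h3 | rfl | h3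
  · exact congrFun he ⟨i, h3⟩
  · rw [hzn, hwn]
  · obtain ⟨k, rfl⟩ : ∃ k, i = k + (n + 1) := ⟨i - (n + 1), by omega⟩
    rw [← shift_iterate_apply (n + 1) z, ← shift_iterate_apply (n + 1) w, (hz.1 n).1 hzn,
      (hw.1 n).1 hwn]

theorem IsStarPeriodic.finite_range (hP : IsStarPeriodic ν) : (range ν).Finite := by
  obtain ⟨p, hp, hi⟩ := hP
  refine ((Set.finite_lt_nat p).image ν).subset ?_
  rintro _ ⟨i, rfl⟩
  refine ⟨i % p, Nat.mod_lt _ hp, ?_⟩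
  conv_rhs => rw [← Nat.mod_add_div i p]
  generalize i / p = k
  induction k with
  | zero => simp
  | succ k ih => rw [Nat.mul_succ, ← add_assoc, (hi _).1, ih]

theorem exists_adm_precritical (hK : IsKneading ν) (hP : IsStarPeriodic ν) {a b : Itin A}
    (ha : a ∈ treeItin ν) (hb : b ∈ treeItin ν) (hab : a ≠ b) :
    ∃ m ∈ treeItin ν, ¬ StarFree m ∧ ¬ Same ν m a b := by
  obtain ⟨x, ρ, he, -, h⟩ := exists_edge_between hK hP ha hb hab
  exact ⟨ρ, he.right_mem, he.not_starFree, h⟩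

/-! ### Parametrization of linear orders -/

section Order

variable {α : Type*} [LinearOrder α]

/-- A dense complete linear order with a countable dense subset is an interval. -/
theorem exists_strictMono_of_dense {bot top : α} (hbot : ∀ z, bot ≤ z) (htop : ∀ z, z ≤ top)
    (hlt : bot < top)
    (hcut : ∀ S : Set α, IsLowerSet S → ∀ u ∈ S, ∀ v ∉ S,
      (∃ m, IsGreatest S m) ∨ ∃ m, IsLeast Sᶜ m)
    {Q : Set α} (hQ : Q.Countable) (hd : ∀ u v : α, u < v → ∃ q ∈ Q, u < q ∧ q < v) :
    ∃ F : α → ℝ, StrictMono F ∧ F bot = 0 ∧ F top = 1 ∧ ∀ s ∈ Icc (0 : ℝ) 1, ∃ z, F z = s := by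
  let D := {q : α // q ∈ Q ∧ bot < q ∧ q < top}
  have hbet : ∀ u v, u < v → ∃ d : D, u < d.1 ∧ d.1 < v := fun u v h => by
    obtain ⟨q, hq, h1, h2⟩ := hd u v h
    exact ⟨⟨q, hq, (hbot u).trans_lt h1, h2.trans_le (htop v)⟩, h1, h2⟩
  have : Countable D := (hQ.mono fun q (hq : q ∈ {q | q ∈ Q ∧ bot < q ∧ q < top}) => hq.1).to_subtype
  have : DenselyOrdered D := ⟨fun u v h => (hbet _ _ h).imp fun d hd => hd⟩
  have : NoMinOrder D := ⟨fun u => (hbet _ _ u.2.2.1).imp fun d hd => hd.2⟩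
  have : NoMaxOrder D := ⟨fun u => (hbet _ _ u.2.2.2).imp fun d hd => hd.1⟩
  have : Nonempty D := ⟨(hbet _ _ hlt).choose⟩
  have : Nonempty (Ioo (0 : ℚ) 1) := ⟨⟨1 / 2, by norm_num, by norm_num⟩⟩
  -- Cantor's theorem. `F` extends the isomorphism by suprema, where `0` is inserted to keep the
  -- sets non-empty.
  obtain ⟨e⟩ := Order.iso_of_countable_dense D (Ioo (0 : ℚ) 1)
  let R : α → Set ℝ := fun z => insert 0 {r | ∃ d : D, d.1 ≤ z ∧ r = ((e d).1 : ℝ)}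
  let F : α → ℝ := fun z => sSup (R z)
  have he0 : ∀ d, (0 : ℝ) < ((e d).1 : ℝ) := fun d => by exact_mod_cast (e d).2.1
  have he1 : ∀ d, ((e d).1 : ℝ) < 1 := fun d => by exact_mod_cast (e d).2.2
  have hub : ∀ z, ∀ r ∈ R z, r ≤ 1 := by
    rintro z r (rfl | ⟨d, -, rfl⟩)
    · exact zero_le_one
    · exact (he1 d).le
  have hne : ∀ z, (R z).Nonempty := fun z => ⟨0, Or.inl rfl⟩
  have hF1 : ∀ z, F z ≤ 1 := fun z => csSup_le (hne z) (hub z)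
  have hF0 : ∀ z, 0 ≤ F z := fun z => le_csSup ⟨1, hub z⟩ (Or.inl rfl)
  have hle : ∀ (d : D) z, d.1 ≤ z → ((e d).1 : ℝ) ≤ F z := fun d z h =>
    le_csSup ⟨1, hub z⟩ (Or.inr ⟨d, h, rfl⟩)
  have hge : ∀ (d : D) z, z ≤ d.1 → F z ≤ ((e d).1 : ℝ) := by
    refine fun d z h => csSup_le (hne z) ?_
    rintro r (rfl | ⟨d', h', rfl⟩)
    · exact (he0 d).le
    · have : e d' ≤ e d := e.monotone (h'.trans h)
      exact_mod_cast this
  have hsurj : ∀ r r' : ℝ, 0 ≤ r → r < r' → r' ≤ 1 →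
      ∃ d, r < ((e d).1 : ℝ) ∧ ((e d).1 : ℝ) < r' := by
    intro r r' h0 h h1
    obtain ⟨q, hq, hq'⟩ := exists_rat_btwn h
    refine ⟨e.symm ⟨q, by exact_mod_cast h0.trans_lt hq, by exact_mod_cast hq'.trans_le h1⟩, ?_⟩
    rw [OrderIso.apply_symm_apply]
    exact ⟨hq, hq'⟩
  have hb : F bot = 0 := by
    refine le_antisymm (csSup_le (hne _) ?_) (hF0 _)
    rintro r (rfl | ⟨d, h, -⟩)
    · exact le_rfl
    · exact absurd d.2.2.1 (not_lt.2 h)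
  have ht : F top = 1 := by
    refine le_antisymm (hF1 _) (le_of_not_gt fun h => ?_)
    obtain ⟨d, h1, -⟩ := hsurj _ _ (hF0 _) h le_rfl
    exact absurd (hle d top d.2.2.2.le) (not_le.2 h1)
  refine ⟨F, fun u v h => ?_, hb, ht, fun s hs => ?_⟩
  · obtain ⟨d, h1, h2⟩ := hbet u v h
    obtain ⟨d', h3, h4⟩ := hbet _ _ h2
    have h5 : e d < e d' := e.strictMono h3
    have h6 : ((e d).1 : ℝ) < ((e d').1 : ℝ) := by exact_mod_cast h5
    exact ((hge d u h1.le).trans_lt h6).trans_le (hle d' v h4.le)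
  · rcases hs.1.eq_or_lt with rfl | h0
    · exact ⟨bot, hb⟩
    have hmono : Monotone F := fun u v h => csSup_le_csSup ⟨1, hub v⟩ (hne u) (by
      rintro r (rfl | ⟨d, h', rfl⟩)
      · exact Or.inl rfl
      · exact Or.inr ⟨d, h'.trans h, rfl⟩)
    -- The cut at `s` has no greatest element, as a point of `D` with value between `F m` and `s`
    -- would exceed it. Its upper part therefore has a least element, and that one has value `s`.
    rcases hcut {z | F z < s} (fun u v h (hu : F u < s) => (hmono h).trans_lt hu) bot
      (show F bot < s by rwa [hb]) top (show ¬ F top < s by rw [ht]; exact not_lt.2 hs.2) with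
      ⟨m, hm, hmax⟩ | ⟨m, hm, hmin⟩
    · exfalso
      obtain ⟨d, h1, h2⟩ := hsurj (F m) s (hF0 _) hm hs.2
      have h3 : d.1 ≤ m := hmax (show F d.1 < s from (hge d d.1 le_rfl).trans_lt h2)
      exact absurd (hle d m h3) (not_le.2 h1)
    · refine ⟨m, le_antisymm (le_of_not_gt fun h => ?_) (not_lt.1 hm)⟩
      obtain ⟨d, h1, h2⟩ := hsurj s (F m) hs.1 h (hF1 _)
      have h3 : m ≤ d.1 := hmin (show ¬ F d.1 < s from not_lt.2 (h1.le.trans (hle d d.1 le_rfl)))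
      exact absurd (hge d m h3) (not_le.2 h2)

/-- In a complete linear order with countably many dense jumps, the jumps can be given lengths. -/
theorem exists_strictMono_of_jumps {bot top : α} (hbot : ∀ z, bot ≤ z) (htop : ∀ z, z ≤ top)
    (hlt : bot < top)
    (hcut : ∀ S : Set α, IsLowerSet S → ∀ u ∈ S, ∀ v ∉ S,
      (∃ m, IsGreatest S m) ∨ ∃ m, IsLeast Sᶜ m)
    (hJ : {j : α × α | j.1 ⋖ j.2}.Countable)
    (hd : ∀ u v : α, u < v → ∃ p q, p ⋖ q ∧ u ≤ p ∧ q ≤ v) :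
    ∃ F : α → ℝ, StrictMono F ∧ F bot = 0 ∧ F top = 1 ∧ ∀ s ∈ Icc (0 : ℝ) 1,
      (∃ z, F z = s) ∨ ∃ p q, p ⋖ q ∧ F p < s ∧ s < F q := by
  classical
  let ι := {j : α × α // j.1 ⋖ j.2}
  have : Countable ι := hJ.to_subtype
  have : Encodable ι := Encodable.ofCountable ι
  -- Each jump receives a positive length `w j`, of finite total `c`. `G z` is the total length of
  -- the jumps up to `z`, and division by `c` normalises it.
  obtain ⟨w, hw, c, hc, -⟩ := posSumOfEncodable (zero_lt_one (α := ℝ)) ι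
  let g : α → ι → ℝ := fun z j => if j.1.2 ≤ z then w j else 0
  have hg0 : ∀ z j, 0 ≤ g z j := fun z j => by
    show 0 ≤ ite _ _ _; split_ifs; exacts [(hw j).le, le_rfl]
  have hgw : ∀ z j, g z j ≤ w j := fun z j => by
    show ite _ _ _ ≤ _; split_ifs; exacts [le_rfl, (hw j).le]
  have hs : ∀ z, Summable (g z) := fun z => hc.summable.of_nonneg_of_le (hg0 z) (hgw z)
  let G : α → ℝ := fun z => ∑' j, g z j
  have hG : StrictMono G := by
    intro u v h
    obtain ⟨p, q, hpq, h1, h2⟩ := hd u v h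
    refine Summable.tsum_lt_tsum (i := ⟨(p, q), hpq⟩) (fun j => ?_) ?_ (hs u) (hs v)
    · show ite _ _ _ ≤ ite _ _ _
      split_ifs with h3 h4
      · exact le_rfl
      · exact absurd (h3.trans h.le) h4
      · exact (hw j).le
      · exact le_rfl
    · show ite (q ≤ u) _ _ < ite (q ≤ v) _ _
      rw [if_neg (not_le.2 (h1.trans_lt hpq.lt)), if_pos h2]
      exact hw _
  have hGb : G bot = 0 := by
    refine (tsum_congr fun j => ?_).trans tsum_zero
    exact if_neg (not_le.2 ((hbot _).trans_lt j.2.lt))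
  have hGt : G top = c := by
    refine (tsum_congr fun j => ?_).trans hc.tsum_eq
    exact if_pos (htop _)
  have hc0 : 0 < c := by rw [← hGb, ← hGt]; exact hG hlt
  -- By dominated convergence, `G` is continuous at `m` along any filter that eventually lies on the
  -- same side of each jump as `m`.
  have hlim : ∀ (𝓕 : Filter α) (m : α),
      (∀ j : ι, ∀ᶠ z in 𝓕, (j.1.2 ≤ z ↔ j.1.2 ≤ m)) → Tendsto G 𝓕 (𝓝 (G m)) := by
    intro 𝓕 m h
    refine tendsto_tsum_of_dominated_convergence hc.summable (fun j => ?_) ?_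
    · refine tendsto_const_nhds.congr' ?_
      filter_upwards [h j] with z hz
      show ite _ _ _ = ite _ _ _
      simp only [hz]
    · exact Eventually.of_forall fun z j => by
        rw [Real.norm_of_nonneg (hg0 z j)]; exact hgw z j
  refine ⟨fun z => G z / c, fun u v h => div_lt_div_of_pos_right (hG h) hc0, by simp [hGb],
    by simp [hGt, hc0.ne'], fun s hs => ?_⟩
  suffices H : (∃ z, G z = s * c) ∨ ∃ p q, p ⋖ q ∧ G p < s * c ∧ s * c < G q by
    rcases H with ⟨z, hz⟩ | ⟨p, q, hpq, h1, h2⟩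
    · exact Or.inl ⟨z, by simp only [hz]; field_simp⟩
    · exact Or.inr ⟨p, q, hpq, (div_lt_iff₀ hc0).2 h1, (lt_div_iff₀ hc0).2 h2⟩
  rcases hs.2.eq_or_lt with rfl | h1
  · exact Or.inl ⟨top, by rw [hGt, one_mul]⟩
  set r := s * c with hr
  have hrt : ¬ G top ≤ r := by rw [hGt, not_le, hr]; exact mul_lt_of_lt_one_left hc0 h1
  have hrb : G bot ≤ r := by rw [hGb]; exact mul_nonneg hs.1 hc0.le
  have hlow : IsLowerSet {z | G z ≤ r} := fun u v h (hu : G u ≤ r) => (hG.monotone h).trans hu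
  rcases hcut {z | G z ≤ r} hlow bot hrb top hrt with ⟨m, hm, hmax⟩ | ⟨m, hm, hmin⟩
  · by_cases hmin : ∃ m', IsLeast {z | G z ≤ r}ᶜ m'
    · obtain ⟨m', hm', hmin⟩ := hmin
      rcases (show G m ≤ r from hm).eq_or_lt with h2 | h2
      · exact Or.inl ⟨m, h2⟩
      · refine Or.inr ⟨m, m', ⟨lt_of_not_ge fun h => hm' (hlow h hm), fun z h3 h4 => ?_⟩, h2,
          not_le.1 hm'⟩
        by_cases h5 : G z ≤ r
        · exact absurd (hmax h5) (not_le.2 h3)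
        · exact absurd (hmin h5) (not_le.2 h4)
    -- The upper part has no least element, so no jump starts at `m`. Along points descending to the
    -- cut `G` tends to `G m`, but it exceeds `r` there.
    · left
      let 𝓕 : Filter α := ⨅ y : {z // ¬ G z ≤ r}, 𝓟 {z | ¬ G z ≤ r ∧ z ≤ y.1}
      have hne : 𝓕.NeBot := by
        have : Nonempty {z // ¬ G z ≤ r} := ⟨⟨top, hrt⟩⟩
        refine iInf_neBot_of_directed' (fun y y' => ?_) fun y => ?_
        · rcases le_total y.1 y'.1 with h | h
          · exact ⟨y, principal_mono.2 fun z hz => hz, principal_mono.2 fun z hz => ⟨hz.1, hz.2.trans h⟩⟩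
          · exact ⟨y', principal_mono.2 fun z hz => ⟨hz.1, hz.2.trans h⟩, principal_mono.2 fun z hz => hz⟩
        · rw [principal_neBot_iff]; exact ⟨y.1, y.2, le_rfl⟩
      have hmem : ∀ y : {z // ¬ G z ≤ r}, {z | ¬ G z ≤ r ∧ z ≤ y.1} ∈ 𝓕 := fun y =>
        mem_iInf_of_mem y (mem_principal_self _)
      have ht : Tendsto G 𝓕 (𝓝 (G m)) := by
        refine hlim 𝓕 m fun j => ?_
        by_cases hj : G j.1.2 ≤ r
        · have hjm : j.1.2 ≤ m := hmax hj
          filter_upwards [hmem ⟨top, hrt⟩] with z hz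
          exact ⟨fun _ => hjm, fun _ => hjm.trans (lt_of_not_ge fun h => hz.1 (hlow h hm)).le⟩
        · obtain ⟨y, hy, hyj⟩ : ∃ y, ¬ G y ≤ r ∧ y < j.1.2 := by
            by_contra! hcon
            exact hmin ⟨_, hj, fun z hz => hcon z (not_le.1 hz)⟩
          filter_upwards [hmem ⟨y, hy⟩] with z hz
          exact ⟨fun h => absurd (h.trans hz.2) (not_le.2 hyj),
            fun h => absurd (hlow h hm) hj⟩
      refine ⟨m, le_antisymm hm (ge_of_tendsto ht ?_)⟩
      filter_upwards [hmem ⟨top, hrt⟩] with z hz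
      exact (not_le.1 hz.1).le
  · by_cases hmax : ∃ m', IsGreatest {z | G z ≤ r} m'
    · obtain ⟨m', hm', hmax⟩ := hmax
      rcases (show G m' ≤ r from hm').eq_or_lt with h2 | h2
      · exact Or.inl ⟨m', h2⟩
      · refine Or.inr ⟨m', m, ⟨lt_of_not_ge fun h => hm (hlow h hm'), fun z h3 h4 => ?_⟩, h2,
          not_le.1 hm⟩
        by_cases h5 : G z ≤ r
        · exact absurd (hmax h5) (not_le.2 h3)
        · exact absurd (hmin h5) (not_le.2 h4)
    -- No jump ends at `m`, since its lower end would be greatest in the cut. So `G m` is a limit of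
    -- values at most `r`, and `m` would belong to the cut.
    · exfalso
      let 𝓕 : Filter α := ⨅ y : {z // G z ≤ r}, 𝓟 {z | G z ≤ r ∧ y.1 ≤ z}
      have hne : 𝓕.NeBot := by
        have : Nonempty {z // G z ≤ r} := ⟨⟨bot, hrb⟩⟩
        refine iInf_neBot_of_directed' (fun y y' => ?_) fun y => ?_
        · rcases le_total y.1 y'.1 with h | h
          · exact ⟨y', principal_mono.2 fun z hz => ⟨hz.1, h.trans hz.2⟩, principal_mono.2 fun z hz => hz⟩
          · exact ⟨y, principal_mono.2 fun z hz => hz, principal_mono.2 fun z hz => ⟨hz.1, h.trans hz.2⟩⟩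
        · rw [principal_neBot_iff]; exact ⟨y.1, y.2, le_rfl⟩
      have hmem : ∀ y : {z // G z ≤ r}, {z | G z ≤ r ∧ y.1 ≤ z} ∈ 𝓕 := fun y =>
        mem_iInf_of_mem y (mem_principal_self _)
      have ht : Tendsto G 𝓕 (𝓝 (G m)) := by
        refine hlim 𝓕 m fun j => ?_
        by_cases hj : G j.1.2 ≤ r
        · filter_upwards [hmem ⟨_, hj⟩] with z hz
          exact ⟨fun _ => (lt_of_not_ge fun h => hm (hlow h hj)).le, fun _ => hz.2⟩
        · have hjm : m < j.1.2 := by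
            refine lt_of_le_of_ne (hmin hj) fun h => hmax ⟨j.1.1, ?_, fun z hz => ?_⟩
            · by_contra h'
              exact absurd (h ▸ j.2.lt) (not_lt.2 (hmin h'))
            · by_contra h'
              exact j.2.2 (not_le.1 h') (h ▸ lt_of_not_ge fun h'' => hm (hlow h'' hz))
          filter_upwards [hmem ⟨bot, hrb⟩] with z hz
          exact ⟨fun h => absurd (hlow h hz.1) hj, fun h => absurd h (not_le.2 hjm)⟩
      refine hm (le_of_tendsto ht ?_)
      filter_upwards [hmem ⟨bot, hrb⟩] with z hz
      exact hz.1

end Order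

/-! ### Parametrization of the intervals of the tree -/

section Param

variable {a b : Itin A}

theorem Chain.val_injective : Function.Injective (Chain.val : Chain ν a b → Itin A) :=
  fun _ _ h => Chain.ext h

/-- The left end of a chain. -/
def leftEnd (hK : IsKneading ν) (ha : a ∈ treeItin ν) (hb : b ∈ treeItin ν) (hab : a ≠ b) :
    Chain ν a b := ⟨a, ha.1, not_same_self hK.adm ha.1 hb.1 hab.symm⟩

/-- The right end of a chain. -/
def rightEnd (hK : IsKneading ν) (ha : a ∈ treeItin ν) (hb : b ∈ treeItin ν) (hab : a ≠ b) :
    Chain ν a b := ⟨b, hb.1, not_same_self' hK.adm hb.1 ha.1 hab⟩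

theorem leftEnd_le (hK : IsKneading ν) (ha : a ∈ treeItin ν) (hb : b ∈ treeItin ν) (hab : a ≠ b)
    (u : Chain ν a b) : leftEnd hK ha hb hab ≤ u := Chain.le_iff'.2 (Or.inr u.property.2)

theorem le_rightEnd (hK : IsKneading ν) (ha : a ∈ treeItin ν) (hb : b ∈ treeItin ν) (hab : a ≠ b)
    (u : Chain ν a b) : u ≤ rightEnd hK ha hb hab := Chain.le_iff.2 (Or.inr u.property.2)

theorem left_lt_right (hK : IsKneading ν) (ha : a ∈ treeItin ν) (hb : b ∈ treeItin ν)
    (hab : a ≠ b) : leftEnd hK ha hb hab < rightEnd hK ha hb hab :=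
  lt_of_le_of_ne (leftEnd_le hK ha hb hab _) fun h => hab (congrArg Chain.val h)

theorem Chain.same_val_iff (hν : Adm ν ν) {x u v : Chain ν a b} (hu : u ≠ x) (hv : v ≠ x) :
    Same ν x.val u.val v.val ↔ (x < u ↔ x < v) := by
  constructor
  · intro h
    by_contra hcon
    rcases lt_or_gt_of_ne hu with h1 | h1 <;> rcases lt_or_gt_of_ne hv with h2 | h2
    · exact hcon ⟨fun h => absurd h h1.asymm, fun h => absurd h h2.asymm⟩
    · exact (between_iff (h1.trans h2) hν x.property.1).2 ⟨x.property, h1.le, h2.le⟩ h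
    · exact (between_iff (h2.trans h1) hν x.property.1).2 ⟨x.property, h2.le, h1.le⟩ h.symm
    · exact hcon ⟨fun _ => h2, fun _ => h1⟩
  · intro h
    by_contra hs
    rcases lt_trichotomy u v with h1 | h1 | h1
    · obtain ⟨_, h2, h3⟩ := (between_iff h1 hν x.property.1).1 hs
      exact absurd (h.2 (lt_of_le_of_ne h3 hv.symm)) (not_lt.2 h2)
    · exact hs (h1 ▸ Same.eq _ _)
    · obtain ⟨_, h2, h3⟩ := (between_iff h1 hν x.property.1).1 fun h => hs h.symm
      exact absurd (h.1 (lt_of_le_of_ne h3 hu.symm)) (not_lt.2 h2)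

theorem IsEdge.covBy (hK : IsKneading ν) {x ρ : Chain ν a b} (h : IsEdge ν x.val ρ.val) :
    x ⋖ ρ ∨ ρ ⋖ x := by
  have hne : x ≠ ρ := fun e => h.ne (congrArg Chain.val e)
  rcases lt_or_gt_of_ne hne with h1 | h1
  · refine Or.inl ⟨h1, fun z h2 h3 => ?_⟩
    rcases h.eq_or_eq z.property.1 ((Chain.between_iff h1 hK.adm z.property.1).2
      ⟨z.property, h2.le, h3.le⟩) with h4 | h4
    · exact h2.ne (Chain.ext h4.symm)
    · exact h3.ne (Chain.ext h4)
  · refine Or.inr ⟨h1, fun z h2 h3 => ?_⟩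
    rcases h.eq_or_eq z.property.1 (fun hs => (Chain.between_iff h1 hK.adm z.property.1).2
      ⟨z.property, h2.le, h3.le⟩ hs.symm) with h4 | h4
    · exact h3.ne (Chain.ext h4)
    · exact h2.ne (Chain.ext h4.symm)

theorem Chain.exists_edge (hK : IsKneading ν) (hP : IsStarPeriodic ν) (ha : a ∈ treeItin ν)
    (hb : b ∈ treeItin ν) {u v : Chain ν a b} (h : u < v) : ∃ x ρ : Chain ν a b,
      IsEdge ν x.val ρ.val ∧ (u ≤ x ∧ x ≤ v) ∧ (u ≤ ρ ∧ ρ ≤ v) := by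
  obtain ⟨x, ρ, he, h1, h2⟩ := exists_edge_between hK hP (u.mem ha hb) (v.mem ha hb)
    fun e => h.ne (Chain.ext e)
  obtain ⟨h3, h4⟩ := (Chain.between_iff h hK.adm he.left_mem.1).1 h1
  obtain ⟨h5, h6⟩ := (Chain.between_iff h hK.adm he.right_mem.1).1 h2
  exact ⟨⟨x, h3⟩, ⟨ρ, h5⟩, he, h4, h6⟩

theorem Chain.edge_of_covBy (hK : IsKneading ν) (hP : IsStarPeriodic ν) (ha : a ∈ treeItin ν)
    (hb : b ∈ treeItin ν) {u v : Chain ν a b} (h : u ⋖ v) :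
    IsEdge ν u.val v.val ∨ IsEdge ν v.val u.val := by
  obtain ⟨x, ρ, he, hx, hρ⟩ := Chain.exists_edge hK hP ha hb h.lt
  have key : ∀ z, u ≤ z ∧ z ≤ v → z = u ∨ z = v := fun z hz => by
    by_contra! hcon
    exact h.2 (lt_of_le_of_ne hz.1 hcon.1.symm) (lt_of_le_of_ne hz.2 hcon.2)
  rcases key x hx with rfl | rfl <;> rcases key ρ hρ with rfl | rfl
  · exact absurd rfl he.ne
  · exact Or.inl he
  · exact Or.inr he
  · exact absurd rfl he.ne

/-- `γ` parametrizes the interval `[a, b]` of the tree; its itineraries are at the parameters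
given by `F`, and the edges are parametrized linearly. -/
structure IsArc (ν a b : Itin A) (F : Chain ν a b → ℝ) (γ : unitInterval → Pt A) : Prop where
  strictMono : StrictMono F
  mem : ∀ u, F u ∈ Icc (0 : ℝ) 1
  left : ∀ u, u.val = a → F u = 0
  right : ∀ u, u.val = b → F u = 1
  cases : ∀ s : unitInterval, (∃ u, F u = s ∧ γ s = .itin u.val) ∨ ∃ (x ρ : Chain ν a b) (t : Ioo (0 : ℝ) 1),
    IsEdge ν x.val ρ.val ∧ ((F x < s ∧ s < F ρ) ∨ (F ρ < s ∧ s < F x)) ∧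
      (t : ℝ) = (s - F x) / (F ρ - F x) ∧ γ s = .fatou x.val ρ.val t

/-- The order is complete by `Chain.exists_cut`. For non-periodic `ν` the precritical points are a
countable dense subset. For periodic `ν` the jumps are the edges; they are dense, and countable
because each is determined by its precritical end and its side. -/
theorem exists_isArc (hK : IsKneading ν) (ha : a ∈ treeItin ν) (hb : b ∈ treeItin ν)
    (hab : a ≠ b) : ∃ F γ, IsArc ν a b F γ := by
  have hν := hK.adm
  let l := leftEnd hK ha hb hab
  let r := rightEnd hK ha hb hab
  have hl := leftEnd_le hK ha hb hab
  have hr := le_rightEnd hK ha hb hab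
  have hlr := left_lt_right hK ha hb hab
  have hcut : ∀ S : Set (Chain ν a b), IsLowerSet S → ∀ u ∈ S, ∀ v ∉ S,
      (∃ m, IsGreatest S m) ∨ ∃ m, IsLeast Sᶜ m :=
    fun S hS u hu v hv => Chain.exists_cut hK ha hb S hS hu hv
  have hQ : {u : Chain ν a b | ¬ StarFree u.val}.Countable := by
    refine ((countable_precritical hK).preimage_of_injOn
      (Chain.val_injective (a := a) (b := b)).injOn).mono ?_
    exact fun u hu => ⟨u.mem ha hb, hu⟩
  have hF : ∃ F : Chain ν a b → ℝ, StrictMono F ∧ F l = 0 ∧ F r = 1 ∧ ∀ s ∈ Icc (0 : ℝ) 1,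
      (∃ z, F z = s) ∨ ∃ p q, (IsEdge ν p.val q.val ∨ IsEdge ν q.val p.val) ∧
        F p < s ∧ s < F q := by
    rcases hK.1 with hN | hP
    · obtain ⟨F, h1, h2, h3, h4⟩ := exists_strictMono_of_dense hl hr hlr hcut hQ fun u v h => by
        obtain ⟨m, hm, hms, hs, h1, h2⟩ := hN.exists_between hK (u.mem ha hb) (v.mem ha hb)
          fun e => h.ne (Chain.ext e)
        obtain ⟨h3, h4, h5⟩ := (Chain.between_iff h hν hm.1).1 hs
        exact ⟨⟨m, h3⟩, hms, lt_of_le_of_ne h4 fun e => h1 (congrArg Chain.val e).symm,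
          lt_of_le_of_ne h5 fun e => h2 (congrArg Chain.val e)⟩
      exact ⟨F, h1, h2, h3, fun s hs => Or.inl (h4 s hs)⟩
    · have hJ : {j : Chain ν a b × Chain ν a b | j.1 ⋖ j.2}.Countable := by
        have h1 : {j : Chain ν a b × Chain ν a b | j.1 ⋖ j.2} ⊆
            {j | j.1 ⋖ j.2 ∧ ¬ StarFree j.1.val} ∪ {j | j.1 ⋖ j.2 ∧ ¬ StarFree j.2.val} := by
          intro j hj
          rcases Chain.edge_of_covBy hK hP ha hb hj with h | h
          · exact Or.inr ⟨hj, h.not_starFree⟩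
          · exact Or.inl ⟨hj, h.not_starFree⟩
        refine (Countable.union ?_ ?_).mono h1
        · have h2 : MapsTo Prod.fst {j : Chain ν a b × Chain ν a b | j.1 ⋖ j.2 ∧
              ¬ StarFree j.1.val} {u : Chain ν a b | ¬ StarFree u.val} := fun j hj => hj.2
          refine h2.countable_of_injOn ?_ hQ
          rintro ⟨p, q⟩ ⟨h3, -⟩ ⟨p', q'⟩ ⟨h4, -⟩ (rfl : p = p')
          exact Prod.ext rfl (h3.unique_right h4)
        · have h2 : MapsTo Prod.snd {j : Chain ν a b × Chain ν a b | j.1 ⋖ j.2 ∧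
              ¬ StarFree j.2.val} {u : Chain ν a b | ¬ StarFree u.val} := fun j hj => hj.2
          refine h2.countable_of_injOn ?_ hQ
          rintro ⟨p, q⟩ ⟨h3, -⟩ ⟨p', q'⟩ ⟨h4, -⟩ (rfl : q = q')
          exact Prod.ext (h3.unique_left h4) rfl
      obtain ⟨F, h1, h2, h3, h4⟩ := exists_strictMono_of_jumps hl hr hlr hcut hJ fun u v h => by
        obtain ⟨x, ρ, he, hx, hρ⟩ := Chain.exists_edge hK hP ha hb h
        rcases he.covBy hK with h1 | h1
        · exact ⟨x, ρ, h1, hx.1, hρ.2⟩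
        · exact ⟨ρ, x, h1, hρ.1, hx.2⟩
      refine ⟨F, h1, h2, h3, fun s hs => (h4 s hs).imp id ?_⟩
      rintro ⟨p, q, h5, h6⟩
      exact ⟨p, q, Chain.edge_of_covBy hK hP ha hb h5, h6⟩
  obtain ⟨F, h1, h2, h3, h4⟩ := hF
  have h5 : ∀ s : unitInterval, ∃ w : Pt A, (∃ u, F u = s ∧ w = .itin u.val) ∨
      ∃ (x ρ : Chain ν a b) (t : Ioo (0 : ℝ) 1),
        IsEdge ν x.val ρ.val ∧ ((F x < s ∧ s < F ρ) ∨ (F ρ < s ∧ s < F x)) ∧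
          (t : ℝ) = (s - F x) / (F ρ - F x) ∧ w = .fatou x.val ρ.val t := by
    intro s
    rcases h4 s s.2 with ⟨u, hu⟩ | ⟨p, q, h | h, h6, h7⟩
    · exact ⟨_, Or.inl ⟨u, hu, rfl⟩⟩
    · have h8 : 0 < F q - F p := by linarith
      exact ⟨_, Or.inr ⟨p, q, ⟨(s - F p) / (F q - F p), div_pos (by linarith) h8,
        (div_lt_one h8).2 (by linarith)⟩, h, Or.inl ⟨h6, h7⟩, rfl, rfl⟩⟩
    · have h8 : F p - F q < 0 := by linarith
      exact ⟨_, Or.inr ⟨q, p, ⟨(s - F q) / (F p - F q), div_pos_of_neg_of_neg (by linarith) h8,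
        (div_lt_one_of_neg h8).2 (by linarith)⟩, h, Or.inr ⟨h6, h7⟩, rfl, rfl⟩⟩
  choose γ hγ using h5
  refine ⟨F, γ, h1, fun u => ⟨?_, ?_⟩, fun u hu => ?_, fun u hu => ?_, hγ⟩
  · rw [← h2]; exact h1.monotone (hl u)
  · rw [← h3]; exact h1.monotone (hr u)
  · rw [show u = l from Chain.ext hu, h2]
  · rw [show u = r from Chain.ext hu, h3]

namespace IsArc

variable {F : Chain ν a b → ℝ} {γ : unitInterval → Pt A}

theorem not_gap (hK : IsKneading ν) (h : IsArc ν a b F γ) {x ρ : Chain ν a b}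
    (he : IsEdge ν x.val ρ.val) (u : Chain ν a b) :
    ¬ ((F x < F u ∧ F u < F ρ) ∨ (F ρ < F u ∧ F u < F x)) := by
  rintro (⟨h1, h2⟩ | ⟨h1, h2⟩) <;>
    rw [h.strictMono.lt_iff_lt] at h1 h2 <;> rcases he.covBy hK with h3 | h3
  · exact h3.2 h1 h2
  · exact (h1.trans h2).asymm h3.lt
  · exact (h1.trans h2).asymm h3.lt
  · exact h3.2 h1 h2

theorem apply_itin (hK : IsKneading ν) (h : IsArc ν a b F γ) (u : Chain ν a b) :
    γ ⟨F u, h.mem u⟩ = .itin u.val := by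
  rcases h.cases ⟨F u, h.mem u⟩ with ⟨u', hu, h1⟩ | ⟨x, ρ, t, he, h1, -⟩
  · rw [h1, h.strictMono.injective hu]
  · exact absurd h1 (h.not_gap hK he u)

/-- A parameter lies in at most one edge. -/
theorem edge_unique (hK : IsKneading ν) (h : IsArc ν a b F γ) {x ρ x' ρ' : Chain ν a b}
    (he : IsEdge ν x.val ρ.val) (he' : IsEdge ν x'.val ρ'.val) {s : ℝ}
    (h1 : (F x < s ∧ s < F ρ) ∨ (F ρ < s ∧ s < F x))
    (h2 : (F x' < s ∧ s < F ρ') ∨ (F ρ' < s ∧ s < F x')) : x = x' ∧ ρ = ρ' := by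
  have key : ∀ p q p' q' : Chain ν a b, (∀ u, ¬ (F p < F u ∧ F u < F q)) →
      (∀ u, ¬ (F p' < F u ∧ F u < F q')) → F p < s → s < F q → F p' < s → s < F q' →
      p = p' ∧ q = q' := by
    intro p q p' q' hg hg' h1 h2 h3 h4
    constructor
    · refine h.strictMono.injective (le_antisymm ?_ ?_)
      · exact not_lt.1 fun h5 => hg' p ⟨h5, h1.trans h4⟩
      · exact not_lt.1 fun h5 => hg p' ⟨h5, h3.trans h2⟩
    · refine h.strictMono.injective (le_antisymm ?_ ?_)
      · exact not_lt.1 fun h5 => hg q' ⟨h1.trans h4, h5⟩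
      · exact not_lt.1 fun h5 => hg' q ⟨h3.trans h2, h5⟩
  have hg := fun u => not_or.1 (h.not_gap hK he u)
  have hg' := fun u => not_or.1 (h.not_gap hK he' u)
  rcases h1 with ⟨h1, h3⟩ | ⟨h1, h3⟩ <;> rcases h2 with ⟨h2, h4⟩ | ⟨h2, h4⟩
  · exact key _ _ _ _ (fun u => (hg u).1) (fun u => (hg' u).1) h1 h3 h2 h4
  · obtain ⟨h5, -⟩ := key _ _ _ _ (fun u => (hg u).1) (fun u => (hg' u).2) h1 h3 h2 h4
    exact absurd (h5 ▸ he.starFree) he'.not_starFree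
  · obtain ⟨h5, -⟩ := key _ _ _ _ (fun u => (hg u).2) (fun u => (hg' u).1) h1 h3 h2 h4
    exact absurd (h5 ▸ he'.starFree) he.not_starFree
  · exact (key _ _ _ _ (fun u => (hg u).2) (fun u => (hg' u).2) h1 h3 h2 h4).symm

theorem apply_fatou (hK : IsKneading ν) (h : IsArc ν a b F γ) {x ρ : Chain ν a b}
    (he : IsEdge ν x.val ρ.val) (t : Ioo (0 : ℝ) 1) : ∃ s : unitInterval,
      ((F x < s ∧ s < F ρ) ∨ (F ρ < s ∧ s < F x)) ∧ γ s = .fatou x.val ρ.val t := by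
  have hx := h.mem x
  have hρ := h.mem ρ
  have ht := t.2
  have hne : F x ≠ F ρ := fun e => he.ne (congrArg Chain.val (h.strictMono.injective e))
  have hs : (F x < F x + t * (F ρ - F x) ∧ F x + t * (F ρ - F x) < F ρ) ∨
      (F ρ < F x + t * (F ρ - F x) ∧ F x + t * (F ρ - F x) < F x) := by
    rcases lt_or_gt_of_ne hne with h1 | h1
    · left; constructor <;> nlinarith [ht.1, ht.2]
    · right; constructor <;> nlinarith [ht.1, ht.2]
  have hmem : F x + t * (F ρ - F x) ∈ Icc (0 : ℝ) 1 := by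
    rcases hs with hs | hs <;> constructor <;> linarith [hx.1, hx.2, hρ.1, hρ.2]
  refine ⟨⟨_, hmem⟩, hs, ?_⟩
  rcases h.cases ⟨_, hmem⟩ with ⟨u, hu, -⟩ | ⟨x', ρ', t', he', h1, h2, h3⟩
  · exact absurd (show _ ∨ _ by rw [hu]; exact hs) (h.not_gap hK he u)
  · obtain ⟨rfl, rfl⟩ := h.edge_unique hK he he' hs h1
    rw [h3]
    congr 1
    refine Subtype.ext (h2.trans ?_)
    have : F ρ - F x ≠ 0 := sub_ne_zero.2 hne.symm
    field_simp
    show F x + t * (F ρ - F x) - F x = _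
    ring

theorem injective (h : IsArc ν a b F γ) : Function.Injective γ := by
  intro s s' hs
  rcases h.cases s with ⟨u, hu, h1⟩ | ⟨x, ρ, t, he, h1, h2, h3⟩ <;>
    rcases h.cases s' with ⟨u', hu', h1'⟩ | ⟨x', ρ', t', he', h1', h2', h3'⟩
  · rw [h1, h1'] at hs
    rw [show u = u' from Chain.ext (Pt.itin.inj hs)] at hu
    exact Subtype.ext (hu.symm.trans hu')
  · rw [h1, h3'] at hs; cases hs
  · rw [h3, h1'] at hs; cases hs
  · rw [h3, h3'] at hs
    obtain ⟨e1, e2, rfl⟩ := Pt.fatou.inj hs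
    obtain rfl : x = x' := Chain.ext e1
    obtain rfl : ρ = ρ' := Chain.ext e2
    have hne : F ρ - F x ≠ 0 := sub_ne_zero.2 fun e =>
      he.ne (congrArg Chain.val (h.strictMono.injective e)).symm
    rw [h2] at h2'
    have := (div_left_inj' hne).1 h2'
    exact Subtype.ext (by linarith)

theorem isTreePt (ha : a ∈ treeItin ν) (hb : b ∈ treeItin ν) (h : IsArc ν a b F γ)
    (s : unitInterval) : IsTreePt ν (γ s) := by
  rcases h.cases s with ⟨u, -, h1⟩ | ⟨x, ρ, t, he, -, -, h1⟩
  · exact Or.inl ⟨_, u.mem ha hb, h1⟩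
  · exact Or.inr ⟨_, _, t, he, h1⟩

theorem apply_zero (hK : IsKneading ν) (ha : a ∈ treeItin ν) (hb : b ∈ treeItin ν) (hab : a ≠ b)
    (h : IsArc ν a b F γ) : γ 0 = .itin a := by
  refine Eq.trans ?_ (h.apply_itin hK (leftEnd hK ha hb hab))
  congr 1
  exact Subtype.ext (h.left (leftEnd hK ha hb hab) rfl).symm

theorem apply_one (hK : IsKneading ν) (ha : a ∈ treeItin ν) (hb : b ∈ treeItin ν) (hab : a ≠ b)
    (h : IsArc ν a b F γ) : γ 1 = .itin b := by
  refine Eq.trans ?_ (h.apply_itin hK (rightEnd hK ha hb hab))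
  congr 1
  exact Subtype.ext (h.right (rightEnd hK ha hb hab) rfl).symm

end IsArc

end Param

/-! ### Separation, endpoints and paths -/

section Separation

variable {X : Type*} [TopologicalSpace X] {z u v : X}

/-- The points `u` and `v` are separated by `z`: some property that does not change locally
except at `z` holds at `u`, but not at `v`. -/
def Separates (z u v : X) : Prop :=
  ∃ S : X → Prop, (∀ w ≠ z, ∀ᶠ w' in 𝓝 w, (S w' ↔ S w)) ∧ S u ∧ ¬ S v

theorem Separates.symm (h : Separates z u v) : Separates z v u := by
  obtain ⟨S, h1, h2, h3⟩ := h
  refine ⟨fun w => ¬ S w, fun w hw => ?_, h3, not_not.2 h2⟩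
  filter_upwards [h1 w hw] with w' hw'
  rw [hw']

theorem Separates.exists_isOpen (h : Separates z u v) : ∃ O O' : Set X, IsOpen O ∧ IsOpen O' ∧
    Disjoint O O' ∧ {z}ᶜ ⊆ O ∪ O' ∧ (u ≠ z → u ∈ O) ∧ (v ≠ z → v ∈ O') := by
  obtain ⟨S, h1, h2, h3⟩ := h
  have hop : ∀ S : X → Prop, IsOpen {w | ∀ᶠ w' in 𝓝 w, S w'} := fun S => by
    rw [isOpen_iff_mem_nhds]
    exact fun w hw => eventually_eventually_nhds.2 hw
  refine ⟨_, _, hop S, hop fun w => ¬ S w, ?_, fun w hw => ?_, fun hu => ?_, fun hv => ?_⟩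
  · rw [Set.disjoint_left]
    exact fun w hw hw' => hw'.self_of_nhds hw.self_of_nhds
  · by_cases hS : S w
    · left; filter_upwards [h1 w hw] with w' hw'; exact hw'.2 hS
    · right; filter_upwards [h1 w hw] with w' hw'; exact fun h => hS (hw'.1 h)
  · show ∀ᶠ w' in 𝓝 u, S w'
    filter_upwards [h1 u hu] with w' hw'; exact hw'.2 h2
  · show ∀ᶠ w' in 𝓝 v, ¬ S w'
    filter_upwards [h1 v hv] with w' hw'; exact fun h => h3 (hw'.1 h)

theorem Separates.mem_of_isPreconnected (h : Separates z u v) {K : Set X} (hK : IsPreconnected K)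
    (hu : u ∈ K) (hv : v ∈ K) : z ∈ K := by
  by_contra hz
  obtain ⟨O, O', h1, h2, h3, h4, h5, h6⟩ := h.exists_isOpen
  obtain ⟨w, -, hw⟩ := hK O O' h1 h2
    (fun w hw => h4 fun e => hz (Set.mem_singleton_iff.1 e ▸ hw))
    ⟨u, hu, h5 fun e => hz (e ▸ hu)⟩ ⟨v, hv, h6 fun e => hz (e ▸ hv)⟩
  exact Set.disjoint_left.1 h3 hw.1 hw.2

theorem Separates.not_isEndpoint (h : Separates z u v) (hu : u ≠ z) (hv : v ≠ z) :
    ¬ IsEndpoint z := fun he => h.mem_of_isPreconnected he.isPreconnected hu hv rfl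

theorem t2Space_of_separates
    (h : ∀ u v : X, u ≠ v → ∃ z, z ≠ u ∧ z ≠ v ∧ Separates z u v) : T2Space X := by
  refine ⟨fun u v huv => ?_⟩
  obtain ⟨z, hu, hv, hs⟩ := h u v huv
  obtain ⟨O, O', h1, h2, h3, -, h5, h6⟩ := hs.exists_isOpen
  exact ⟨O, O', h1, h2, h5 hu.symm, h6 hv.symm, h3⟩

theorem existsUnique_path [T2Space X] {γ : unitInterval → X} (hγ : Continuous γ)
    (hinj : Function.Injective γ) (h0 : γ 0 = u) (h1 : γ 1 = v)
    (hsep : ∀ s, γ s = u ∨ γ s = v ∨ Separates (γ s) u v) :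
    IsPathBetween (range γ) u v ∧ ∀ P, IsPathBetween P u v → P = range γ := by
  have he : IsEmbedding γ := (hγ.isClosedEmbedding hinj).isEmbedding
  refine ⟨⟨γ, he, h0, h1, rfl⟩, ?_⟩
  rintro P ⟨δ, hδ, hδ0, hδ1, rfl⟩
  have hsub : range γ ⊆ range δ := by
    rintro _ ⟨s, rfl⟩
    have hpc : IsPreconnected (range δ) := isPreconnected_range hδ.continuous
    rcases hsep s with h | h | h
    · exact ⟨0, hδ0.trans h.symm⟩
    · exact ⟨1, hδ1.trans h.symm⟩
    · exact h.mem_of_isPreconnected hpc ⟨0, hδ0⟩ ⟨1, hδ1⟩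
  refine Subset.antisymm ?_ hsub
  have hpre : IsPreconnected (δ ⁻¹' range γ) := by
    rw [← hδ.isInducing.isPreconnected_image, image_preimage_eq_inter_range,
      inter_eq_left.2 hsub]
    exact isPreconnected_range hγ
  have hIcc := hpre.Icc_subset (a := 0) (b := 1) ⟨0, h0.trans hδ0.symm⟩ ⟨1, h1.trans hδ1.symm⟩
  rintro _ ⟨s, rfl⟩
  exact hIcc ⟨s.2.1, s.2.2⟩

end Separation

section Tree

variable {h : FatouMaps A}

/-- The points of the tree, as elements of the Hubbard tree. -/
def treePt (h : FatouMaps A) (hK : IsKneading ν) {w : Pt A} (hw : IsTreePt ν w) :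
    hubbardTree h ν := ⟨w, (mem_hubbardTree_iff hK).2 hw⟩

/-- The itineraries of the tree, as elements of the Hubbard tree. -/
def itinPt (h : FatouMaps A) (hK : IsKneading ν) {z : Itin A} (hz : z ∈ treeItin ν) :
    hubbardTree h ν := treePt h hK (Or.inl ⟨z, hz, rfl⟩)

/-- The interior points of the edges, as elements of the Hubbard tree. -/
def edgePt (h : FatouMaps A) (hK : IsKneading ν) {x ρ : Itin A} (he : IsEdge ν x ρ)
    (t : Ioo (0 : ℝ) 1) : hubbardTree h ν := treePt h hK (Or.inr ⟨x, ρ, t, he, rfl⟩)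

theorem tree_cases (hK : IsKneading ν) (w : hubbardTree h ν) :
    (∃ z, ∃ hz : z ∈ treeItin ν, w = itinPt h hK hz) ∨
      ∃ x ρ, ∃ he : IsEdge ν x ρ, ∃ t, w = edgePt h hK he t := by
  rcases (mem_hubbardTree_iff hK).1 w.2 with ⟨z, hz, hw⟩ | ⟨x, ρ, t, he, hw⟩
  · exact Or.inl ⟨z, hz, Subtype.ext hw⟩
  · exact Or.inr ⟨x, ρ, he, t, Subtype.ext hw⟩

theorem itinPt_inj {hK : IsKneading ν} {z u : Itin A} {hz : z ∈ treeItin ν} {hu : u ∈ treeItin ν} :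
    itinPt h hK hz = itinPt h hK hu ↔ z = u :=
  ⟨fun e => Pt.itin.inj (congrArg Subtype.val e), fun e => by subst e; rfl⟩

theorem itinPt_ne_edgePt {hK : IsKneading ν} {z x ρ : Itin A} {hz : z ∈ treeItin ν}
    {he : IsEdge ν x ρ} {t : Ioo (0 : ℝ) 1} : itinPt h hK hz ≠ edgePt h hK he t :=
  fun e => by cases congrArg Subtype.val e

theorem treeMap_iterate_val (n : ℕ) (w : hubbardTree h ν) :
    ((treeMap h ν)^[n] w).1 = (ptShift h)^[n] w.1 := by
  induction n generalizing w with
  | zero => rfl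
  | succ n ih => exact ih (treeMap h ν w)

theorem mem_critOrbit_iff (hK : IsKneading ν) {w : hubbardTree h ν} :
    w ∈ critOrbit h ν ↔ ∃ k, w = itinPt h hK (orb_mem hK k) := by
  have : ∀ k, (treeMap h ν)^[k] (treeCrit h ν) = itinPt h hK (orb_mem hK k) := fun k =>
    Subtype.ext ((treeMap_iterate_val k _).trans (ptShift_iterate_itin h k _))
  exact exists_congr fun k => by rw [this]

theorem exists_precritical_between (hK : IsKneading ν) {a b : Itin A} (ha : a ∈ treeItin ν)
    (hb : b ∈ treeItin ν) (hab : a ≠ b) :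
    ∃ m ∈ treeItin ν, ¬ StarFree m ∧ ¬ Same ν m a b := by
  rcases hK.1 with hN | hP
  · obtain ⟨m, h1, h2, h3, -⟩ := hN.exists_between hK ha hb hab
    exact ⟨m, h1, h2, h3⟩
  · exact exists_adm_precritical hK hP ha hb hab

/-- The properties of the topology of the tree on which the statements on endpoints and paths
rest. -/
structure IsTreeLike (hK : IsKneading ν) (h : FatouMaps A) : Prop where
  t2 : T2Space (hubbardTree h ν)
  continuous_arc : ∀ {a b : Itin A} {F : Chain ν a b → ℝ} {γ : unitInterval → Pt A},
    a ∈ treeItin ν → b ∈ treeItin ν → IsArc ν a b F γ → ∀ hw : ∀ s, IsTreePt ν (γ s),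
      Continuous fun s => treePt h hK (hw s)
  separates_itin : ∀ {z u v : Itin A} (hz : z ∈ treeItin ν) (hu : u ∈ treeItin ν)
    (hv : v ∈ treeItin ν), u ≠ z → v ≠ z → ¬ Same ν z u v →
      Separates (itinPt h hK hz) (itinPt h hK hu) (itinPt h hK hv)
  separates_edge : ∀ {x ρ u v : Itin A} (he : IsEdge ν x ρ) (t : Ioo (0 : ℝ) 1)
    (hu : u ∈ treeItin ν) (hv : v ∈ treeItin ν), Same ν x u ρ → ¬ Same ν x v ρ →
      Separates (edgePt h hK he t) (itinPt h hK hu) (itinPt h hK hv)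
  not_isBranchPoint : ∀ {x ρ : Itin A} (he : IsEdge ν x ρ) (t : Ioo (0 : ℝ) 1),
    ¬ IsBranchPoint (edgePt h hK he t)

namespace IsTreeLike

variable {hK : IsKneading ν}

theorem mem_critOrbit (H : IsTreeLike hK h) {w : hubbardTree h ν} (hw : IsEndpoint w) :
    w ∈ critOrbit h ν := by
  rw [mem_critOrbit_iff hK]
  rcases tree_cases hK w with ⟨z, hz, rfl⟩ | ⟨x, ρ, he, t, rfl⟩
  · by_contra! hcon
    obtain ⟨i, hi⟩ := hz.2
    have hne : ∀ k, orb ν k ≠ z := fun k e => hcon k (itinPt_inj.2 e.symm)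
    refine (H.separates_itin hz (orb_mem hK 0) (orb_mem hK i) (hne 0) (hne i) hi).not_isEndpoint
      (fun e => hne 0 (itinPt_inj.1 e)) (fun e => hne i (itinPt_inj.1 e)) hw
  · exact ((H.separates_edge he t he.right_mem he.left_mem (Same.eq _ _)
      (not_same_self hK.adm he.left_mem.1 he.right_mem.1 he.ne.symm)).not_isEndpoint
        itinPt_ne_edgePt itinPt_ne_edgePt hw).elim

theorem exists_path (H : IsTreeLike hK h) {a b : Itin A} (ha : a ∈ treeItin ν)
    (hb : b ∈ treeItin ν) (hab : a ≠ b) :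
    (∃! P : Set (hubbardTree h ν), IsPathBetween P (itinPt h hK ha) (itinPt h hK hb)) ∧
      ∀ P, IsPathBetween P (itinPt h hK ha) (itinPt h hK hb) →
        ∃ n : ℕ, treeCrit h ν ∈ (treeMap h ν)^[n] '' P := by
  have := H.t2
  obtain ⟨F, γ, hγ⟩ := exists_isArc hK ha hb hab
  have hw := hγ.isTreePt ha hb
  have hc := H.continuous_arc ha hb hγ hw
  obtain ⟨h1, h2⟩ := existsUnique_path (u := itinPt h hK ha) (v := itinPt h hK hb) hc
    (fun s s' e => hγ.injective (congrArg Subtype.val e))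
    (Subtype.ext (hγ.apply_zero hK ha hb hab)) (Subtype.ext (hγ.apply_one hK ha hb hab)) (by
      intro s
      rcases hγ.cases s with ⟨u, -, h1⟩ | ⟨x, ρ, t, he, -, -, h1⟩
      · have h2 : treePt h hK (hw s) = itinPt h hK (u.mem ha hb) := Subtype.ext h1
        rw [h2]
        by_cases hua : u.val = a
        · exact Or.inl (itinPt_inj.2 hua)
        by_cases hub : u.val = b
        · exact Or.inr (Or.inl (itinPt_inj.2 hub))
        exact Or.inr (Or.inr (H.separates_itin _ ha hb (fun e => hua e.symm)
          (fun e => hub e.symm) u.property.2))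
      · have h2 : treePt h hK (hw s) = edgePt h hK he t := Subtype.ext h1
        rw [h2]
        right; right
        by_cases h3 : Same ν x.val a ρ.val
        · exact H.separates_edge he t ha hb h3 fun h4 => x.property.2 (h3.trans h4.symm)
        · refine (H.separates_edge he t hb ha ?_ h3).symm
          by_contra h4
          rcases not_same_or x.val ρ.property.2 with h5 | h5
          · exact he.ne (not_same_asymm x.property.1 ρ.property.1 h3 h5)
          · exact he.ne (not_same_asymm x.property.1 ρ.property.1 h4 fun h => h5 h.symm))
  refine ⟨⟨_, h1, h2⟩, fun P hP => ?_⟩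
  rw [h2 P hP]
  obtain ⟨m, hm, hms, hmab⟩ := exists_precritical_between hK ha hb hab
  simp only [StarFree, not_forall, not_not] at hms
  obtain ⟨n, hn⟩ := hms
  refine ⟨n, itinPt h hK hm, ⟨⟨_, hγ.mem ⟨m, hm.1, hmab⟩⟩, Subtype.ext
    (hγ.apply_itin hK ⟨m, hm.1, hmab⟩)⟩, Subtype.ext ?_⟩
  rw [treeMap_iterate_val]
  refine (ptShift_iterate_itin h n m).trans (congrArg Pt.itin ?_)
  exact (hm.1.iterate n).eq_critPt (by rw [shift_iterate_apply, Nat.zero_add]; exact hn)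

theorem exists_itinPt (H : IsTreeLike hK h) {w : hubbardTree h ν}
    (hw : IsBranchPoint w ∨ w ∈ critOrbit h ν) : ∃ z, ∃ hz : z ∈ treeItin ν, w = itinPt h hK hz := by
  rcases hw with hw | hw
  · rcases tree_cases hK w with h1 | ⟨x, ρ, he, t, rfl⟩
    · exact h1
    · exact absurd hw (H.not_isBranchPoint he t)
  · obtain ⟨k, rfl⟩ := (mem_critOrbit_iff hK).1 hw
    exact ⟨_, _, rfl⟩

theorem expansive (H : IsTreeLike hK h) {x y : hubbardTree h ν} (hxy : x ≠ y)
    (hx : IsBranchPoint x ∨ x ∈ critOrbit h ν) (hy : IsBranchPoint y ∨ y ∈ critOrbit h ν) :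
    (∃! P : Set (hubbardTree h ν), IsPathBetween P x y) ∧
      ∀ P, IsPathBetween P x y → ∃ n : ℕ, treeCrit h ν ∈ (treeMap h ν)^[n] '' P := by
  obtain ⟨a, ha, rfl⟩ := H.exists_itinPt hx
  obtain ⟨b, hb, rfl⟩ := H.exists_itinPt hy
  exact H.exists_path ha hb fun e => hxy (itinPt_inj.2 e)

end IsTreeLike

end Tree

/-! ### The topology for non-periodic kneading sequences -/

section NonPeriodic

variable {h : FatouMaps A}

theorem IsNonPeriodic.tree_cases (hK : IsKneading ν) (hN : IsNonPeriodic ν) (w : hubbardTree h ν) :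
    ∃ z, ∃ hz : z ∈ treeItin ν, w = itinPt h hK hz := by
  rcases Kneading.tree_cases hK w with h1 | ⟨x, ρ, he, -⟩
  · exact h1
  · exact absurd hN (he.isStarPeriodic hK).not_nonPeriodic

/-- The basic neighbourhoods in the tree. -/
def near (h : FatouMaps A) (ν : Itin A) (n : ℕ) (a : Itin A) : Set (hubbardTree h ν) :=
  {w | ∃ b, w.1 = .itin b ∧ Agree n a b ∧ ((∃ i < n, b i = none) → b = a)}

theorem basicNhd_eq_near (hK : IsKneading ν) (hN : IsNonPeriodic ν) (n : ℕ) (a : Itin A) :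
    {w : hubbardTree h ν | ∃ b ∈ basicNhd ν (n + 1) a, w.1 = .itin b} = near h ν n a := by
  ext w
  obtain ⟨z, hz, rfl⟩ := hN.tree_cases hK w
  constructor
  · rintro ⟨b, ⟨⟨hb, hd⟩, hb'⟩, hw⟩
    obtain rfl : z = b := Pt.itin.inj hw
    refine ⟨z, rfl, le_diff_iff.1 hd, fun hex => ?_⟩
    by_contra hne
    refine hb' ⟨⟨⟨hb, hd⟩, hne⟩, ?_, ?_⟩
    · rintro rfl
      obtain ⟨i, -, hi⟩ := hex
      exact hN.1 i hi
    · classical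
      have hex' : ∃ i, z i = none := hex.imp fun i hi => hi.2
      obtain ⟨w, hw1, hw2⟩ := exists_wordCons (n := Nat.find hex') fun i hi => Nat.find_min hex' hi
      rw [(hz.1.iterate _).eq_critPt
        (by rw [shift_iterate_apply, Nat.zero_add]; exact Nat.find_spec hex')] at hw2
      refine ⟨w, hw2, ?_⟩
      obtain ⟨i, hi, hi'⟩ := hex
      have := Nat.find_min' hex' hi'
      omega
  · rintro ⟨b, hw, h1, h2⟩
    obtain rfl : z = b := Pt.itin.inj hw
    have hd : ((n + 1 : ℕ) : ℕ∞) ≤ diff a z := le_diff_iff.2 h1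
    refine ⟨z, ⟨⟨hz.1.mem_itinSpace, hd⟩, ?_⟩, rfl⟩
    rintro ⟨⟨-, hne⟩, -, w, hw1, hw2⟩
    refine hne (h2 ⟨w.length, by omega, ?_⟩)
    have := (wordCons_apply w (critPt ν) 0).2
    rw [Nat.zero_add] at this
    rw [hw1, precrit, this]; rfl

theorem near_subset {n : ℕ} {a z : Itin A} {hK : IsKneading ν} {hz : z ∈ treeItin ν}
    (hw : itinPt h hK hz ∈ near h ν n a) : near h ν n z ⊆ near h ν n a := by
  obtain ⟨b, hb, h1, h2⟩ := hw
  obtain rfl : z = b := Pt.itin.inj hb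
  by_cases hza : z = a
  · rw [hza]
  have h3 : ∀ i < n, z i ≠ none := fun i hi h0 => hza (h2 ⟨i, hi, h0⟩)
  rintro w ⟨b, hw, h4, h5⟩
  have h6 : ∀ i < n, b i ≠ none := fun i hi h0 => h3 i hi (h5 ⟨i, hi, h0⟩ ▸ h0)
  refine ⟨b, hw, fun i hi => ?_, fun ⟨i, hi, h0⟩ => absurd h0 (h6 i hi)⟩
  have : z i = b i := by
    rcases not_differ_iff.1 (h4 i hi) with h7 | h7 | h7
    · exact h7
    · exact absurd h7 (h3 i hi)
    · exact absurd h7 (h6 i hi)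
  rw [← this]
  exact h1 i hi

theorem itinPt_mem_near (hK : IsKneading ν) {z : Itin A} (hz : z ∈ treeItin ν) (n : ℕ) :
    itinPt h hK hz ∈ near h ν n z := ⟨z, rfl, Agree.refl n z, fun _ => rfl⟩

theorem treeTopology_eq (hN : IsNonPeriodic ν) : treeTopology h ν = TopologicalSpace.generateFrom
    {V | ∃ a ∈ itinSpace ν, ∃ k : ℕ, 1 ≤ k ∧ V = {z | ∃ b ∈ basicNhd ν k a, z.1 = .itin b}} :=
  if_neg fun hP => hP.not_nonPeriodic hN

theorem mem_nhds_iff_near (hK : IsKneading ν) (hN : IsNonPeriodic ν) {z : Itin A}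
    (hz : z ∈ treeItin ν) {V : Set (hubbardTree h ν)} :
    V ∈ 𝓝 (itinPt h hK hz) ↔ ∃ n, near h ν n z ⊆ V := by
  have hmono : ∀ {n m : ℕ} (z : Itin A), n ≤ m → near h ν m z ⊆ near h ν n z :=
    fun z hnm w ⟨b, h1, h2, h3⟩ => ⟨b, h1, h2.mono hnm,
      fun ⟨i, hi, h0⟩ => h3 ⟨i, hi.trans_le hnm, h0⟩⟩
  have hopen : ∀ n, IsOpen (near h ν n z) := fun n => by
    rw [treeTopology_eq hN]
    refine TopologicalSpace.GenerateOpen.basic _ ⟨z, hz.1.mem_itinSpace, n + 1, by omega, ?_⟩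
    rw [basicNhd_eq_near hK hN]
  constructor
  · intro hV
    obtain ⟨U, hUV, hU, hzU⟩ := mem_nhds_iff.1 hV
    suffices H : ∃ n, near h ν n z ⊆ U by
      obtain ⟨n, hn⟩ := H
      exact ⟨n, hn.trans hUV⟩
    rw [treeTopology_eq hN] at hU
    clear hUV
    induction hU with
    | basic s hs =>
      obtain ⟨a, -, k, hk, rfl⟩ := hs
      obtain ⟨n, rfl⟩ : ∃ n, k = n + 1 := ⟨k - 1, by omega⟩
      rw [basicNhd_eq_near hK hN] at hzU ⊢
      exact ⟨n, near_subset hzU⟩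
    | univ => exact ⟨0, subset_univ _⟩
    | inter s t _ _ ihs iht =>
      obtain ⟨n, hn⟩ := ihs hzU.1
      obtain ⟨m, hm⟩ := iht hzU.2
      exact ⟨max n m, subset_inter ((hmono z (le_max_left _ _)).trans hn)
        ((hmono z (le_max_right _ _)).trans hm)⟩
    | sUnion S _ ih =>
      obtain ⟨s, hs, hzs⟩ := hzU
      obtain ⟨n, hn⟩ := ih s hs hzs
      exact ⟨n, hn.trans (subset_sUnion_of_mem hs)⟩
  · rintro ⟨n, hn⟩
    exact mem_of_superset ((hopen n).mem_nhds (itinPt_mem_near hK hz n)) hn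

theorem IsNonPeriodic.separates (hK : IsKneading ν) (hN : IsNonPeriodic ν) {z u v : Itin A}
    (hz : z ∈ treeItin ν) (hu : u ∈ treeItin ν) (hv : v ∈ treeItin ν) (hs : ¬ Same ν z u v) :
    Separates (itinPt h hK hz) (itinPt h hK hu) (itinPt h hK hv) := by
  refine ⟨fun w => ∃ y, w.1 = .itin y ∧ Same ν z y u, fun w hw => ?_, ⟨u, rfl, Same.eq _ _⟩, ?_⟩
  · obtain ⟨y, hy, rfl⟩ := hN.tree_cases hK w
    have hne : y ≠ z := fun e => hw (itinPt_inj.2 e)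
    obtain ⟨n, hn⟩ : ∃ n, ¬ Agree n y z := by
      by_contra! hcon
      exact hne (hN.eq_of_agree hy.1 hz.1 hcon)
    refine (mem_nhds_iff_near hK hN hy).2 ⟨n, ?_⟩
    rintro w' ⟨b, hb, h1, -⟩
    obtain ⟨y', hy', rfl⟩ := hN.tree_cases hK w'
    obtain rfl : y' = b := Pt.itin.inj hb
    have h2 : Same ν z y y' := by
      by_contra h2
      exact hn (between_agree hy.1 hy'.1 hz.1 h1 h2).1
    constructor
    · rintro ⟨x, hx, h3⟩
      obtain rfl : y' = x := Pt.itin.inj hx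
      exact ⟨y, rfl, h2.trans h3⟩
    · rintro ⟨x, hx, h3⟩
      obtain rfl : y = x := Pt.itin.inj hx
      exact ⟨y', rfl, h2.symm.trans h3⟩
  · rintro ⟨y, hy, h1⟩
    obtain rfl : v = y := Pt.itin.inj hy
    exact hs h1.symm

theorem exists_near (hK : IsKneading ν) {z c : Itin A}
    (hz : z ∈ treeItin ν) (hc : c ∈ treeItin ν) (hne : z ≠ c) (n : ℕ) :
    ∃ v, Adm ν v ∧ ¬ Same ν v z c ∧ v ≠ z ∧ ∀ w, Adm ν w → ¬ Same ν w z v → w ≠ v →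
      Agree n z w ∧ ((∃ i < n, w i = none) → w = z) := by
  have hs := isNest_nest hK (fun _ => False) hz hc hne
  set s := nest ν (fun _ => False) z c with hsdef
  have hs1 : ∀ n, (s n).1 = z := by
    intro n
    induction n with
    | zero => rfl
    | succ n ih =>
      have : s (n + 1) = nestStep ν (fun _ => False) (s n) := rfl
      rw [this, nestStep]
      split_ifs with h1 h2
      · exact ih
      · exact h2.elim
      · exact ih
  have h1 := hs.right_between hK (Nat.zero_le n)
  have h2 := hs.ne n
  have h3 := hs.agree n
  rw [hs1] at h2 h3
  refine ⟨(s n).2, (hs.right_mem n).1, h1, h2.symm, fun w hw hwz hwne => ?_⟩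
  obtain ⟨h4, -, h5⟩ := between_agree hz.1 (hs.right_mem n).1 hw h3 hwz
  exact ⟨h4, fun h6 => (h5 h6).resolve_right hwne⟩

theorem IsNonPeriodic.continuous_arc (hK : IsKneading ν) (hN : IsNonPeriodic ν) {a b : Itin A}
    {F : Chain ν a b → ℝ} {γ : unitInterval → Pt A} (ha : a ∈ treeItin ν) (hb : b ∈ treeItin ν)
    (hγ : IsArc ν a b F γ) (hw : ∀ s, IsTreePt ν (γ s)) :
    Continuous fun s => treePt h hK (hw s) := by
  have hν := hK.adm
  have hcases : ∀ s : unitInterval, ∃ u : Chain ν a b, F u = s ∧ γ s = .itin u.val := fun s => by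
    rcases hγ.cases s with h1 | ⟨x, ρ, t, he, -⟩
    · exact h1
    · exact absurd hN (he.isStarPeriodic hK).not_nonPeriodic
  by_cases hab : a = b
  · have : ∀ s s' : unitInterval, s = s' := fun s s' => by
      obtain ⟨u, hu, -⟩ := hcases s
      exact absurd (hab ▸ Same.eq u.val a) u.property.2
    exact continuous_iff_continuousAt.2 fun s => by
      have : (fun s => treePt h hK (hw s)) = fun _ => treePt h hK (hw s) := funext fun s' => by
        rw [this s' s]
      rw [this]; exact continuousAt_const
  have hle := leftEnd_le hK ha hb hab
  have hre := le_rightEnd hK ha hb hab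
  refine continuous_iff_continuousAt.2 fun s V hV => ?_
  obtain ⟨u, hu, hs⟩ := hcases s
  have hs' : treePt h hK (hw s) = itinPt h hK (u.mem ha hb) := Subtype.ext hs
  rw [hs'] at hV
  obtain ⟨n, hn⟩ := (mem_nhds_iff_near hK hN _).1 hV
  have hR : ∀ᶠ s' in 𝓝 s, s ≤ s' → treePt h hK (hw s') ∈ V := by
    by_cases hub : u.val = b
    · refine Eventually.of_forall fun s' hss' => ?_
      have : s' = s := le_antisymm (Subtype.coe_le_coe.1 (by
        rw [← hu, hγ.right u hub]; exact s'.2.2)) hss'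
      rw [this, hs']
      exact hn (itinPt_mem_near hK _ n)
    · obtain ⟨v, hv, hvs, hvne, hvw⟩ := exists_near hK (u.mem ha hb) hb hub n
      have hlt : u < rightEnd hK ha hb hab := lt_of_le_of_ne (hre u) fun e =>
        hub (congrArg Chain.val e)
      obtain ⟨hv', h1, -⟩ := (Chain.between_iff hlt hν hv).1 hvs
      have h1 : u < ⟨v, hv'⟩ := lt_of_le_of_ne h1 fun e => hvne (congrArg Chain.val e).symm
      have h2 : s < ⟨_, hγ.mem ⟨v, hv'⟩⟩ := Subtype.coe_lt_coe.1 (by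
        rw [← hu]; exact hγ.strictMono h1)
      filter_upwards [Iio_mem_nhds h2] with s' hs' hss'
      have hs'' : (s' : ℝ) < F ⟨v, hv'⟩ := hs'
      obtain ⟨u', hu', he⟩ := hcases s'
      refine hn ⟨u'.val, he, hvw _ u'.property.1 ?_ ?_⟩
      · refine (Chain.between_iff h1 hν u'.property.1).2 ⟨u'.property, ?_, ?_⟩
        · rw [← hγ.strictMono.le_iff_le]
          show F u ≤ F u'
          rw [hu, hu']; exact hss'
        · rw [← hγ.strictMono.le_iff_le]
          show F u' ≤ _
          rw [hu']; exact hs''.le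
      · rintro rfl
        have h3 : F u' < F u' := hu'.trans_lt hs''
        exact lt_irrefl _ h3
  have hL : ∀ᶠ s' in 𝓝 s, s' ≤ s → treePt h hK (hw s') ∈ V := by
    by_cases hua : u.val = a
    · refine Eventually.of_forall fun s' hss' => ?_
      have : s' = s := le_antisymm hss' (Subtype.coe_le_coe.1 (by
        rw [← hu, hγ.left u hua]; exact s'.2.1))
      rw [this, hs']
      exact hn (itinPt_mem_near hK _ n)
    · obtain ⟨v, hv, hvs, hvne, hvw⟩ := exists_near hK (u.mem ha hb) ha hua n
      have hlt : leftEnd hK ha hb hab < u := lt_of_le_of_ne (hle u) fun e =>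
        hua (congrArg Chain.val e).symm
      obtain ⟨hv', -, h1⟩ := (Chain.between_iff hlt hν hv).1 fun h => hvs h.symm
      have h1 : ⟨v, hv'⟩ < u := lt_of_le_of_ne h1 fun e => hvne (congrArg Chain.val e)
      have h2 : ⟨_, hγ.mem ⟨v, hv'⟩⟩ < s := Subtype.coe_lt_coe.1 (by
        rw [← hu]; exact hγ.strictMono h1)
      filter_upwards [Ioi_mem_nhds h2] with s' hs' hss'
      have hs'' : F ⟨v, hv'⟩ < (s' : ℝ) := hs'
      obtain ⟨u', hu', he⟩ := hcases s'
      refine hn ⟨u'.val, he, hvw _ u'.property.1 (fun hsame => ?_) ?_⟩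
      · refine (Chain.between_iff h1 hν u'.property.1).2 ⟨u'.property, ?_, ?_⟩ hsame.symm
        · rw [← hγ.strictMono.le_iff_le]
          show _ ≤ F u'
          rw [hu']; exact hs''.le
        · rw [← hγ.strictMono.le_iff_le]
          show F u' ≤ F u
          rw [hu, hu']; exact hss'
      · rintro rfl
        have h3 : F u' < F u' := hs''.trans_eq hu'.symm
        exact lt_irrefl _ h3
  show ∀ᶠ s' in 𝓝 s, treePt h hK (hw s') ∈ V
  filter_upwards [hR, hL] with s' h1 h2
  exact (le_total s s').elim h1 h2

theorem IsNonPeriodic.isTreeLike (hK : IsKneading ν) (hN : IsNonPeriodic ν) : IsTreeLike hK h where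
  t2 := t2Space_of_separates fun u v huv => by
    obtain ⟨y, hy, rfl⟩ := hN.tree_cases hK u
    obtain ⟨z, hz, rfl⟩ := hN.tree_cases hK v
    obtain ⟨m, hm, -, h1, h2, h3⟩ := hN.exists_between hK hy hz fun e => huv (itinPt_inj.2 e)
    exact ⟨itinPt h hK hm, fun e => h2 (itinPt_inj.1 e), fun e => h3 (itinPt_inj.1 e),
      hN.separates hK hm hy hz h1⟩
  continuous_arc ha hb hγ hw := hN.continuous_arc hK ha hb hγ hw
  separates_itin hz hu hv _ _ hs := hN.separates hK hz hu hv hs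
  separates_edge he := absurd hN (he.isStarPeriodic hK).not_nonPeriodic
  not_isBranchPoint he := absurd hN (he.isStarPeriodic hK).not_nonPeriodic

theorem treeMap_itinPt (hK : IsKneading ν) {z : Itin A} (hz : z ∈ treeItin ν) :
    treeMap h ν (itinPt h hK hz) = itinPt h hK (shift_mem hK hz) := rfl

theorem IsNonPeriodic.continuous_treeMap (hK : IsKneading ν) (hN : IsNonPeriodic ν) :
    Continuous (treeMap h ν) := by
  refine continuous_iff_continuousAt.2 fun w V hV => ?_
  obtain ⟨z, hz, rfl⟩ := hN.tree_cases hK w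
  rw [treeMap_itinPt] at hV
  obtain ⟨n, hn⟩ := (mem_nhds_iff_near hK hN _).1 hV
  refine (mem_nhds_iff_near hK hN hz).2 ⟨n + 1, ?_⟩
  rintro w ⟨b, hb, h1, h2⟩
  obtain ⟨y, hy, rfl⟩ := hN.tree_cases hK w
  obtain rfl : y = b := Pt.itin.inj hb
  refine hn ⟨shift y, rfl, h1.shift, fun ⟨i, hi, h0⟩ => ?_⟩
  rw [h2 ⟨i + 1, by omega, h0⟩]

theorem IsNonPeriodic.exists_isEmbedding (hK : IsKneading ν) (hN : IsNonPeriodic ν)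
    (w : hubbardTree h ν) (hw : w ≠ treeCrit h ν) :
    ∃ U : Set (hubbardTree h ν), IsOpen U ∧ w ∈ U ∧ IsEmbedding (U.domRestrict (treeMap h ν)) := by
  have hs : sym w.1 ≠ none := fun h0 =>
    hw (Subtype.ext (((mem_hubbardTree_iff hK).1 w.2).sym_eq_none h0))
  refine ⟨{w' | sym w'.1 = sym w.1}, isOpen_iff_mem_nhds.2 fun w' hw' => ?_, rfl, ?_, ?_⟩
  · obtain ⟨z, hz, rfl⟩ := hN.tree_cases hK w'
    refine (mem_nhds_iff_near hK hN hz).2 ⟨1, ?_⟩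
    rintro v ⟨b, hb, h1, h2⟩
    obtain ⟨y, hy, rfl⟩ := hN.tree_cases hK v
    obtain rfl : y = b := Pt.itin.inj hb
    have hz0 : z 0 = sym w.1 := hw'
    show y 0 = sym w.1
    rcases not_differ_iff.1 (h1 0 one_pos) with h3 | h3 | h3
    · rw [← h3, hz0]
    · exact absurd (hz0.symm.trans h3) hs
    · rw [h2 ⟨0, one_pos, h3⟩, hz0]
  · rw [isInducing_iff_nhds]
    intro v
    refine le_antisymm (((hN.continuous_treeMap hK).comp
      continuous_subtype_val).continuousAt.tendsto.le_comap) fun V hV => ?_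
    obtain ⟨v, hv⟩ := v
    obtain ⟨z, hz, rfl⟩ := hN.tree_cases hK v
    obtain ⟨V', hV', hVV'⟩ := mem_nhds_subtype _ _ _ |>.1 hV
    obtain ⟨n, hn⟩ := (mem_nhds_iff_near hK hN hz).1 hV'
    refine ⟨near h ν n (shift z), (mem_nhds_iff_near hK hN (shift_mem hK hz)).2 ⟨n, Subset.rfl⟩, ?_⟩
    rintro ⟨v', hv'⟩ hmem
    obtain ⟨y, hy, rfl⟩ := hN.tree_cases hK v'
    obtain ⟨b, hb, h1, h2⟩ := hmem
    obtain rfl : shift y = b := Pt.itin.inj hb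
    refine hVV' (hn ⟨y, rfl, fun i hi => ?_, fun ⟨i, hi, h0⟩ => ?_⟩)
    · cases i with
      | zero => exact not_differ_iff.2 (Or.inl (Eq.trans hv hv'.symm))
      | succ i => exact h1 i (by omega)
    · cases i with
      | zero => exact absurd (Eq.trans (Eq.symm hv') h0) hs
      | succ i => exact ext_head (Eq.trans hv' hv.symm) (h2 ⟨i, by omega, h0⟩)
  · rintro ⟨v, hv⟩ ⟨v', hv'⟩ he
    exact Subtype.ext (Subtype.ext (eq_of_ptShift_eq ((mem_hubbardTree_iff hK).1 v.2)
      ((mem_hubbardTree_iff hK).1 v'.2) (Eq.trans hv hv'.symm) (congrArg Subtype.val he)))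

end NonPeriodic

/-! ### Retractions to the edges -/

section Retraction

variable {x ρ : Itin A}

open Classical in
/-- An itinerary other than `z` that represents the position of a point relative to `z`. -/
def rep (z : Itin A) : Pt A → Itin A
  | .itin y => y
  | .fatou y η _ => if z = y then η else y

open Classical in
/-- The retraction of the tree to the edge `[x, ρ] ≅ [0, 1]`. -/
def retr (ν x ρ : Itin A) : Pt A → ℝ
  | .itin y => if Same ν x y ρ then 1 else 0
  | .fatou y η t => if y = x ∧ η = ρ then t else
      if Same ν x (rep x (.fatou y η t)) ρ then 1 else 0

theorem rep_mem {z : Itin A} {w : Pt A} (hw : IsTreePt ν w) : rep z w ∈ treeItin ν := by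
  rcases hw with ⟨y, hy, rfl⟩ | ⟨y, η, t, he, rfl⟩
  · exact hy
  · simp only [rep]
    split_ifs
    exacts [he.right_mem, he.left_mem]

open Classical in
theorem retr_itin (y : Itin A) : retr ν x ρ (.itin y) = if Same ν x y ρ then 1 else 0 := rfl

theorem retr_edge (t : Ioo (0 : ℝ) 1) : retr ν x ρ (.fatou x ρ t) = t := if_pos ⟨rfl, rfl⟩

open Classical in
theorem retr_of_ne {w : Pt A} (h : ∀ t, w ≠ .fatou x ρ t) :
    retr ν x ρ w = if Same ν x (rep x w) ρ then 1 else 0 := by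
  cases w with
  | itin y => rfl
  | fatou y η t =>
    refine if_neg ?_
    rintro ⟨rfl, rfl⟩
    exact h t rfl

theorem retr_eq_iff {w : Pt A} {t : Ioo (0 : ℝ) 1} (h : retr ν x ρ w = t) : w = .fatou x ρ t := by
  by_cases hw : ∃ t, w = .fatou x ρ t
  · obtain ⟨t', rfl⟩ := hw
    rw [retr_edge] at h
    rw [Subtype.ext h]
  · rw [retr_of_ne fun t h => hw ⟨t, h⟩] at h
    split_ifs at h
    · exact absurd h t.2.2.ne'
    · exact absurd h t.2.1.ne

/-- An edge that separates two points of the tree lies between them. -/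
theorem IsEdge.between (hK : IsKneading ν) (h : IsEdge ν x ρ) {u v : Itin A} (hu : u ∈ treeItin ν)
    (h1 : Same ν x u ρ) (h2 : ¬ Same ν x v ρ) : ¬ Same ν x u v ∧ ¬ Same ν ρ u v := by
  refine ⟨fun h3 => h2 (h3.symm.trans h1), fun h3 => ?_⟩
  have h4 : ¬ Same ν ρ u x := (h.not_same_or hK hu).resolve_left (not_not.2 h1)
  rcases same_or_same h.left_mem.1 h.right_mem.1 h.ne v with h5 | h5
  · exact h2 h5
  · exact h4 (h3.trans h5)

/-- An edge between two points of the tree separates them. -/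
theorem IsEdge.same_of_between (h : IsEdge ν x ρ) {u v : Itin A}
    (h1 : ¬ Same ν ρ u v) (h2 : ¬ Same ν x u ρ) : Same ν x v ρ := by
  by_contra h3
  rcases Kneading.not_same_or x h1 with h4 | h4
  · exact h.ne (not_same_asymm h.left_mem.1 h.right_mem.1 h2 h4)
  · exact h.ne (not_same_asymm h.left_mem.1 h.right_mem.1 h3 fun h => h4 h.symm)

/-- The retractions separate the points of the tree. -/
theorem exists_retr_ne (hK : IsKneading ν) (hP : IsStarPeriodic ν) {w w' : Pt A}
    (hw : IsTreePt ν w) (hw' : IsTreePt ν w') (hne : w ≠ w') :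
    ∃ x ρ, IsEdge ν x ρ ∧ retr ν x ρ w ≠ retr ν x ρ w' := by
  rcases hw with ⟨u, hu, rfl⟩ | ⟨x, ρ, t, he, rfl⟩
  · rcases hw' with ⟨v, hv, rfl⟩ | ⟨x, ρ, t, he, rfl⟩
    · obtain ⟨x, ρ, he, h1, h2⟩ := exists_edge_between hK hP hu hv fun e => hne (by rw [e])
      refine ⟨x, ρ, he, ?_⟩
      rw [retr_itin, retr_itin]
      by_cases h3 : Same ν x u ρ
      · rw [if_pos h3, if_neg fun h4 => h1 (h3.trans h4.symm)]; exact one_ne_zero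
      · rw [if_neg h3, if_pos (he.same_of_between h2 h3)]; exact zero_ne_one
    · exact ⟨x, ρ, he, fun h => hne (retr_eq_iff (h.trans (retr_edge t)))⟩
  · exact ⟨x, ρ, he, fun h => hne (retr_eq_iff (h.symm.trans (retr_edge t))).symm⟩

section Arc

variable {a b : Itin A} {F : Chain ν a b → ℝ} {γ : unitInterval → Pt A}

theorem IsArc.exists_rep (hK : IsKneading ν) (h : IsArc ν a b F γ) (x : Itin A)
    (s : unitInterval) : ∃ u : Chain ν a b, rep x (γ s) = u.val ∧
      (F u = s ∨ (u.val ≠ x ∧ (∀ v, F v ≠ s) ∧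
        ∀ v, ¬ ((F u < F v ∧ F v < s) ∨ (s < F v ∧ F v < F u)))) := by
  rcases h.cases s with ⟨u, hu, h1⟩ | ⟨y, η, t, he, h1, -, h2⟩
  · exact ⟨u, by rw [h1]; rfl, Or.inl hu⟩
  · have hg := h.not_gap hK he
    have hne : ∀ v, F v ≠ s := fun v hv => hg v (by rw [hv]; exact h1)
    have key : ∀ u, u = y ∨ u = η → ∀ v, ¬ ((F u < F v ∧ F v < s) ∨ (s < F v ∧ F v < F u)) := by
      rintro u (rfl | rfl) v h3
      · refine hg v ?_
        rcases h1 with h1 | h1 <;> rcases h3 with h3 | h3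
        · exact Or.inl ⟨h3.1, h3.2.trans h1.2⟩
        · linarith
        · linarith
        · exact Or.inr ⟨h1.1.trans h3.1, h3.2⟩
      · refine hg v ?_
        rcases h1 with h1 | h1 <;> rcases h3 with h3 | h3
        · linarith
        · exact Or.inl ⟨h1.1.trans h3.1, h3.2⟩
        · exact Or.inr ⟨h3.1, h3.2.trans h1.2⟩
        · linarith
    by_cases hx : x = y.val
    · refine ⟨η, by rw [h2]; exact if_pos hx, Or.inr ⟨?_, hne, key η (Or.inr rfl)⟩⟩
      rw [hx]; exact he.ne.symm
    · exact ⟨y, by rw [h2]; exact if_neg hx, Or.inr ⟨fun e => hx e.symm, hne, key y (Or.inl rfl)⟩⟩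

/-- The position of a parameter relative to an edge of the arc. -/
theorem IsArc.retr_eq (hK : IsKneading ν) (h : IsArc ν a b F γ) {X R : Chain ν a b}
    (he : IsEdge ν X.val R.val) (s : unitInterval) :
    retr ν X.val R.val (γ s) = max 0 (min 1 ((s - F X) / (F R - F X))) := by
  have hν := hK.adm
  have hXR : R ≠ X := fun e => he.ne (congrArg Chain.val e).symm
  have hg := h.not_gap hK he
  by_cases hs : ∃ t, γ s = .fatou X.val R.val t
  · obtain ⟨t, ht⟩ := hs
    rcases h.cases s with ⟨u, -, h1⟩ | ⟨y, η, t', -, -, h1, h2⟩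
    · rw [h1] at ht; cases ht
    · rw [h2] at ht
      obtain ⟨e1, e2, rfl⟩ := Pt.fatou.inj ht
      obtain rfl : y = X := Chain.ext e1
      obtain rfl : η = R := Chain.ext e2
      rw [h2, retr_edge, ← h1, min_eq_right t'.2.2.le, max_eq_right t'.2.1.le]
  · have hns : ¬ ((F X < s ∧ s < F R) ∨ (F R < s ∧ s < F X)) := by
      intro h1
      rcases h.cases s with ⟨u, hu, -⟩ | ⟨y, η, t', he', h2, -, h3⟩
      · exact hg u (by rw [hu]; exact h1)
      · obtain ⟨rfl, rfl⟩ := h.edge_unique hK he he' h1 h2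
        exact hs ⟨t', h3⟩
    rw [retr_of_ne fun t ht => hs ⟨t, ht⟩]
    obtain ⟨u, hu, hus⟩ := h.exists_rep hK X.val s
    rw [hu]
    have hgu := not_or.1 (hg u)
    have hns := not_or.1 hns
    have hself : ¬ Same ν X.val X.val R.val := not_same_self hν X.property.1 R.property.1 he.ne.symm
    rcases lt_or_gt_of_ne hXR with h1 | h1
    · have hF := h.strictMono h1
      have hd : F R - F X < 0 := by linarith
      have h2 : Same ν X.val u.val R.val ↔ u < X := by
        by_cases huX : u = X
        · subst huX; exact ⟨fun h => absurd h hself, fun h => absurd h (lt_irrefl _)⟩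
        · rw [Chain.same_val_iff hν huX hXR]
          constructor
          · intro h; exact lt_of_le_of_ne (not_lt.1 fun h' => (h.1 h').asymm h1) huX
          · intro h; exact ⟨fun h' => absurd h' h.asymm, fun h' => absurd h' h1.asymm⟩
      split_ifs with h3
      · rw [h2, ← h.strictMono.lt_iff_lt] at h3
        have h4 : F u ≤ F R := not_lt.1 fun h' => hgu.2 ⟨h', h3⟩
        have h5 : (s : ℝ) ≤ F R := by
          rcases hus with hus | ⟨-, hne, hb⟩
          · rw [← hus]; exact h4
          · by_contra h6
            have h7 : F X < s := lt_of_le_of_ne (not_lt.1 fun h' => hns.2 ⟨not_le.1 h6, h'⟩) (hne X)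
            exact hb X (Or.inl ⟨h3, h7⟩)
        rw [min_eq_left ((one_le_div_of_neg hd).2 (by linarith)), max_eq_right zero_le_one]
      · rw [h2, not_lt, ← h.strictMono.le_iff_le] at h3
        have h5 : F X ≤ s := by
          rcases hus with hus | ⟨hux, hne, hb⟩
          · rw [← hus]; exact h3
          · by_contra h6
            have h7 : F X < F u := lt_of_le_of_ne h3 fun e =>
              hux (congrArg Chain.val (h.strictMono.injective e)).symm
            exact hb X (Or.inr ⟨not_le.1 h6, h7⟩)
        have h6 : (s - F X) / (F R - F X) ≤ 0 := div_nonpos_of_nonneg_of_nonpos (by linarith) hd.le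
        rw [min_eq_right (h6.trans zero_le_one), max_eq_left h6]
    · have hF := h.strictMono h1
      have hd : 0 < F R - F X := by linarith
      have h2 : Same ν X.val u.val R.val ↔ X < u := by
        by_cases huX : u = X
        · subst huX; exact ⟨fun h => absurd h hself, fun h => absurd h (lt_irrefl _)⟩
        · rw [Chain.same_val_iff hν huX hXR]
          exact ⟨fun h => h.2 h1, fun h => ⟨fun _ => h1, fun _ => h⟩⟩
      split_ifs with h3
      · rw [h2, ← h.strictMono.lt_iff_lt] at h3
        have h4 : F R ≤ F u := not_lt.1 fun h' => hgu.1 ⟨h3, h'⟩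
        have h5 : F R ≤ s := by
          rcases hus with hus | ⟨-, hne, hb⟩
          · rw [← hus]; exact h4
          · by_contra h6
            have h7 : s < F X := lt_of_le_of_ne (not_lt.1 fun h' => hns.1 ⟨h', not_le.1 h6⟩)
              (hne X).symm
            exact hb X (Or.inr ⟨h7, h3⟩)
        rw [min_eq_left ((one_le_div hd).2 (by linarith)), max_eq_right zero_le_one]
      · rw [h2, not_lt, ← h.strictMono.le_iff_le] at h3
        have h5 : s ≤ F X := by
          rcases hus with hus | ⟨hux, hne, hb⟩
          · rw [← hus]; exact h3
          · by_contra h6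
            have h7 : F u < F X := lt_of_le_of_ne h3 fun e =>
              hux (congrArg Chain.val (h.strictMono.injective e))
            exact hb X (Or.inl ⟨h7, not_le.1 h6⟩)
        have h6 : (s - F X) / (F R - F X) ≤ 0 := div_nonpos_of_nonpos_of_nonneg (by linarith) hd.le
        rw [min_eq_right (h6.trans zero_le_one), max_eq_left h6]

theorem IsArc.retr_continuous (hK : IsKneading ν) (ha : a ∈ treeItin ν) (hb : b ∈ treeItin ν)
    (h : IsArc ν a b F γ) (he : IsEdge ν x ρ) :
    Continuous (fun s => retr ν x ρ (γ s)) ∧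
      (Monotone (fun s => retr ν x ρ (γ s)) ∨ Antitone (fun s => retr ν x ρ (γ s))) := by
  by_cases hm : (¬ Same ν x a b) ∧ ¬ Same ν ρ a b
  · let X : Chain ν a b := ⟨x, he.left_mem.1, hm.1⟩
    let R : Chain ν a b := ⟨ρ, he.right_mem.1, hm.2⟩
    have hfun : (fun s => retr ν x ρ (γ s)) =
        fun s : unitInterval => max 0 (min 1 (((s : ℝ) - F X) / (F R - F X))) :=
      funext fun s => h.retr_eq hK (X := X) (R := R) he s
    rw [hfun]
    refine ⟨by fun_prop, ?_⟩
    rcases le_total (F X) (F R) with h1 | h1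
    · left
      intro s s' hs
      have hs' : (s : ℝ) ≤ s' := hs
      have : 0 ≤ F R - F X := by linarith
      show max _ _ ≤ max _ _
      gcongr
    · right
      intro s s' hs
      have hs' : (s : ℝ) ≤ s' := hs
      have h2 : F R - F X ≤ 0 := by linarith
      have h3 : ((s' : ℝ) - F X) / (F R - F X) ≤ ((s : ℝ) - F X) / (F R - F X) :=
        div_le_div_of_nonpos_of_le h2 (by linarith)
      show max _ _ ≤ max _ _
      gcongr
  · have hmem : ∀ u : Itin A, u ∈ treeItin ν → ¬ Same ν u a b → (Same ν x u ρ ↔ Same ν x a ρ) := by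
      intro u hu hab
      by_contra hcon
      have h1 : ¬ Same ν x a u ∧ ¬ Same ν ρ a u := by
        by_cases h2 : Same ν x a ρ
        · exact he.between hK ha h2 fun h3 => hcon ⟨fun _ => h2, fun _ => h3⟩
        · have h3 : Same ν x u ρ := by
            by_contra h3
            exact hcon ⟨fun h => absurd h h3, fun h => absurd h h2⟩
          have := he.between hK hu h3 h2
          exact ⟨fun h => this.1 h.symm, fun h => this.2 h.symm⟩
      exact hm ⟨not_same_trans he.left_mem.1 hu.1 h1.1 hab,
        not_same_trans he.right_mem.1 hu.1 h1.2 hab⟩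
    have hconst : ∀ s, retr ν x ρ (γ s) = retr ν x ρ (.itin a) := by
      intro s
      rw [retr_itin, retr_of_ne fun t ht => ?_]
      · have h1 := hmem (rep x (γ s)) (rep_mem (h.isTreePt ha hb s)) ?_
        · classical exact if_congr h1 rfl rfl
        · rcases h.cases s with ⟨u, -, h1⟩ | ⟨y, η, t, -, -, -, h1⟩
          · rw [h1]; exact u.property.2
          · rw [h1]
            simp only [rep]
            split_ifs
            exacts [η.property.2, y.property.2]
      · rcases h.cases s with ⟨u, -, h1⟩ | ⟨y, η, t', -, -, -, h1⟩
        · rw [h1] at ht; cases ht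
        · rw [h1] at ht
          obtain ⟨rfl, rfl, -⟩ := Pt.fatou.inj ht
          exact hm ⟨y.property.2, η.property.2⟩
    have hfun : (fun s => retr ν x ρ (γ s)) = fun _ => retr ν x ρ (.itin a) := funext hconst
    rw [hfun]
    exact ⟨continuous_const, Or.inl monotone_const⟩

end Arc

/-! ### The retractions and the shift -/

/-- The points of the tree with symbol `o` or `⋆`. -/
def HasHead (ν : Itin A) (o : Option A) (w : Pt A) : Prop :=
  IsTreePt ν w ∧ (sym w = o ∨ sym w = none)

theorem HasHead.rep {o : Option A} {w : Pt A} (hw : HasHead ν o w) (z : Itin A) :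
    rep z w 0 = o ∨ rep z w 0 = none := by
  obtain ⟨⟨y, hy, rfl⟩ | ⟨y, η, t, he, rfl⟩, h⟩ := hw
  · exact h
  · simp only [Kneading.rep]
    split_ifs
    · rcases he.head with h1 | h1
      · rw [h1]; exact h
      · right; rw [h1]; rfl
    · exact h

theorem same_shift_iff {x' ρ' y : Itin A} {o : Option A} (ho : o ≠ none) (hx0 : x' 0 = o)
    (hρ' : Adm ν ρ') (hρ0 : ρ' 0 = o ∨ ρ' 0 = none) (hy : Adm ν y)
    (hy0 : y 0 = o ∨ y 0 = none) :
    Same ν (shift x') (shift y) (shift ρ') ↔ Same ν x' y ρ' := by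
  rw [same_iff (z := x') (hx0.symm ▸ ho), hx0, pull_eq_shift hy hy0, pull_eq_shift hρ' hρ0]

theorem HasHead.exists_lift {h : FatouMaps A} {o : Option A} {x' ρ' : Itin A} (hx0 : x' 0 = o) (hρ' : Adm ν ρ')
    (hρ0 : ρ' 0 = o ∨ ρ' 0 = none) {w : Pt A} (hw : HasHead ν o w)
    (hne : ∀ t, w ≠ .fatou x' ρ' t) : ∃ y ∈ treeItin ν, (y 0 = o ∨ y 0 = none) ∧
      retr ν x' ρ' w = retr ν x' ρ' (.itin y) ∧
      retr ν (shift x') (shift ρ') (ptShift h w) =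
        retr ν (shift x') (shift ρ') (.itin (shift y)) := by
  refine ⟨Kneading.rep x' w, rep_mem hw.1, hw.rep x', ?_, ?_⟩
  · rw [retr_of_ne hne, retr_itin]
  · obtain ⟨⟨y, hy, rfl⟩ | ⟨y, η, t, he, rfl⟩, h0⟩ := hw
    · rfl
    · have hy0 : y 0 = o := h0.resolve_right (he.starFree 0)
      have hyx : shift y = shift x' ↔ y = x' :=
        ⟨fun e => ext_head (hy0.trans hx0.symm) e, fun e => by rw [e]⟩
      have hne' : ∀ t', ptShift h (.fatou y η t) ≠ .fatou (shift x') (shift ρ') t' := by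
        intro t' e
        obtain ⟨e1, e2, -⟩ := Pt.fatou.inj e
        have e3 := hyx.1 e1
        refine hne t ?_
        rw [e3]
        have hη0 : η 0 = o ∨ η 0 = none := he.head.imp (fun h => h.trans hy0) fun h => by rw [h]; rfl
        have hηρ : η = ρ' := by
          refine ext_head ?_ e2
          by_cases h1 : shift η = ν
          · rw [he.right_mem.1.zero_eq_none.2 h1, hρ'.zero_eq_none.2 (e2 ▸ h1)]
          · rw [hη0.resolve_right fun h2 => h1 (he.right_mem.1.zero_eq_none.1 h2),
              hρ0.resolve_right fun h2 => h1 (e2 ▸ hρ'.zero_eq_none.1 h2)]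
        rw [hηρ]
      have hrep : Kneading.rep (shift x') (ptShift h (.fatou y η t)) =
          shift (Kneading.rep x' (.fatou y η t)) := by
        simp only [ptShift, Kneading.rep]
        by_cases h1 : x' = y
        · rw [if_pos h1, if_pos (hyx.2 h1.symm).symm]
        · rw [if_neg h1, if_neg fun e => h1 (hyx.1 e.symm).symm]
      rw [retr_of_ne hne', retr_itin, hrep]

/-- On the points with symbol `o` or `⋆`, the retractions composed with the shift are
retractions up to a reparametrization of the edge. -/
theorem exists_retr_ptShift (hK : IsKneading ν) (h : FatouMaps A) (he : IsEdge ν x ρ)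
    {o : Option A} (ho : o ≠ none) :
    (∃ c : ℝ, ∀ w, HasHead ν o w → retr ν x ρ (ptShift h w) = c) ∨
      ∃ x' ρ', IsEdge ν x' ρ' ∧ ∃ H : ℝ → ℝ, Continuous H ∧
        ∀ w, HasHead ν o w → retr ν x ρ (ptShift h w) = H (retr ν x' ρ' w) := by
  classical
  have hν := hK.adm
  have hP := he.isStarPeriodic hK
  obtain ⟨j, hj⟩ := hP.exists_none
  have hxν : x ≠ ν := fun e => he.starFree j (e ▸ hj)
  obtain ⟨e, rfl⟩ := Option.ne_none_iff_exists'.1 ho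
  obtain ⟨x', hx', hx0, rfl⟩ : ∃ x', Adm ν x' ∧ x' 0 = some e ∧ shift x' = x :=
    ⟨cons (some e) x, he.left_mem.1.cons hxν e, rfl, rfl⟩
  obtain ⟨ρ', hρ', hρ0, hρT, rfl⟩ : ∃ ρ', Adm ν ρ' ∧ (ρ' 0 = some e ∨ ρ' 0 = none) ∧
      (ρ' 0 = none → ρ' ∈ treeItin ν) ∧ shift ρ' = ρ := by
    by_cases h1 : ρ = ν
    · exact ⟨critPt ν, critPt_mem_adm hν, Or.inr rfl, fun _ => critPt_mem_treeItin hK, h1.symm⟩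
    · exact ⟨cons (some e) ρ, he.right_mem.1.cons h1 e, Or.inl rfl, fun h => (by cases h), rfl⟩
  have hsame : ∀ y, Adm ν y → (y 0 = some e ∨ y 0 = none) →
      (Same ν (shift x') (shift y) (shift ρ') ↔ Same ν x' y ρ') :=
    fun y hy hy0 => same_shift_iff ho hx0 hρ' hρ0 hy hy0
  by_cases hT : x' ∈ treeItin ν ∧ ρ' ∈ treeItin ν
  · right
    have hE : IsEdge ν x' ρ' := by
      refine ⟨hT.1, hT.2, fun i => ?_, fun hs => he.not_starFree fun i => hs (i + 1), fun n i hi => ?_⟩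
      · cases i with
        | zero => rw [hx0]; exact ho
        | succ i => exact he.starFree i
      · cases i with
        | zero =>
          rw [not_differ_iff, hx0]
          exact hρ0.imp Eq.symm Or.inr
        | succ i => exact he.agree n i (by omega)
    let H : ℝ → ℝ := fun r => if hr : r ∈ Ioo (0 : ℝ) 1 then h x' ρ' ⟨r, hr⟩ else r
    have hH0 : H 0 = 0 := dif_neg fun h => lt_irrefl _ h.1
    have hH1 : H 1 = 1 := dif_neg fun h => lt_irrefl _ h.2
    have hHt : ∀ t : Ioo (0 : ℝ) 1, H t = h x' ρ' t := fun t => dif_pos t.2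
    have hHs : Function.Surjective H := by
      intro r
      by_cases hr : r ∈ Ioo (0 : ℝ) 1
      · exact ⟨(h x' ρ').symm ⟨r, hr⟩, by rw [hHt, OrderIso.apply_symm_apply]⟩
      · exact ⟨r, dif_neg hr⟩
    have hHm : Monotone H := by
      intro r r' hrr
      by_cases hr : r ∈ Ioo (0 : ℝ) 1 <;> by_cases hr' : r' ∈ Ioo (0 : ℝ) 1
      · rw [hHt ⟨r, hr⟩, hHt ⟨r', hr'⟩]
        exact (h x' ρ').monotone hrr
      · rw [hHt ⟨r, hr⟩, show H r' = r' from dif_neg hr']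
        have h1 := (h x' ρ' ⟨r, hr⟩).2.2
        have h2 : 1 ≤ r' := not_lt.1 fun h => hr' ⟨hr.1.trans_le hrr, h⟩
        linarith
      · rw [hHt ⟨r', hr'⟩, show H r = r from dif_neg hr]
        have h1 := (h x' ρ' ⟨r', hr'⟩).2.1
        have h2 : r ≤ 0 := not_lt.1 fun h => hr ⟨h, hrr.trans_lt hr'.2⟩
        linarith
      · rw [show H r' = r' from dif_neg hr', show H r = r from dif_neg hr]
        exact hrr
    refine ⟨x', ρ', hE, H, hHm.continuous_of_surjective hHs, fun w hw => ?_⟩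
    by_cases hw' : ∃ t, w = .fatou x' ρ' t
    · obtain ⟨t, rfl⟩ := hw'
      rw [retr_edge, hHt]
      exact retr_edge _
    · obtain ⟨y, hy, hy0, h1, h2⟩ := hw.exists_lift (h := h) hx0 hρ' hρ0
        fun t ht => hw' ⟨t, ht⟩
      rw [h1, h2, retr_itin, retr_itin]
      have h3 := hsame y hy.1 hy0
      by_cases h4 : Same ν x' y ρ'
      · rw [if_pos h4, if_pos (h3.2 h4), hH1]
      · rw [if_neg h4, if_neg fun h5 => h4 (h3.1 h5), hH0]
  · left
    have hne : ∀ w, HasHead ν (some e) w → ∀ t, w ≠ .fatou x' ρ' t := by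
      rintro w ⟨⟨y, hy, rfl⟩ | ⟨y, η, t, hE, rfl⟩, -⟩ t' h1
      · cases h1
      · obtain ⟨rfl, rfl, -⟩ := Pt.fatou.inj h1
        exact hT ⟨hE.left_mem, hE.right_mem⟩
    have hall : ∀ y₁ ∈ treeItin ν, (y₁ 0 = some e ∨ y₁ 0 = none) → ∀ y₂ ∈ treeItin ν,
        (y₂ 0 = some e ∨ y₂ 0 = none) → Same ν (shift x') (shift y₁) (shift ρ') →
        Same ν (shift x') (shift y₂) (shift ρ') := by
      intro y₁ hy₁ h1 y₂ hy₂ h2 h3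
      by_contra h4
      obtain ⟨h5, h6⟩ := he.between hK (shift_mem hK hy₁) h3 h4
      refine hT ⟨between_mem hy₁ hy₂ hx' fun h7 => h5 ?_, ?_⟩
      · rw [same_iff (hx0.symm ▸ ho), hx0, pull_eq_shift hy₁.1 h1, pull_eq_shift hy₂.1 h2] at h7
        exact h7
      · by_cases h8 : ρ' 0 = none
        · exact hρT h8
        · refine between_mem hy₁ hy₂ hρ' fun h7 => h6 ?_
          rw [same_iff h8, hρ0.resolve_right h8, pull_eq_shift hy₁.1 h1,
            pull_eq_shift hy₂.1 h2] at h7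
          exact h7
    by_cases hex : ∃ y ∈ treeItin ν, (y 0 = some e ∨ y 0 = none) ∧
        Same ν (shift x') (shift y) (shift ρ')
    · obtain ⟨y₁, hy₁, h1, h2⟩ := hex
      refine ⟨1, fun w hw => ?_⟩
      obtain ⟨y, hy, hy0, -, h3⟩ := hw.exists_lift (h := h) hx0 hρ' hρ0 (hne w hw)
      rw [h3, retr_itin, if_pos (hall y₁ hy₁ h1 y hy hy0 h2)]
    · refine ⟨0, fun w hw => ?_⟩
      obtain ⟨y, hy, hy0, -, h3⟩ := hw.exists_lift (h := h) hx0 hρ' hρ0 (hne w hw)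
      rw [h3, retr_itin, if_neg fun h4 => hex ⟨y, hy, hy0, h4⟩]

/-- A retraction to an edge at the critical point sees the symbol of that edge. -/
theorem sym_eq_of_retr_lt (he : IsEdge ν x (critPt ν)) {w : Pt A} (hw : IsTreePt ν w)
    (h : retr ν x (critPt ν) w < 1) : sym w = x 0 := by
  by_contra h0
  have hx0 : x 0 ≠ none := he.starFree 0
  rw [retr_of_ne, if_pos] at h
  · exact lt_irrefl _ h
  · rw [same_iff hx0, pull_of_ne (x := critPt ν) fun h => hx0 h.symm, pull_of_ne]
    · exact Same.eq _ _
    · rcases hw with ⟨y, hy, rfl⟩ | ⟨y, η, t, hE, rfl⟩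
      · exact h0
      · have : x ≠ y := fun e => h0 (by rw [e]; rfl)
        simp only [Kneading.rep, if_neg this]
        exact h0
  · rintro t rfl
    exact h0 rfl

theorem exists_retr_lt (hK : IsKneading ν) (hP : IsStarPeriodic ν) {w : Pt A}
    (hw : IsTreePt ν w) (h0 : sym w ≠ none) :
    ∃ x, IsEdge ν x (critPt ν) ∧ retr ν x (critPt ν) w < 1 := by
  have hc := critPt_mem_treeItin hK
  have hcs : ¬ StarFree (critPt ν) := fun h => h 0 rfl
  rcases hw with ⟨y, hy, rfl⟩ | ⟨y, η, t, hE, rfl⟩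
  · have hne : critPt ν ≠ y := fun e => h0 (by rw [← e]; rfl)
    obtain ⟨x, he, h1⟩ := exists_edge_towards hK hP hc hcs hy hne
    refine ⟨x, he, ?_⟩
    rw [retr_itin, if_neg fun h => h1 h.symm]
    exact zero_lt_one
  · have hne : critPt ν ≠ y := fun e => h0 (by rw [← e]; rfl)
    obtain ⟨x, he, h1⟩ := exists_edge_towards hK hP hc hcs hE.left_mem hne
    refine ⟨x, he, ?_⟩
    by_cases h2 : y = x ∧ η = critPt ν
    · obtain ⟨rfl, rfl⟩ := h2
      rw [retr_edge]; exact t.2.2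
    · rw [retr_of_ne (by rintro t' h3; obtain ⟨e1, e2, -⟩ := Pt.fatou.inj h3; exact h2 ⟨e1, e2⟩),
        if_neg]
      · exact zero_lt_one
      · simp only [Kneading.rep]
        split_ifs with h3
        · subst h3
          refine (he.not_same_or hK hE.right_mem).resolve_right fun h4 => ?_
          rcases hE.eq_or_eq hc.1 fun h5 => h4 h5.symm with h6 | h6
          · exact hne h6
          · exact h2 ⟨rfl, h6.symm⟩
        · exact fun h => h1 h.symm

end Retraction

/-! ### The topology for `⋆`-periodic kneading sequences -/

section Periodic

variable {h : FatouMaps A}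

/-- The coarsest topology for which the retractions to the edges are continuous. -/
@[reducible] def edgeTopology (h : FatouMaps A) (ν : Itin A) : TopologicalSpace (hubbardTree h ν) :=
  ⨅ (x : Itin A) (ρ : Itin A) (_ : IsEdge ν x ρ),
    TopologicalSpace.induced (fun w => retr ν x ρ w.1) inferInstance

theorem continuous_edgeTopology_iff {Y : Type*} [tY : TopologicalSpace Y]
    {f : Y → hubbardTree h ν} : Continuous[tY, edgeTopology h ν] f ↔
      ∀ x ρ, IsEdge ν x ρ → Continuous fun y => retr ν x ρ (f y).1 := by
  refine continuous_iInf_rng.trans (forall_congr' fun x => continuous_iInf_rng.trans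
    (forall_congr' fun ρ => continuous_iInf_rng.trans (forall_congr' fun _ => ?_)))
  exact continuous_induced_rng

theorem continuous_retr_edgeTopology {x ρ : Itin A} (he : IsEdge ν x ρ) :
    Continuous[edgeTopology h ν, _] fun w : hubbardTree h ν => retr ν x ρ w.1 :=
  (continuous_edgeTopology_iff (tY := edgeTopology h ν) (f := id)).1 (@continuous_id _ (_)) x ρ he

theorem isOpen_sym (hK : IsKneading ν) (hP : IsStarPeriodic ν) {o : Option A} (ho : o ≠ none) :
    IsOpen[edgeTopology h ν] {w : hubbardTree h ν | sym w.1 = o} := by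
  let _ : TopologicalSpace (hubbardTree h ν) := edgeTopology h ν
  rw [isOpen_iff_mem_nhds]
  intro w hw
  have hw' : sym w.1 = o := hw
  obtain ⟨x, he, hx⟩ := exists_retr_lt hK hP ((mem_hubbardTree_iff hK).1 w.2) (hw' ▸ ho)
  have hx0 := sym_eq_of_retr_lt he ((mem_hubbardTree_iff hK).1 w.2) hx
  have hop : IsOpen {w : hubbardTree h ν | retr ν x (critPt ν) w.1 < 1} :=
    isOpen_lt (continuous_retr_edgeTopology he) continuous_const
  refine mem_of_superset (hop.mem_nhds hx) fun w' hw' => ?_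
  show sym w'.1 = o
  rw [sym_eq_of_retr_lt he ((mem_hubbardTree_iff hK).1 w'.2) hw', ← hx0]
  exact hw

theorem isClosed_hasHead (hK : IsKneading ν) (hP : IsStarPeriodic ν) (o : Option A) :
    IsClosed[edgeTopology h ν] {w : hubbardTree h ν | HasHead ν o w.1} := by
  let _ : TopologicalSpace (hubbardTree h ν) := edgeTopology h ν
  have h1 : {w : hubbardTree h ν | HasHead ν o w.1}ᶜ =
      ⋃ f : {f : Option A // f ≠ o ∧ f ≠ none}, {w : hubbardTree h ν | sym w.1 = f.1} := by
    ext w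
    simp only [HasHead, mem_compl_iff, mem_ofPred_eq, mem_iUnion, (mem_hubbardTree_iff hK).1 w.2,
      true_and, not_or]
    constructor
    · intro h2; exact ⟨⟨_, h2⟩, rfl⟩
    · rintro ⟨f, hf⟩; rw [hf]; exact f.2
  rw [← isOpen_compl_iff, h1]
  exact isOpen_iUnion fun f => isOpen_sym hK hP f.2.2

theorem continuous_treeMap_edgeTopology (hK : IsKneading ν) (hP : IsStarPeriodic ν) :
    Continuous[edgeTopology h ν, edgeTopology h ν] (treeMap h ν) := by
  refine (continuous_edgeTopology_iff (tY := edgeTopology h ν)).2 fun x ρ he => ?_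
  let _ : TopologicalSpace (hubbardTree h ν) := edgeTopology h ν
  have : Finite (range ν) := hP.finite_range
  have htp : ∀ w : hubbardTree h ν, IsTreePt ν w.1 := fun w => (mem_hubbardTree_iff hK).1 w.2
  refine (locallyFinite_of_finite fun o : range ν =>
    {w : hubbardTree h ν | HasHead ν o w.1}).continuous ?_ (fun o => isClosed_hasHead hK hP o) ?_
  · rw [eq_univ_iff_forall]
    intro w
    have h1 : sym w.1 = none ∨ sym w.1 ∈ range ν := by
      rcases htp w with ⟨z, hz, h1⟩ | ⟨y, η, t, hE, h1⟩
      · rw [h1]; exact head_mem_range hz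
      · rw [h1]; exact head_mem_range hE.left_mem
    rcases h1 with h1 | h1
    · obtain ⟨j, hj⟩ := hP.exists_none
      exact mem_iUnion.2 ⟨⟨ν j, mem_range_self j⟩, htp w, Or.inr h1⟩
    · exact mem_iUnion.2 ⟨⟨_, h1⟩, htp w, Or.inl rfl⟩
  · rintro ⟨o, -⟩
    by_cases ho : o = none
    · refine (continuousOn_const (c := retr ν x ρ (ptShift h (.itin (critPt ν))))).congr ?_
      intro w hw
      have h1 : sym w.1 = none := hw.2.elim (fun h => h.trans ho) id
      show retr ν x ρ (ptShift h w.1) = _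
      rw [(htp w).sym_eq_none h1]
    · rcases exists_retr_ptShift hK h he ho with ⟨c, hc⟩ | ⟨x', ρ', he', H, hH, hw⟩
      · exact (continuousOn_const (c := c)).congr fun w hw => hc w.1 hw
      · exact (hH.comp (continuous_retr_edgeTopology he')).continuousOn.congr fun w hw' => hw w.1 hw'

/-! ### The topology of the critical path -/

theorem pathLt_iff (hK : IsKneading ν) (hP : IsStarPeriodic ν) {F : Chain ν (critPt ν) ν → ℝ}
    {γ : unitInterval → Pt A} (hγ : IsArc ν (critPt ν) ν F γ) {s s' : unitInterval} :
    pathLt ν (γ s) (γ s') ↔ s < s' := by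
  have hlt : ∀ u v : Chain ν (critPt ν) ν, itinLt ν u.val v.val ↔ F u < F v := fun u v => by
    rw [itinLt_iff hK hP u.property v.property, cLt_iff u.property v.property,
      hγ.strictMono.lt_iff_lt]
  have hle : ∀ u v : Chain ν (critPt ν) ν, itinLe ν u.val v.val ↔ F u ≤ F v := fun u v => by
    rw [itinLe, hlt, le_iff_lt_or_eq, or_comm, hγ.strictMono.injective.eq_iff]
    exact or_congr Iff.rfl ⟨fun e => Chain.ext e, fun e => by rw [e]⟩
  rw [← Subtype.coe_lt_coe]
  rcases hγ.cases s with ⟨u, hu, h1⟩ | ⟨y, η, t, he, h2, h3, h1⟩ <;>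
    rcases hγ.cases s' with ⟨u', hu', h1'⟩ | ⟨y', η', t', he', h2', h3', h1'⟩
  · rw [h1, h1', pathLt, hlt, hu, hu']
  · rw [h1, h1', pathLt, hle, hle, ← hu]
    obtain ⟨g1, g2⟩ := not_or.1 (hγ.not_gap hK he' u)
    rcases h2' with ⟨h4, h5⟩ | ⟨h4, h5⟩
    · constructor
      · rintro ⟨h6, -⟩; linarith
      · intro h6
        have h7 : F u ≤ F y' := not_lt.1 fun h7 => g1 ⟨h7, h6.trans h5⟩
        exact ⟨h7, by linarith⟩
    · constructor
      · rintro ⟨-, h6⟩; linarith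
      · intro h6
        have h7 : F u ≤ F η' := not_lt.1 fun h7 => g2 ⟨h7, h6.trans h5⟩
        exact ⟨by linarith, h7⟩
  · rw [h1, h1', pathLt, hle, hle, ← hu']
    obtain ⟨g1, g2⟩ := not_or.1 (hγ.not_gap hK he u')
    rcases h2 with ⟨h4, h5⟩ | ⟨h4, h5⟩
    · constructor
      · rintro ⟨-, h6⟩; linarith
      · intro h6
        have h7 : F η ≤ F u' := not_lt.1 fun h7 => g1 ⟨h4.trans h6, h7⟩
        exact ⟨by linarith, h7⟩
    · constructor
      · rintro ⟨h6, -⟩; linarith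
      · intro h6
        have h7 : F y ≤ F u' := not_lt.1 fun h7 => g2 ⟨h4.trans h6, h7⟩
        exact ⟨h7, by linarith⟩
  · rw [h1, h1', pathLt, hle, hle, hle, hle, hlt, hlt]
    by_cases hsame : y = y' ∧ η = η'
    · obtain ⟨rfl, rfl⟩ := hsame
      simp only [true_and]
      rw [← Subtype.coe_lt_coe, ← Subtype.coe_lt_coe, h3, h3']
      rcases h2 with ⟨h4, h5⟩ | ⟨h4, h5⟩
      · have hd : 0 < F η - F y := by linarith
        rw [div_lt_div_iff_of_pos_right hd]
        constructor
        · rintro ((⟨-, h6⟩ | ⟨h6, -⟩) | ⟨-, -, h6, -⟩) <;> linarith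
        · intro h6; exact Or.inl (Or.inl ⟨by linarith, by linarith⟩)
      · have hd : F η - F y < 0 := by linarith
        rw [div_lt_div_right_of_neg hd, div_lt_div_right_of_neg hd]
        constructor
        · rintro ((⟨h6, -⟩ | ⟨-, h6⟩) | ⟨-, h6, -, -⟩) <;> linarith
        · intro h6; exact Or.inl (Or.inr ⟨by linarith, by linarith⟩)
    · have hns : ¬ (y.val = y'.val ∧ η.val = η'.val ∧
          ((F y < F η ∧ t < t') ∨ (F η < F y ∧ t' < t))) :=
        fun h => hsame ⟨Chain.ext h.1, Chain.ext h.2.1⟩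
      rw [or_iff_right hns]
      have hun : ∀ r : ℝ, ((F y < r ∧ r < F η) ∨ (F η < r ∧ r < F y)) →
          ((F y' < r ∧ r < F η') ∨ (F η' < r ∧ r < F y')) → False := fun r h4 h5 =>
        hsame (hγ.edge_unique hK he he' h4 h5)
      have g := fun u => not_or.1 (hγ.not_gap hK he' u)
      rcases h2 with ⟨h4, h5⟩ | ⟨h4, h5⟩ <;> rcases h2' with ⟨h4', h5'⟩ | ⟨h4', h5'⟩
      · constructor
        · rintro ⟨-, -, h6, -⟩; linarith
        · intro h6
          have h7 : F η ≤ F y' := not_lt.1 fun h7 =>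
            hun s' (Or.inl ⟨by linarith, h5'.trans_le
              (not_lt.1 fun h8 => (g η).1 ⟨h7, h8⟩)⟩) (Or.inl ⟨h4', h5'⟩)
          refine ⟨?_, ?_, h7, ?_⟩ <;> linarith
      · constructor
        · rintro ⟨-, -, -, h6⟩; linarith
        · intro h6
          have h7 : F η ≤ F η' := not_lt.1 fun h7 =>
            hun s' (Or.inl ⟨by linarith, h5'.trans_le
              (not_lt.1 fun h8 => (g η).2 ⟨h7, h8⟩)⟩) (Or.inr ⟨h4', h5'⟩)
          refine ⟨?_, ?_, ?_, h7⟩ <;> linarith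
      · constructor
        · rintro ⟨h6, -, -, -⟩; linarith
        · intro h6
          have h7 : F y ≤ F y' := not_lt.1 fun h7 =>
            hun s' (Or.inr ⟨by linarith, h5'.trans_le
              (not_lt.1 fun h8 => (g y).1 ⟨h7, h8⟩)⟩) (Or.inl ⟨h4', h5'⟩)
          refine ⟨h7, ?_, ?_, ?_⟩ <;> linarith
      · constructor
        · rintro ⟨-, h6, -, -⟩; linarith
        · intro h6
          have h7 : F y ≤ F η' := not_lt.1 fun h7 =>
            hun s' (Or.inr ⟨by linarith, h5'.trans_le
              (not_lt.1 fun h8 => (g y).2 ⟨h7, h8⟩)⟩) (Or.inr ⟨h4', h5'⟩)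
          refine ⟨?_, h7, ?_, ?_⟩ <;> linarith

/-- The critical path is an interval. -/
theorem exists_critPath_param (hK : IsKneading ν) (hP : IsStarPeriodic ν) :
    ∃ F γ, IsArc ν (critPt ν) ν F γ ∧ ∃ g : unitInterval → critPath ν, (∀ s, (g s).1 = γ s) ∧
      Function.Surjective g ∧
      TopologicalSpace.induced g (pathTopology ν) = (inferInstance : TopologicalSpace unitInterval) := by
  obtain ⟨F, γ, hγ⟩ := exists_isArc hK (critPt_mem_treeItin hK) (critVal_mem hK) hK.critPt_ne
  have hmem : ∀ s, γ s ∈ critPath ν := by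
    intro s
    rcases hγ.cases s with ⟨u, -, h1⟩ | ⟨y, η, t, he, -, -, h1⟩
    · exact Or.inl ⟨u.val, (mem_pathItin_iff hK).2 u.property, h1⟩
    · exact Or.inr ⟨y.val, η.val, t, (fatouPair_iff hK).2 ⟨he, y.property.2, η.property.2⟩, h1⟩
  have hsurj : Function.Surjective fun s => (⟨γ s, hmem s⟩ : critPath ν) := by
    rintro ⟨w, ⟨x, hx, rfl⟩ | ⟨x, ρ, t, he, rfl⟩⟩
    · exact ⟨_, Subtype.ext (hγ.apply_itin hK ⟨x, (mem_pathItin_iff hK).1 hx⟩)⟩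
    · obtain ⟨hE, hx, hρ⟩ := (fatouPair_iff hK).1 he
      obtain ⟨s, -, hs⟩ := hγ.apply_fatou hK (x := ⟨x, hE.left_mem.1, hx⟩)
        (ρ := ⟨ρ, hE.right_mem.1, hρ⟩) hE t
      exact ⟨s, Subtype.ext hs⟩
  refine ⟨F, γ, hγ, fun s => ⟨γ s, hmem s⟩, fun s => rfl, hsurj, ?_⟩
  rw [pathTopology, induced_generateFrom_eq]
  refine Eq.trans ?_ (OrderTopology.topology_eq_generate_intervals (α := unitInterval)).symm
  congr 1
  ext V
  simp only [mem_image, mem_ofPred_eq]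
  constructor
  · rintro ⟨-, ⟨u, rfl | rfl⟩, rfl⟩
    · obtain ⟨s, rfl⟩ := hsurj u
      exact ⟨s, Or.inl (Set.ext fun s' => pathLt_iff hK hP hγ)⟩
    · obtain ⟨s, rfl⟩ := hsurj u
      exact ⟨s, Or.inr (Set.ext fun s' => pathLt_iff hK hP hγ)⟩
  · rintro ⟨s, rfl | rfl⟩
    · exact ⟨_, ⟨⟨γ s, hmem s⟩, Or.inl rfl⟩, Set.ext fun s' => pathLt_iff hK hP hγ⟩
    · exact ⟨_, ⟨⟨γ s, hmem s⟩, Or.inr rfl⟩, Set.ext fun s' => pathLt_iff hK hP hγ⟩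

theorem continuous_treePt_edgeTopology (hK : IsKneading ν) {a b : Itin A}
    {F : Chain ν a b → ℝ} {γ : unitInterval → Pt A} (ha : a ∈ treeItin ν) (hb : b ∈ treeItin ν)
    (hγ : IsArc ν a b F γ) (hw : ∀ s, IsTreePt ν (γ s)) :
    Continuous[_, edgeTopology h ν] fun s => treePt h hK (hw s) :=
  continuous_edgeTopology_iff.2 fun _ _ he => (hγ.retr_continuous hK ha hb he).1

theorem t2Space_edgeTopology (hK : IsKneading ν) (hP : IsStarPeriodic ν) :
    @T2Space _ (edgeTopology h ν) := by
  let _ : TopologicalSpace (hubbardTree h ν) := edgeTopology h ν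
  refine ⟨fun w w' hne => ?_⟩
  obtain ⟨x, ρ, he, h1⟩ := exists_retr_ne hK hP ((mem_hubbardTree_iff hK).1 w.2)
    ((mem_hubbardTree_iff hK).1 w'.2) fun e => hne (Subtype.ext e)
  exact separated_by_continuous (continuous_retr_edgeTopology he) h1

theorem treeTopology_eq_iSup (hP : IsStarPeriodic ν) : treeTopology h ν =
    ⨆ k : Fin (Function.minimalPeriod shift ν),
      TopologicalSpace.coinduced (pathToTree h ν k) (pathTopology ν) := if_pos hP

theorem eq_induced_of_compactSpace_of_t2Space {X Y : Type*} [t : TopologicalSpace X]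
    [t' : TopologicalSpace Y] [CompactSpace X] [T2Space Y] {f : X → Y} (hf : Continuous f)
    (hi : Function.Injective f) : t = t'.induced f :=
  (hf.isClosedEmbedding hi).isInducing.eq_induced

theorem compactSpace_and_eq (hK : IsKneading ν) (hP : IsStarPeriodic ν) :
    CompactSpace (hubbardTree h ν) ∧ treeTopology h ν = edgeTopology h ν := by
  obtain ⟨F, γ, hγ, g, hg, hsurj, hind⟩ := exists_critPath_param hK hP
  have hw := hγ.isTreePt (critPt_mem_treeItin hK) (critVal_mem hK)
  have hcont : ∀ k, Continuous[_, edgeTopology h ν] fun s => pathToTree h ν k (g s) := by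
    intro k
    induction k with
    | zero =>
      have h1 : (fun s => pathToTree h ν 0 (g s)) = fun s => treePt h hK (hw s) :=
        funext fun s => Subtype.ext (hg s)
      rw [h1]
      exact continuous_treePt_edgeTopology hK (critPt_mem_treeItin hK) (critVal_mem hK) hγ hw
    | succ k ih =>
      have h1 : (fun s => pathToTree h ν (k + 1) (g s)) =
          treeMap h ν ∘ fun s => pathToTree h ν k (g s) :=
        funext fun s => Subtype.ext (Function.iterate_succ_apply' _ _ _)
      rw [h1]
      exact @Continuous.comp _ _ _ _ (edgeTopology h ν) (edgeTopology h ν) _ _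
        (continuous_treeMap_edgeTopology hK hP) ih
  have hgc : Continuous[_, pathTopology ν] g := by
    rw [continuous_iff_le_induced, hind]
  have hle : treeTopology h ν ≤ edgeTopology h ν := by
    rw [treeTopology_eq_iSup hP]
    refine iSup_le fun k => ?_
    intro V hV
    show IsOpen[pathTopology ν] (pathToTree h ν k ⁻¹' V)
    have h1 : IsOpen (g ⁻¹' (pathToTree h ν k ⁻¹' V)) :=
      @IsOpen.preimage _ _ _ (edgeTopology h ν) _ (hcont k) _ hV
    have h1' : IsOpen[TopologicalSpace.induced g (pathTopology ν)]
        (g ⁻¹' (pathToTree h ν k ⁻¹' V)) := by rw [hind]; exact h1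
    obtain ⟨V', hV', h2⟩ := h1'
    rwa [hsurj.preimage_injective h2] at hV'
  have hcomp : CompactSpace (hubbardTree h ν) := by
    obtain ⟨p, hp0, hp, horb⟩ := hP.exists_period
    refine ⟨?_⟩
    have hun : (univ : Set (hubbardTree h ν)) =
        ⋃ k : Fin (Function.minimalPeriod shift ν), range fun s => pathToTree h ν k (g s) := by
      symm
      rw [eq_univ_iff_forall]
      intro w
      obtain ⟨n, hn, c, hc, h1⟩ := exists_critPath_lt hK h hp0 horb ((mem_hubbardTree_iff hK).1 w.2)
      obtain ⟨s, hs⟩ := hsurj ⟨c, hc⟩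
      refine mem_iUnion.2 ⟨⟨n, hp ▸ hn⟩, s, Subtype.ext ?_⟩
      show (ptShift h)^[n] (g s).1 = w.1
      rw [hs, h1]
    rw [hun]
    refine isCompact_iUnion fun k => isCompact_range ?_
    have h1 : Continuous[pathTopology ν, treeTopology h ν] (pathToTree h ν k) := by
      rw [treeTopology_eq_iSup hP, continuous_iff_coinduced_le]
      exact le_iSup (fun k : Fin (Function.minimalPeriod shift ν) =>
        TopologicalSpace.coinduced (pathToTree h ν k) (pathTopology ν)) k
    exact @Continuous.comp _ _ _ _ (pathTopology ν) _ _ _ h1 hgc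
  refine ⟨hcomp, ?_⟩
  have h1 := @eq_induced_of_compactSpace_of_t2Space _ _ (treeTopology h ν) (edgeTopology h ν) hcomp
    (t2Space_edgeTopology hK hP) id (continuous_id_iff_le.2 hle) Function.injective_id
  exact h1.trans (@induced_id _ (edgeTopology h ν))

theorem IsStarPeriodic.continuous_treeMap (hK : IsKneading ν) (hP : IsStarPeriodic ν) :
    Continuous (treeMap h ν) := by
  rw [(compactSpace_and_eq hK hP).2]
  exact continuous_treeMap_edgeTopology hK hP

theorem continuous_retr (hK : IsKneading ν) {x ρ : Itin A} (he : IsEdge ν x ρ) :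
    Continuous fun w : hubbardTree h ν => retr ν x ρ w.1 := by
  rw [(compactSpace_and_eq hK (he.isStarPeriodic hK)).2]
  exact continuous_retr_edgeTopology he

theorem IsStarPeriodic.exists_isEmbedding (hK : IsKneading ν) (hP : IsStarPeriodic ν)
    (w : hubbardTree h ν) (hw : w ≠ treeCrit h ν) :
    ∃ U : Set (hubbardTree h ν), IsOpen U ∧ w ∈ U ∧ IsEmbedding (U.domRestrict (treeMap h ν)) := by
  obtain ⟨hcomp, heq⟩ := compactSpace_and_eq (h := h) hK hP
  have htp : ∀ w : hubbardTree h ν, IsTreePt ν w.1 := fun w => (mem_hubbardTree_iff hK).1 w.2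
  have hs : sym w.1 ≠ none := fun h0 => hw (Subtype.ext ((htp w).sym_eq_none h0))
  have hopen : IsOpen {w' : hubbardTree h ν | sym w'.1 = sym w.1} := by
    rw [heq]; exact isOpen_sym hK hP hs
  have hclosed : IsClosed {w' : hubbardTree h ν | HasHead ν (sym w.1) w'.1} := by
    rw [heq]; exact isClosed_hasHead hK hP _
  have ht2 : T2Space (hubbardTree h ν) := by rw [heq]; exact t2Space_edgeTopology hK hP
  refine ⟨_, hopen, rfl, ?_⟩
  have hsub : {w' : hubbardTree h ν | sym w'.1 = sym w.1} ⊆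
      {w' : hubbardTree h ν | HasHead ν (sym w.1) w'.1} := fun w' hw' => ⟨htp w', Or.inl hw'⟩
  have hC : CompactSpace {w' : hubbardTree h ν | HasHead ν (sym w.1) w'.1} :=
    isCompact_iff_compactSpace.1 hclosed.isCompact
  have hemb : IsEmbedding
      ({w' : hubbardTree h ν | HasHead ν (sym w.1) w'.1}.domRestrict (treeMap h ν)) := by
    refine (((hP.continuous_treeMap hK).comp continuous_subtype_val).isClosedEmbedding ?_).isEmbedding
    rintro ⟨v, hv⟩ ⟨v', hv'⟩ he
    have he' : ptShift h v.1 = ptShift h v'.1 := congrArg Subtype.val he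
    refine Subtype.ext (Subtype.ext ?_)
    have key : ∀ v v' : hubbardTree h ν, ptShift h v.1 = ptShift h v'.1 → sym v.1 = none →
        v.1 = v'.1 := by
      intro v v' he' h0
      have h1 := (htp v).sym_eq_none h0
      rw [h1] at he' ⊢
      exact (eq_critPt_of_ptShift (htp v') he'.symm).symm
    rcases hv.2 with h0 | h0
    · rcases hv'.2 with h0' | h0'
      · exact eq_of_ptShift_eq (htp v) (htp v') (h0.trans h0'.symm) he'
      · exact (key v' v he'.symm h0').symm
    · exact key v v' he' h0
  exact hemb.comp (IsEmbedding.inclusion hsub)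

end Periodic

theorem not_three_le_card_connectedComponents {X : Type*} [TopologicalSpace X] {p q : X}
    {K L : Set X} (hK : IsPreconnected K) (hL : IsPreconnected L) (hp : p ∈ K) (hq : q ∈ L)
    (hKL : K ∪ L = univ) : ¬ 3 ≤ ENat.card (ConnectedComponents X) := by
  have hs : Function.Surjective fun i : Bool => (ConnectedComponents.mk (if i then p else q)) := by
    intro c
    obtain ⟨w, rfl⟩ := ConnectedComponents.surjective_coe c
    rcases (hKL ▸ mem_univ w : w ∈ K ∪ L) with hw | hw
    · exact ⟨true, ConnectedComponents.coe_eq_coe'.2 (hK.subset_connectedComponent hw hp)⟩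
    · exact ⟨false, ConnectedComponents.coe_eq_coe'.2 (hL.subset_connectedComponent hw hq)⟩
  have : Finite (ConnectedComponents X) := Finite.of_surjective _ hs
  have h1 := Nat.card_le_card_of_surjective _ hs
  rw [Nat.card_eq_fintype_card (α := Bool), Fintype.card_bool] at h1
  rw [ENat.card_eq_coe_natCard, ← Nat.cast_ofNat, Nat.cast_le]
  omega

theorem isPreconnected_preimage_val {X : Type*} [TopologicalSpace X] {S K : Set X}
    (hK : IsPreconnected K) (hKS : K ⊆ S) : IsPreconnected ((↑) ⁻¹' K : Set S) := by
  rw [← IsInducing.subtypeVal.isPreconnected_image, Subtype.image_preimage_coe,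
    inter_eq_right.2 hKS]
  exact hK

section Periodic

variable {h : FatouMaps A} {x ρ z : Itin A}

theorem same_rep_of_retr_ne (hν : Adm ν ν) (he : IsEdge ν x ρ) (hz : Adm ν z) {w : Pt A} (hw : IsTreePt ν w)
    (hne : retr ν x ρ w ≠ retr ν x ρ (.itin z)) :
    (¬ Same ν x z ρ → Same ν z (rep z w) ρ) ∧ (Same ν x z ρ → Same ν z (rep z w) x) := by
  have hx := he.left_mem.1
  by_cases hE : ∃ t, w = .fatou x ρ t
  · obtain ⟨t, rfl⟩ := hE
    simp only [rep]
    refine ⟨fun h1 => ?_, fun h1 => ?_⟩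
    · split_ifs with h2
      · exact Same.eq _ _
      · by_contra h3
        rcases he.eq_or_eq hz h3 with h4 | h4
        · exact h2 h4
        · exact h1 (h4 ▸ Same.eq _ _)
    · split_ifs with h2
      · subst h2
        exact absurd h1 (not_same_self hν hz he.right_mem.1 he.ne.symm)
      · exact Same.eq _ _
  · rw [retr_of_ne fun t ht => hE ⟨t, ht⟩, retr_itin] at hne
    refine ⟨fun h1 => ?_, fun h1 => ?_⟩
    · have h2 : Same ν x (rep x w) ρ := by
        by_contra h2; rw [if_neg h1, if_neg h2] at hne; exact hne rfl
      by_cases hzx : z = x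
      · subst hzx; exact h2
      have h3 : Same ν z x ρ := by
        by_contra h3
        exact (he.eq_or_eq hz h3).elim hzx fun h4 => h1 (h4 ▸ Same.eq _ _)
      have h4 : Same ν z (rep x w) ρ := by
        rcases same_or_same hz hx hzx (rep x w) with h4 | h4
        · exact h4.trans h3
        · exact absurd (h4.symm.trans h2) h1
      rcases hw with ⟨y, hy, rfl⟩ | ⟨y, η, t, hE', rfl⟩
      · exact h4
      · by_cases hzy : z = y
        · simp only [rep, if_neg fun e : x = y => hzx (hzy.trans e.symm)] at h2
          exact absurd (hzy ▸ h2) h1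
        · simp only [rep, if_neg hzy] at h4 ⊢
          split_ifs at h4 with hxy
          · exact hxy ▸ h3
          · exact h4
    · have h2 : ¬ Same ν x (rep x w) ρ := by
        intro h2; rw [if_pos h1, if_pos h2] at hne; exact hne rfl
      by_cases hzx : z = x
      · subst hzx
        exact absurd h1 (not_same_self hν hz he.right_mem.1 he.ne.symm)
      have h4 : Same ν z (rep x w) x := by
        rcases same_or_same hz hx hzx (rep x w) with h4 | h4
        · exact h4
        · exact absurd (h4.trans h1) h2
      rcases hw with ⟨y, hy, rfl⟩ | ⟨y, η, t, hE', rfl⟩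
      · exact h4
      · by_cases hzy : z = y
        · simp only [rep, if_neg fun e : x = y => hzx (hzy.trans e.symm)] at h2
          exact absurd (hzy ▸ h1) h2
        · simp only [rep, if_neg hzy] at h4 ⊢
          split_ifs at h4 with hxy
          · exact hxy ▸ Same.eq _ _
          · exact h4

theorem IsStarPeriodic.separates_itin (hK : IsKneading ν) (hP : IsStarPeriodic ν) {u v : Itin A}
    (hz : z ∈ treeItin ν) (hu : u ∈ treeItin ν) (hv : v ∈ treeItin ν) (h1 : ¬ Same ν z u v) :
    Separates (itinPt h hK hz) (itinPt h hK hu) (itinPt h hK hv) := by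
  refine ⟨fun w => Same ν z (rep z w.1) u, fun w hw => ?_, Same.eq _ _, fun h2 => h1 h2.symm⟩
  have htp : ∀ w : hubbardTree h ν, IsTreePt ν w.1 := fun w => (mem_hubbardTree_iff hK).1 w.2
  obtain ⟨x, ρ, he, h2⟩ := exists_retr_ne hK hP (htp w) (Or.inl ⟨z, hz, rfl⟩)
    fun e => hw (Subtype.ext e)
  filter_upwards [((continuous_retr hK he).continuousAt (x := w)).eventually_ne h2] with w' h3
  have h4 := same_rep_of_retr_ne hK.adm he hz.1 (htp w) h2
  have h5 := same_rep_of_retr_ne hK.adm he hz.1 (htp w') h3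
  by_cases hs : Same ν x z ρ
  · exact ⟨fun h6 => ((h4.2 hs).trans (h5.2 hs).symm).trans h6,
      fun h6 => ((h5.2 hs).trans (h4.2 hs).symm).trans h6⟩
  · exact ⟨fun h6 => ((h4.1 hs).trans (h5.1 hs).symm).trans h6,
      fun h6 => ((h5.1 hs).trans (h4.1 hs).symm).trans h6⟩

theorem retr_ne_of_ne_edgePt (hK : IsKneading ν) (he : IsEdge ν x ρ) {t : Ioo (0 : ℝ) 1}
    {w : hubbardTree h ν} (hw : w ≠ edgePt h hK he t) : retr ν x ρ w.1 ≠ t := fun e =>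
  hw (Subtype.ext (retr_eq_iff e))

theorem separates_edge (hK : IsKneading ν) (he : IsEdge ν x ρ) (t : Ioo (0 : ℝ) 1) {u v : Itin A}
    (hu : u ∈ treeItin ν) (hv : v ∈ treeItin ν) (h1 : Same ν x u ρ) (h2 : ¬ Same ν x v ρ) :
    Separates (edgePt h hK he t) (itinPt h hK hu) (itinPt h hK hv) := by
  refine ⟨fun w => (t : ℝ) < retr ν x ρ w.1, fun w hw => ?_, ?_, ?_⟩
  · have hc := (continuous_retr (h := h) hK he).continuousAt (x := w)
    rcases lt_or_gt_of_ne (retr_ne_of_ne_edgePt hK he hw) with h3 | h3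
    · filter_upwards [hc.eventually_lt_const h3] with w' h4
      exact ⟨fun h5 => absurd h4 h5.asymm, fun h5 => absurd h3 h5.asymm⟩
    · filter_upwards [hc.eventually_const_lt h3] with w' h4
      exact ⟨fun _ => h3, fun _ => h4⟩
  · show (t : ℝ) < retr ν x ρ (.itin u)
    rw [retr_itin, if_pos h1]
    exact t.2.2
  · show ¬ (t : ℝ) < retr ν x ρ (.itin v)
    rw [retr_itin, if_neg h2]
    exact t.2.1.asymm

/-- Every point of the tree is on an arc through a given itinerary. -/
theorem exists_isArc_through (hK : IsKneading ν) {c : Itin A} (hc : c ∈ treeItin ν) {w : Pt A}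
    (hw : IsTreePt ν w) : ∃ a ∈ treeItin ν, ∃ b ∈ treeItin ν, ∃ F γ, IsArc ν a b F γ ∧
      (∃ s, γ s = .itin c) ∧ ∃ s, γ s = w := by
  rcases hw with ⟨v, hv, rfl⟩ | ⟨y, η, t, he, rfl⟩
  · have key : ∀ v ∈ treeItin ν, c ≠ v → ∃ a ∈ treeItin ν, ∃ b ∈ treeItin ν, ∃ F γ,
        IsArc ν a b F γ ∧ (∃ s, γ s = .itin c) ∧ ∃ s, γ s = .itin v := by
      intro v hv hcv
      obtain ⟨F, γ, hγ⟩ := exists_isArc hK hc hv hcv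
      exact ⟨c, hc, v, hv, F, γ, hγ, ⟨0, hγ.apply_zero hK hc hv hcv⟩,
        ⟨1, hγ.apply_one hK hc hv hcv⟩⟩
    by_cases hcv : c = v
    · obtain ⟨o, ho, hco⟩ : ∃ o ∈ treeItin ν, c ≠ o := by
        by_cases h1 : c = ν
        · exact ⟨_, critPt_mem_treeItin hK, fun e => hK.critPt_ne (e.symm.trans h1)⟩
        · exact ⟨ν, critVal_mem hK, h1⟩
      obtain ⟨a, ha, b, hb, F, γ, h1, h2, -⟩ := key o ho hco
      exact ⟨a, ha, b, hb, F, γ, h1, h2, hcv ▸ h2⟩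
    · exact key v hv hcv
  · have hν := hK.adm
    rcases he.not_same_or hK hc with h1 | h1
    · have hne : c ≠ η := fun e => h1 (e ▸ Same.eq _ _)
      obtain ⟨F, γ, hγ⟩ := exists_isArc hK hc he.right_mem hne
      obtain ⟨s, -, hs⟩ := hγ.apply_fatou hK (x := ⟨y, he.left_mem.1, h1⟩)
        (ρ := ⟨η, he.right_mem.1, not_same_self' hν he.right_mem.1 hc.1 hne⟩) he t
      exact ⟨c, hc, η, he.right_mem, F, γ, hγ, ⟨0, hγ.apply_zero hK hc he.right_mem hne⟩, s, hs⟩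
    · have hne : c ≠ y := fun e => h1 (e ▸ Same.eq _ _)
      obtain ⟨F, γ, hγ⟩ := exists_isArc hK hc he.left_mem hne
      obtain ⟨s, -, hs⟩ := hγ.apply_fatou hK (ρ := ⟨η, he.right_mem.1, h1⟩)
        (x := ⟨y, he.left_mem.1, not_same_self' hν he.left_mem.1 hc.1 hne⟩) he t
      exact ⟨c, hc, y, he.left_mem, F, γ, hγ, ⟨0, hγ.apply_zero hK hc he.left_mem hne⟩, s, hs⟩

theorem IsStarPeriodic.continuous_arc (hK : IsKneading ν) (hP : IsStarPeriodic ν) {a b : Itin A}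
    {F : Chain ν a b → ℝ} {γ : unitInterval → Pt A} (ha : a ∈ treeItin ν) (hb : b ∈ treeItin ν)
    (hγ : IsArc ν a b F γ) (hw : ∀ s, IsTreePt ν (γ s)) :
    Continuous fun s => treePt h hK (hw s) := by
  rw [(compactSpace_and_eq hK hP).2]
  exact continuous_treePt_edgeTopology hK ha hb hγ hw

theorem isPreconnected_retr_preimage (hK : IsKneading ν) (he : IsEdge ν x ρ) {c : Itin A}
    (hc : c ∈ treeItin ν) {I : Set ℝ} (hI : I.OrdConnected) (hcI : retr ν x ρ (.itin c) ∈ I) :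
    IsPreconnected {w : hubbardTree h ν | retr ν x ρ w.1 ∈ I} := by
  refine isPreconnected_of_forall (itinPt h hK hc) fun w hw => ?_
  obtain ⟨a, ha, b, hb, F, γ, hγ, ⟨s, hs⟩, s', hs'⟩ :=
    exists_isArc_through hK hc ((mem_hubbardTree_iff hK).1 w.2)
  have hw' := hγ.isTreePt ha hb
  have hpre : ((fun s => retr ν x ρ (γ s)) ⁻¹' I).OrdConnected :=
    (hγ.retr_continuous hK ha hb he).2.elim hI.preimage_mono hI.preimage_anti
  refine ⟨(fun s => treePt h hK (hw' s)) '' ((fun s => retr ν x ρ (γ s)) ⁻¹' I), ?_, ?_, ?_,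
    hpre.isPreconnected.image _
      ((he.isStarPeriodic hK).continuous_arc hK ha hb hγ hw').continuousOn⟩
  · rintro _ ⟨s, hs, rfl⟩; exact hs
  · exact ⟨s, by rw [mem_preimage, hs]; exact hcI, Subtype.ext hs⟩
  · exact ⟨s', by rw [mem_preimage, hs']; exact hw, Subtype.ext hs'⟩

theorem not_isBranchPoint_edgePt (hK : IsKneading ν) (he : IsEdge ν x ρ) (t : Ioo (0 : ℝ) 1) :
    ¬ IsBranchPoint (edgePt h hK he t) := by
  have hρ : retr ν x ρ (.itin ρ) ∈ Ioi (t : ℝ) := by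
    rw [retr_itin, if_pos (Same.eq _ _)]; exact t.2.2
  have hx : retr ν x ρ (.itin x) ∈ Iio (t : ℝ) := by
    rw [retr_itin, if_neg (not_same_self hK.adm he.left_mem.1 he.right_mem.1 he.ne.symm)]
    exact t.2.1
  have hne : ∀ I : Set ℝ, (t : ℝ) ∉ I →
      {w : hubbardTree h ν | retr ν x ρ w.1 ∈ I} ⊆ {edgePt h hK he t}ᶜ := by
    rintro I hI w hw (rfl : w = _)
    exact hI ((retr_edge t : retr ν x ρ _ = _) ▸ hw)
  refine not_three_le_card_connectedComponents
    (p := ⟨itinPt h hK he.right_mem, itinPt_ne_edgePt⟩)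
    (q := ⟨itinPt h hK he.left_mem, itinPt_ne_edgePt⟩)
    (isPreconnected_preimage_val (isPreconnected_retr_preimage hK he he.right_mem ordConnected_Ioi hρ)
      (hne _ (lt_irrefl (t : ℝ))))
    (isPreconnected_preimage_val (isPreconnected_retr_preimage hK he he.left_mem ordConnected_Iio hx)
      (hne _ (lt_irrefl (t : ℝ)))) hρ hx ?_
  rw [eq_univ_iff_forall]
  rintro ⟨w, hw⟩
  exact (lt_or_gt_of_ne (retr_ne_of_ne_edgePt hK he hw)).symm

theorem IsStarPeriodic.isTreeLike (hK : IsKneading ν) (hP : IsStarPeriodic ν) :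
    IsTreeLike hK h where
  t2 := by
    rw [(compactSpace_and_eq hK hP).2]
    exact t2Space_edgeTopology hK hP
  continuous_arc := hP.continuous_arc hK
  separates_itin hz hu hv _ _ h1 := hP.separates_itin hK hz hu hv h1
  separates_edge he t hu hv h1 h2 := separates_edge hK he t hu hv h1 h2
  not_isBranchPoint he t := not_isBranchPoint_edgePt hK he t

end Periodic

end Kneading

end

theorem mainTheorem5 {A : Type*} (d : ℕ∞) (hd : 2 ≤ d) (hA : ENat.card A = d)
    (ν : Kneading.Itin A) (hν : Kneading.IsKneading ν) (h : Kneading.FatouMaps A) :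
    -- continuity and surjectivity
    (Continuous (Kneading.treeMap h ν) ∧ Function.Surjective (Kneading.treeMap h ν)) ∧
    -- at most `d` inverse images
    (∀ y : Kneading.hubbardTree h ν, (Kneading.treeMap h ν ⁻¹' {y}).encard ≤ d) ∧
    -- local homeomorphism onto its image away from the critical point
    (∀ x : Kneading.hubbardTree h ν, x ≠ Kneading.treeCrit h ν →
      ∃ U : Set (Kneading.hubbardTree h ν), IsOpen U ∧ x ∈ U ∧
        Topology.IsEmbedding (U.domRestrict (Kneading.treeMap h ν))) ∧
    -- endpoints
    (∀ x : Kneading.hubbardTree h ν, Kneading.IsEndpoint x → x ∈ Kneading.critOrbit h ν) ∧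
    -- expansivity; the path `[x, y]` exists and is unique
    (∀ x y : Kneading.hubbardTree h ν, x ≠ y →
      (Kneading.IsBranchPoint x ∨ x ∈ Kneading.critOrbit h ν) →
      (Kneading.IsBranchPoint y ∨ y ∈ Kneading.critOrbit h ν) →
      (∃! P : Set (Kneading.hubbardTree h ν), Kneading.IsPathBetween P x y) ∧
      ∀ P : Set (Kneading.hubbardTree h ν), Kneading.IsPathBetween P x y →
        ∃ n : ℕ, Kneading.treeCrit h ν ∈ (Kneading.treeMap h ν)^[n] '' P) := by
  have hA' : 2 ≤ ENat.card A := hA ▸ hd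
  obtain ⟨hc, he, ht⟩ : Continuous (Kneading.treeMap h ν) ∧
      (∀ x : Kneading.hubbardTree h ν, x ≠ Kneading.treeCrit h ν →
        ∃ U : Set (Kneading.hubbardTree h ν), IsOpen U ∧ x ∈ U ∧
          Topology.IsEmbedding (U.domRestrict (Kneading.treeMap h ν))) ∧
      Kneading.IsTreeLike hν h := by
    rcases hν.1 with hN | hP
    · exact ⟨hN.continuous_treeMap hν, hN.exists_isEmbedding hν, hN.isTreeLike hν⟩
    · exact ⟨hP.continuous_treeMap hν, hP.exists_isEmbedding hν, hP.isTreeLike hν⟩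
  refine ⟨⟨hc, Kneading.surjective_treeMap hν h⟩, fun y => ?_, he, fun x hx => ht.mem_critOrbit hx,
    fun x y hxy hx hy => ht.expansive hxy hx hy⟩
  exact (Kneading.encard_preimage_le hν h hA' y).trans hA.le
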